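/- Let $k$ be an algebraically closed field of arbitrary characteristic, let $n\ge 3$, and let $X\subseteq\mathbb{P}^n_k$ be a smooth cubic hypersurface, i.e. a closed subscheme, smooth over $k$, whose ideal sheaf is generated by a nonzero homogeneous form of degree $3$ (so $\dim X=n-1\ge 2$). Call a $k$-morphism $h:\mathbb{P}^1_k\to X$ very free if $H^1(\mathbb{P}^1,(h^*T_X)(-2))=0$, where $T_X$ is the tangent bundle of $X$ over $k$. Then there is a very free $h:\mathbb{P}^1_k\to X$ whose image is contained in a plane (a $2$-dimensional linear subspace of $\mathbb{P}^n$) if $\operatorname{char}k\ne 2$, and in a $3$-dimensional linear subspace of $\mathbb{P}^n$ if $\operatorname{char}k=2$. In particular $X$ is separably rationally connected, i.e. $X$ is a smooth projective integral variety over $k$ that carries a very free curve $\mathbb{P}^1_k\to X$. -/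

import Mathlib

open AlgebraicGeometry CategoryTheory

universe u

noncomputable section

namespace CubicSRC

attribute [local instance] MvPolynomial.gradedAlgebra

/-! ### Projective space over a field -/

section ProjectiveSpace

variable (k : Type u) [Field k]

/-- The standard grading of the polynomial ring `k[x₀, …, xₙ]`. -/
abbrev grading (n : ℕ) : ℕ → Submodule k (MvPolynomial (Fin (n + 1)) k) :=
  MvPolynomial.homogeneousSubmodule (Fin (n + 1)) k

/-- Projective `n`-space `ℙⁿ = Proj k[x₀, …, xₙ]`. -/
abbrev PP (n : ℕ) : Scheme.{u} := Proj (grading k n)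

/-- The structure morphism `ℙⁿ ⟶ Spec k`. -/
def PP.toSpec (n : ℕ) : PP k n ⟶ Spec (.of k) :=
  Proj.toSpecZero (grading k n) ≫
    Spec.map (CommRingCat.ofHom (algebraMap k (grading k n 0)))

variable {k}

/-- The standard affine chart `D₊(x_j)` of `ℙⁿ`. -/
abbrev chart {n : ℕ} (j : Fin (n + 1)) : (PP k n).Opens :=
  Proj.basicOpen (grading k n) (MvPolynomial.X j)

/-- For a form `F` of degree `d`, the regular function `F / x_j ^ d` on the chart `D₊(x_j)`. -/
def dehomogenize {n d : ℕ} (F : MvPolynomial (Fin (n + 1)) k) (hF : F.IsHomogeneous d)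
    (j : Fin (n + 1)) : Γ(PP k n, chart j) :=
  Proj.awayToSection (grading k n) (MvPolynomial.X j)
    (HomogeneousLocalization.Away.mk (grading k n) (d := 1)
      (MvPolynomial.isHomogeneous_X k j) d F
      (by rw [smul_eq_mul, mul_one]; exact hF))

/-- The linear subspace `ℙ(L) ⊆ ℙⁿ` attached to a vector subspace `L ⊆ k^(n+1)`, as a set of points
of the scheme `ℙⁿ`: the common zero locus of all linear forms that vanish on `L`.
Its dimension is `dim L - 1`. -/
def linearSubspace {n : ℕ} (L : Submodule k (Fin (n + 1) → k)) : Set (PP k n) :=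
  {x | ∀ c : Fin (n + 1) → k, (∀ v ∈ L, ∑ j, c j * v j = 0) →
    (∑ j, MvPolynomial.C (c j) * MvPolynomial.X j : MvPolynomial (Fin (n + 1)) k) ∈
      x.asHomogeneousIdeal}

end ProjectiveSpace

/-! ### The pullback of the tangent bundle -/

section Tangent

variable {X Y S : Scheme.{u}}

/-- The sections over an open `W ⊆ Y` of the pulled back tangent sheaf
`h^* T_{X/S} = Hom(h^* Ω_{X/S}, 𝒪_Y)`, where `s : X ⟶ S` is smooth with `S` the spectrum of a
field and `h : Y ⟶ X`. They are the `S`-derivations `𝒪_X ⟶ (h|_W)_* 𝒪_W` along `h`, i.e.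
families of additive maps `D U : Γ(X, U) → Γ(Y, W ∩ h⁻¹ U)`, compatible with restriction,
satisfying the Leibniz rule and killing the functions that come from `S`. -/
def tangentSections (s : X ⟶ S) (h : Y ⟶ X) (W : Y.Opens) :
    AddSubgroup (∀ U : X.Opens, Γ(X, U) →+ Γ(Y, W ⊓ h ⁻¹ᵁ U)) where
  carrier := {D |
    (∀ (U : X.Opens) (f g : Γ(X, U)),
      D U (f * g) = h.appLE U (W ⊓ h ⁻¹ᵁ U) inf_le_right f * D U g
        + h.appLE U (W ⊓ h ⁻¹ᵁ U) inf_le_right g * D U f) ∧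
    (∀ (U : X.Opens) (c : Γ(S, ⊤)), D U (s.appLE ⊤ U le_top c) = 0) ∧
    (∀ (U V : X.Opens) (i : V ≤ U) (f : Γ(X, U)),
      D V (X.presheaf.map (homOfLE i).op f) =
        Y.presheaf.map (homOfLE (inf_le_inf_left W (h.preimage_mono i))).op (D U f))}
  add_mem' := by
    rintro D E ⟨hD₁, hD₂, hD₃⟩ ⟨hE₁, hE₂, hE₃⟩
    refine ⟨fun U f g => ?_, fun U c => ?_, fun U V i f => ?_⟩
    · simp only [Pi.add_apply, AddMonoidHom.add_apply, hD₁, hE₁]; ring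
    · simp only [Pi.add_apply, AddMonoidHom.add_apply, hD₂, hE₂, add_zero]
    · simp only [Pi.add_apply, AddMonoidHom.add_apply, hD₃, hE₃, map_add]
  zero_mem' := by
    refine ⟨fun U f g => ?_, fun U c => ?_, fun U V i f => ?_⟩ <;> simp
  neg_mem' := by
    rintro D ⟨hD₁, hD₂, hD₃⟩
    refine ⟨fun U f g => ?_, fun U c => ?_, fun U V i f => ?_⟩
    · simp only [Pi.neg_apply, AddMonoidHom.neg_apply, hD₁]; ring
    · simp only [Pi.neg_apply, AddMonoidHom.neg_apply, hD₂, neg_zero]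
    · simp only [Pi.neg_apply, AddMonoidHom.neg_apply, hD₃, map_neg]

/-- Restriction of sections of `h^* T_{X/S}` to a smaller open. -/
def tangentRestrict (s : X ⟶ S) (h : Y ⟶ X) {W W' : Y.Opens} (i : W' ≤ W) :
    tangentSections s h W →+ tangentSections s h W' where
  toFun D := ⟨fun U => (Y.presheaf.map
      (homOfLE (inf_le_inf_right (h ⁻¹ᵁ U) i)).op).hom.toAddMonoidHom.comp (D.1 U), by
    obtain ⟨D, hD₁, hD₂, hD₃⟩ := D
    refine ⟨fun U f g => ?_, fun U c => ?_, fun U V j f => ?_⟩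
    · simp [hD₁, ← CommRingCat.comp_apply, Scheme.Hom.appLE_map]
    · simp [hD₂]
    · simp [hD₃, ← CommRingCat.comp_apply, ← Functor.map_comp, ← op_comp]⟩
  map_zero' := by ext U f; simp
  map_add' D E := by ext U f; simp

/-- Multiplication of a section of `h^* T_{X/S}` over `W` by a regular function on `W`. -/
def tangentMul (s : X ⟶ S) (h : Y ⟶ X) {W : Y.Opens} (a : Γ(Y, W)) :
    tangentSections s h W →+ tangentSections s h W where
  toFun D := ⟨fun U => (AddMonoidHom.mulLeft
      (Y.presheaf.map (homOfLE (inf_le_left : W ⊓ h ⁻¹ᵁ U ≤ W)).op a)).comp (D.1 U), by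
    obtain ⟨D, hD₁, hD₂, hD₃⟩ := D
    refine ⟨fun U f g => ?_, fun U c => ?_, fun U V j f => ?_⟩
    · simp only [AddMonoidHom.comp_apply, AddMonoidHom.coe_mulLeft, hD₁]; ring
    · simp [hD₂]
    · simp [hD₃, ← CommRingCat.comp_apply, ← Functor.map_comp, ← op_comp]⟩
  map_zero' := by ext U f; simp
  map_add' D E := by ext U f; simp [mul_add]

end Tangent

/-! ### Very free rational curves -/

section VeryFree

variable {k : Type u} [Field k] {X : Scheme.{u}}

/-- The coordinate function `u / v` on the chart `D₊(v)` of `ℙ¹ = Proj k[u, v]`. -/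
def coordUV : Γ(PP k 1, chart 1) :=
  dehomogenize (d := 1) (MvPolynomial.X 0) (MvPolynomial.isHomogeneous_X k 0) 1

/-- The Čech differential of `(h^* T_X)(-m)` for the affine cover `ℙ¹ = D₊(u) ∪ D₊(v)`.
Sections of `(h^* T_X)(-m)` over `D₊(u)` are written as `e₀ · u ^ (-m)`, those over `D₊(v)` as
`e₁ · v ^ (-m)`, and those over the overlap as `e · u ^ (-m)`. Since
`v ^ (-m) = (u / v) ^ m · u ^ (-m)`, the differential is `(e₀, e₁) ↦ (u / v) ^ m • e₁ - e₀`. -/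
def cechDifferential (s : X ⟶ Spec (.of k)) (h : PP k 1 ⟶ X) (m : ℕ) :
    tangentSections s h (chart 0) × tangentSections s h (chart 1) →+
      tangentSections s h (chart 0 ⊓ chart 1) :=
  ((tangentRestrict s h inf_le_right).comp
      ((tangentMul s h (coordUV ^ m)).comp (AddMonoidHom.snd _ _))) -
    (tangentRestrict s h inf_le_left).comp (AddMonoidHom.fst _ _)

/-- The cohomology group `H¹(ℙ¹, (h^* T_X)(-m))`, as the cokernel of the Čech differential. -/
abbrev H1 (s : X ⟶ Spec (.of k)) (h : PP k 1 ⟶ X) (m : ℕ) : Type u :=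
  tangentSections s h (chart 0 ⊓ chart 1) ⧸ (cechDifferential s h m).range

/-- A morphism `h : ℙ¹ ⟶ X` to a smooth `k`-scheme `s : X ⟶ Spec k` is a very free rational curve:
it is a morphism over `k`, and `H¹(ℙ¹, (h^* T_X)(-2)) = 0`. -/
structure IsVeryFree (s : X ⟶ Spec (.of k)) (h : PP k 1 ⟶ X) : Prop where
  comp_eq : h ≫ s = PP.toSpec k 1
  subsingleton_H1 : Subsingleton (H1 s h 2)

/-- Separable rational connectedness of a `k`-scheme `s : X ⟶ Spec k` (with `k` algebraically
closed): it is a smooth projective integral variety that carries a very free rational curve. -/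
structure IsSeparablyRationallyConnected (s : X ⟶ Spec (.of k)) : Prop where
  isIntegral : IsIntegral X
  smooth : Smooth s
  projective : ∃ (N : ℕ) (i : X ⟶ PP k N), IsClosedImmersion i ∧ i ≫ PP.toSpec k N = s
  exists_veryFree : ∃ h : PP k 1 ⟶ X, IsVeryFree s h

/-- `i : X ⟶ ℙⁿ` is (the inclusion of) a hypersurface of degree `d`: a closed immersion whose ideal
sheaf is generated by a nonzero form `F` of degree `d`, i.e. on each chart `D₊(x_j)` the ideal of
`X` is generated by `F / x_j ^ d`. -/
structure IsHypersurface {n : ℕ} (d : ℕ) (i : X ⟶ PP k n) : Prop where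
  isClosedImmersion : IsClosedImmersion i
  exists_form : ∃ (F : MvPolynomial (Fin (n + 1)) k) (hF : F.IsHomogeneous d), F ≠ 0 ∧
    ∀ j : Fin (n + 1), RingHom.ker (i.app (chart j)).hom = Ideal.span {dehomogenize F hF j}

end VeryFree

end CubicSRC

end

/-! Let X be the hypersurface F = 0. For a map given by binary cubics h = (h_0, ..., h_n), the Euler
sequence turns every tuple s of binary quadratic forms with ∑ s_j ∂_jF(h) = 0 into a global section
of (h^*T_X)(-1). Suppose that finitely many such tuples span h^*T_X, modulo the Euler vector h,
where uv is invertible. Then a sum of copies of O(-1) maps to (h^*T_X)(-2), onto over the overlap of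
the two charts, hence onto on Čech H¹; as H¹(O(-1)) = 0, the curve is very free. `IsVeryFreeTuple`
records these data, `IsVeryFreeTuple.subsingleton_H1` proves the vanishing, and
`IsVeryFreeTuple.exists_isVeryFree` produces the curve.

Two explicit curves supply the data. If F restricts to xyz - y³ - z³ on a plane (a nodal triple),
the nodal cubic (u³+v³, u²v, uv²) works in every characteristic. If the characteristic is 2 and F
restricts to x²t + xt² + y³ + z³ on a 3-space (a Hermitian quadruple), the twisted cubic (u³, u²v,
uv², v³) works.

It remains to find such sections. Smoothness gives nonsingularity in terms of partial derivatives
(`exists_pderiv_ne_zero`), which also makes F irreducible and X integral. A dual variety argument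
valid in every characteristic (`IsNonsingular.exists_hyperplane`) cuts X down to a nonsingular cubic
surface. If the second fundamental form is nondegenerate at some point of the surface, the tangent
plane section there is nodal; moving the point over k[[ε]] avoids branches that are flexes, and the
Nullstellensatz brings the solution back to k (`IsNonsingular.exists_isNodalTriple`).

Suppose then that no nodal triple exists, so that the second fundamental form degenerates
everywhere. If 2 ≠ 0, the Hessian determinant vanishes on the surface and equals F times a linear
form. At a point where both factors vanish, the geometry forces characteristic 3 and an explicit
equation, which turns out to be singular: a contradiction. If 2 = 0, the full polarization of F
vanishes identically (`IsNonsingular.tri_eq_zero`), so the derivative of F is additive and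
Frobenius-semilinear in the base point. Lang's theorem then provides an orthonormal basis for a
Hermitian form over the field with four elements; the surface is the Fermat cubic and contains a
Hermitian quadruple.

Cubic forms are handled as x ↦ τ(x,x,x) for a trilinear form τ that need not be symmetric, so that
no division by 2 or 3 occurs. -/

noncomputable section

/-! ### Morphisms to projective space and to a hypersurface, through ring-valued points. -/

namespace CubicSRC

attribute [local instance] MvPolynomial.gradedAlgebra

open HomogeneousLocalization

/-! ### Points of `Proj` with values in a ring -/

section Points

variable {σ : Type*} {A : Type u} [CommRing A] [SetLike σ A] [AddSubgroupClass σ A]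
  (𝒜 : ℕ → σ) [GradedRing 𝒜] {T T₂ : Type u} [CommRing T] [CommRing T₂]

/-- Evaluation of degree zero fractions `a / f ^ n` along a ring homomorphism inverting `f`. -/
def evalAway (θ : A →+* T) {f : A} (hf : IsUnit (θ f)) : Away 𝒜 f →+* T :=
  (IsLocalization.Away.lift (S := Localization.Away f) f hf).comp
    (algebraMap (Away 𝒜 f) (Localization.Away f))

lemma evalAway_mk (θ : A →+* T) {f : A} (hf : IsUnit (θ f)) {d : ℕ} (hd : f ∈ 𝒜 d) (n : ℕ) (a : A)
    (ha : a ∈ 𝒜 (n • d)) :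
    evalAway 𝒜 θ hf (Away.mk 𝒜 hd n a ha) * θ f ^ n = θ a := by
  rw [evalAway, RingHom.comp_apply, HomogeneousLocalization.algebraMap_apply, Away.val_mk,
    Localization.mk_eq_mk', ← map_pow]
  have h := IsLocalization.mk'_spec (Localization.Away f) a (⟨f ^ n, n, rfl⟩ : Submonoid.powers f)
  have h2 := congrArg (IsLocalization.Away.lift (S := Localization.Away f) f hf) h
  rw [map_mul] at h2
  simpa using h2

lemma evalAway_unique (θ : A →+* T) {f : A} (hf : IsUnit (θ f)) {d : ℕ} (hd : f ∈ 𝒜 d)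
    (g : Away 𝒜 f →+* T)
    (hg : ∀ (n : ℕ) (a : A) (ha : a ∈ 𝒜 (n • d)), g (Away.mk 𝒜 hd n a ha) * θ f ^ n = θ a) :
    g = evalAway 𝒜 θ hf := by
  ext x
  obtain ⟨n, a, ha, rfl⟩ := Away.mk_surjective 𝒜 hd x
  exact (hf.pow n).mul_right_cancel ((hg n a ha).trans (evalAway_mk 𝒜 θ hf hd n a ha).symm)

lemma comp_evalAway (φ : T →+* T₂) (θ : A →+* T) {f : A} (hf : IsUnit (θ f)) {d : ℕ}
    (hd : f ∈ 𝒜 d) :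
    φ.comp (evalAway 𝒜 θ hf) = evalAway 𝒜 (φ.comp θ) (f := f) (hf.map φ) := by
  refine evalAway_unique 𝒜 _ _ hd _ fun n a ha => ?_
  simp only [RingHom.comp_apply, ← map_pow, ← map_mul]
  rw [map_pow, evalAway_mk]

/-- Numerator and denominator of a degree zero fraction scale by the same power of c. Hence
proportional homogeneous coordinates define the same point. -/
lemma evalAway_scale (θ θ' : A →+* T) (c : T) (hc : ∀ (n : ℕ) (a : A), a ∈ 𝒜 n → θ' a = c ^ n * θ a)
    {f : A} (hf : IsUnit (θ f)) (hf' : IsUnit (θ' f)) {d : ℕ} (hd : f ∈ 𝒜 d) :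
    evalAway 𝒜 θ hf = evalAway 𝒜 θ' hf' := by
  refine evalAway_unique 𝒜 _ _ hd _ fun n a ha => ?_
  rw [hc _ _ hd, hc _ _ ha, mul_pow, ← evalAway_mk 𝒜 θ hf hd n a ha, smul_eq_mul]
  ring

/-- The `T`-valued point of `Proj 𝒜` given by a ring homomorphism to `T` that inverts the
homogeneous element `f` of positive degree. -/
def pt (θ : A →+* T) {f : A} (hf : IsUnit (θ f)) {d : ℕ} (hd : f ∈ 𝒜 d) (h0 : 0 < d) :
    Spec (.of T) ⟶ Proj 𝒜 :=
  Spec.map (CommRingCat.ofHom (evalAway 𝒜 θ hf)) ≫ Proj.awayι 𝒜 f hd h0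

/-- Shrinking D₊(f) to D₊(fg) does not change the point. The product enters as x with an equation,
so that f * g can also be read as g * f when two charts are compared in `pt_eq`. -/
lemma pt_mul (θ : A →+* T) {f : A} (hf : IsUnit (θ f)) {d : ℕ} (hd : f ∈ 𝒜 d) (h0 : 0 < d)
    {g x : A} (hg : IsUnit (θ g)) {e : ℕ} (he : g ∈ 𝒜 e) (hx : x = f * g) {m : ℕ} (hm : x ∈ 𝒜 m)
    (hm0 : 0 < m) (hxu : IsUnit (θ x)) :
    pt 𝒜 θ hxu hm hm0 = pt 𝒜 θ hf hd h0 := by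
  have key : Spec.map (CommRingCat.ofHom (evalAway 𝒜 θ hf)) ≫ Proj.awayι 𝒜 f hd h0 =
      Spec.map (CommRingCat.ofHom (evalAway 𝒜 θ hxu)) ≫
        Proj.awayι 𝒜 x (hx ▸ SetLike.mul_mem_graded hd he) (h0.trans_le (d.le_add_right e)) := by
    rw [← Proj.SpecMap_awayMap_awayι 𝒜 hd h0 he hx, ← Category.assoc, ← Spec.map_comp,
      ← CommRingCat.ofHom_comp]
    congr 3
    symm
    refine evalAway_unique 𝒜 _ _ hd _ fun n a ha => ?_
    rw [RingHom.comp_apply, awayMap_mk 𝒜 he hx]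
    have h := evalAway_mk 𝒜 θ hxu (hx ▸ SetLike.mul_mem_graded hd he : x ∈ 𝒜 (d + e)) n (a * g ^ n)
      (by rw [smul_add]; exact SetLike.mul_mem_graded ha (SetLike.pow_mem_graded n he))
    refine (hg.pow n).mul_right_cancel ?_
    rw [mul_assoc, ← mul_pow, ← map_mul, ← map_pow θ g, ← map_mul θ a, ← h]
    exact congrArg (fun y => _ * θ y ^ n) hx.symm
  rw [pt, pt, key]
  rfl

lemma pt_eq (θ : A →+* T) {f : A} (hf : IsUnit (θ f)) {d : ℕ} (hd : f ∈ 𝒜 d) (h0 : 0 < d)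
    {g : A} (hg : IsUnit (θ g)) {e : ℕ} (he : g ∈ 𝒜 e) (he0 : 0 < e) :
    pt 𝒜 θ hf hd h0 = pt 𝒜 θ hg he he0 := by
  have hfg : IsUnit (θ (f * g)) := by rw [map_mul]; exact hf.mul hg
  have hm : f * g ∈ 𝒜 (d + e) := SetLike.mul_mem_graded hd he
  exact (pt_mul 𝒜 θ hf hd h0 hg he rfl hm (by lia) hfg).symm.trans
    (pt_mul 𝒜 θ hg he he0 hf hd (mul_comm _ _) hm (by lia) hfg)

lemma SpecMap_pt (φ : T →+* T₂) (θ : A →+* T) {f : A} (hf : IsUnit (θ f)) {d : ℕ} (hd : f ∈ 𝒜 d)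
    (h0 : 0 < d) :
    Spec.map (CommRingCat.ofHom φ) ≫ pt 𝒜 θ hf hd h0 =
      pt 𝒜 (φ.comp θ) (f := f) (hf.map φ) hd h0 := by
  rw [pt, pt, ← Category.assoc, ← Spec.map_comp, ← CommRingCat.ofHom_comp, comp_evalAway 𝒜 _ _ _ hd]

lemma pt_scale (θ θ' : A →+* T) (c : T) (hc : ∀ (n : ℕ) (a : A), a ∈ 𝒜 n → θ' a = c ^ n * θ a)
    {f : A} (hf : IsUnit (θ f)) (hf' : IsUnit (θ' f)) {d : ℕ} (hd : f ∈ 𝒜 d) (h0 : 0 < d) :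
    pt 𝒜 θ hf hd h0 = pt 𝒜 θ' hf' hd h0 := by
  rw [pt, pt, evalAway_scale 𝒜 θ θ' c hc hf hf' hd]

lemma pt_congr {θ θ' : A →+* T} (hθ : θ = θ') {f : A} (hf : IsUnit (θ f)) {d : ℕ} (hd : f ∈ 𝒜 d)
    (h0 : 0 < d) : pt 𝒜 θ hf hd h0 = pt 𝒜 θ' (hθ ▸ hf) hd h0 := by
  subst hθ; rfl

lemma range_pt_subset (θ : A →+* T) {f : A} (hf : IsUnit (θ f)) {d : ℕ} (hd : f ∈ 𝒜 d)
    (h0 : 0 < d) : pt 𝒜 θ hf hd h0 ⁻¹ᵁ Proj.basicOpen 𝒜 f = ⊤ := by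
  rw [pt, Scheme.Hom.comp_preimage, ← Proj.opensRange_awayι 𝒜 f hd h0,
    Scheme.Hom.preimage_opensRange]
  rfl

lemma pt_toSpecZero (θ : A →+* T) {f : A} (hf : IsUnit (θ f)) {d : ℕ} (hd : f ∈ 𝒜 d)
    (h0 : 0 < d) : pt 𝒜 θ hf hd h0 ≫ Proj.toSpecZero 𝒜 =
      Spec.map (CommRingCat.ofHom (θ.comp (algebraMap (𝒜 0) A))) := by
  rw [pt, Category.assoc, Proj.awayι_toSpecZero, ← Spec.map_comp, ← CommRingCat.ofHom_comp]
  congr 2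
  ext a
  have h := evalAway_mk 𝒜 θ hf hd 0 (a : A) (by rw [zero_smul]; exact a.2)
  rw [pow_zero, mul_one] at h
  rw [RingHom.comp_apply, RingHom.comp_apply]
  refine Eq.trans (congrArg _ ?_) h
  apply HomogeneousLocalization.val_injective
  rw [Away.val_mk]
  exact congrArg (Localization.mk (a : A)) (Subtype.ext (pow_zero f).symm)

lemma SpecMap_fromSpec_appLE {X : Scheme.{u}} {U : X.Opens} (hU : IsAffineOpen U)
    (φ : Γ(X, U) ⟶ .of T) (h : ⊤ ≤ (Spec.map φ ≫ hU.fromSpec) ⁻¹ᵁ U) :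
    (Spec.map φ ≫ hU.fromSpec).appLE U ⊤ h ≫ (Scheme.ΓSpecIso (.of T)).hom = φ := by
  rw [← Scheme.Hom.appLE_comp_appLE _ _ U ⊤ ⊤ (by rw [hU.fromSpec_preimage_self]) le_top,
    Scheme.Hom.appLE, hU.fromSpec_app_self]
  simp only [Category.assoc]
  rw [← Functor.map_comp_assoc]
  have : ∀ (g : (Opposite.op ⊤ : (Spec Γ(X, U)).Opensᵒᵖ) ⟶ Opposite.op ⊤),
      (Spec Γ(X, U)).presheaf.map g = 𝟙 _ := fun g => by
    rw [Subsingleton.elim g (𝟙 _), CategoryTheory.Functor.map_id]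
  have h2 : (Spec.map φ).appLE ⊤ ⊤ le_top = (Spec.map φ).appTop :=
    (Scheme.Hom.app_eq_appLE _).symm
  rw [this, Category.id_comp, h2, Scheme.ΓSpecIso_naturality, Iso.inv_hom_id_assoc]

lemma SpecMap_awayToSection_awayι {f : A} {d : ℕ} (hd : f ∈ 𝒜 d) (h0 : 0 < d) :
    Spec.map (Proj.awayToSection 𝒜 f) ≫ Proj.awayι 𝒜 f hd h0 =
      (Proj.isAffineOpen_basicOpen 𝒜 f hd h0).fromSpec := by
  rw [Proj.awayι, ← Category.assoc, ← IsAffineOpen.isoSpec_inv_ι]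
  congr 1
  rw [Iso.comp_inv_eq, Iso.eq_inv_comp, Proj.basicOpenIsoSpec_hom, IsAffineOpen.isoSpec_hom]
  rfl

lemma isIso_awayToSection {f : A} {d : ℕ} (hd : f ∈ 𝒜 d) (h0 : 0 < d) :
    IsIso (Proj.awayToSection 𝒜 f) := by
  rw [← Proj.basicOpenIsoAway_hom 𝒜 f hd h0]
  infer_instance

/-- The ring homomorphism `Γ(D₊(f)) ⟶ T` attached to a `T`-valued point of `D₊(f)`. -/
def evalSection (θ : A →+* T) {f : A} (hf : IsUnit (θ f)) {d : ℕ} (hd : f ∈ 𝒜 d) (h0 : 0 < d) :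
    Γ(Proj 𝒜, Proj.basicOpen 𝒜 f) ⟶ .of T :=
  (Proj.basicOpenIsoAway 𝒜 f hd h0).inv ≫ CommRingCat.ofHom (evalAway 𝒜 θ hf)

lemma awayToSection_evalSection (θ : A →+* T) {f : A} (hf : IsUnit (θ f)) {d : ℕ} (hd : f ∈ 𝒜 d)
    (h0 : 0 < d) : Proj.awayToSection 𝒜 f ≫ evalSection 𝒜 θ hf hd h0 =
      CommRingCat.ofHom (evalAway 𝒜 θ hf) := by
  rw [evalSection, ← Proj.basicOpenIsoAway_hom 𝒜 f hd h0, Iso.hom_inv_id_assoc]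

lemma pt_eq_fromSpec (θ : A →+* T) {f : A} (hf : IsUnit (θ f)) {d : ℕ} (hd : f ∈ 𝒜 d)
    (h0 : 0 < d) : pt 𝒜 θ hf hd h0 = Spec.map (evalSection 𝒜 θ hf hd h0) ≫
      (Proj.isAffineOpen_basicOpen 𝒜 f hd h0).fromSpec := by
  rw [← SpecMap_awayToSection_awayι, ← Category.assoc, ← Spec.map_comp, awayToSection_evalSection]
  rfl

/-- A `T`-valued point evaluates the regular functions on `D₊(f)` as expected. -/
lemma pt_appLE (θ : A →+* T) {f : A} (hf : IsUnit (θ f)) {d : ℕ} (hd : f ∈ 𝒜 d)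
    (h0 : 0 < d) (h : ⊤ ≤ pt 𝒜 θ hf hd h0 ⁻¹ᵁ Proj.basicOpen 𝒜 f) :
    (pt 𝒜 θ hf hd h0).appLE (Proj.basicOpen 𝒜 f) ⊤ h ≫ (Scheme.ΓSpecIso (.of T)).hom =
      evalSection 𝒜 θ hf hd h0 := by
  rw [← SpecMap_fromSpec_appLE (Proj.isAffineOpen_basicOpen 𝒜 f hd h0)
    (evalSection 𝒜 θ hf hd h0) (by rw [← pt_eq_fromSpec]; exact h)]
  simp_rw [pt_eq_fromSpec]

end Points

/-! ### Points of a hypersurface -/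

section HypersurfacePoints

variable {k : Type u} [Field k] {n : ℕ} {X : Scheme.{u}} {T : Type u} [CommRing T]

variable (k) in
lemma X_mem (j : Fin (n + 1)) : (MvPolynomial.X j : MvPolynomial (Fin (n + 1)) k) ∈ grading k n 1 :=
  MvPolynomial.isHomogeneous_X k j

lemma awayToSection_mk_eq_dehomogenize {d : ℕ} (F : MvPolynomial (Fin (n + 1)) k)
    (hF : F.IsHomogeneous d) (j : Fin (n + 1)) :
    (dehomogenize F hF j : Γ(PP k n, chart j)) = Proj.awayToSection (grading k n) (MvPolynomial.X j)
      (Away.mk (grading k n) (d := 1) (X_mem k j) d F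
        (by rw [smul_eq_mul, mul_one]; exact hF)) := rfl

lemma evalSection_dehomogenize (θ : MvPolynomial (Fin (n + 1)) k →+* T) {j : Fin (n + 1)}
    (hj : IsUnit (θ (MvPolynomial.X j))) {d : ℕ} (F : MvPolynomial (Fin (n + 1)) k)
    (hF : F.IsHomogeneous d) :
    evalSection (grading k n) θ hj (X_mem k j) one_pos (dehomogenize F hF j) *
      θ (MvPolynomial.X j) ^ d = θ F := by
  rw [awayToSection_mk_eq_dehomogenize]
  have h := awayToSection_evalSection (grading k n) θ hj (X_mem k j) one_pos
  have h2 := congrArg (fun g => g.hom (Away.mk (grading k n) (d := 1)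
    (X_mem k j) d F (by rw [smul_eq_mul, mul_one]; exact hF))) h
  simp only [CommRingCat.hom_comp, RingHom.comp_apply, CommRingCat.hom_ofHom] at h2
  rw [← evalAway_mk (grading k n) θ hj (X_mem k j) d F
    (by rw [smul_eq_mul, mul_one]; exact hF)]
  exact congrArg (· * _) h2

/-- Over the affine D₊(x_j) the immersion is the quotient by F / x_j ^ d, so a point factors through
X as soon as its coordinates satisfy F = 0. -/
lemma exists_lift_pt {i : X ⟶ PP k n} [IsClosedImmersion i] {d : ℕ}
    {F : MvPolynomial (Fin (n + 1)) k} (hF : F.IsHomogeneous d) {j : Fin (n + 1)}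
    (hker : RingHom.ker (i.app (chart j)).hom = Ideal.span {dehomogenize F hF j})
    (θ : MvPolynomial (Fin (n + 1)) k →+* T)
    (hj : IsUnit (θ (MvPolynomial.X j))) (hθ : θ F = 0) :
    ∃ g : Spec (.of T) ⟶ X,
      g ≫ i = pt (grading k n) θ hj (X_mem k j) one_pos := by
  have hU := Proj.isAffineOpen_basicOpen (grading k n) (MvPolynomial.X j)
    (X_mem k j) one_pos
  have hV : IsAffineOpen (i ⁻¹ᵁ chart j) := hU.preimage i
  have hsurj : Function.Surjective (i.app (chart j)).hom := i.app_surjective (chart j) hU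
  set ev := evalSection (grading k n) θ hj (X_mem k j) one_pos with hev
  have hle : RingHom.ker (i.app (chart j)).hom ≤ RingHom.ker ev.hom := by
    rw [hker, Ideal.span_le, Set.singleton_subset_iff]
    have h := evalSection_dehomogenize θ hj F hF
    rw [hθ] at h
    exact ((hj.pow d).mul_left_eq_zero).1 h
  obtain ⟨ρ, hρ⟩ : ∃ ρ : Γ(X, i ⁻¹ᵁ chart j) ⟶ .of T, i.app (chart j) ≫ ρ = ev := by
    refine ⟨CommRingCat.ofHom (RingHom.liftOfSurjective (i.app (chart j)).hom hsurj
      ⟨ev.hom, hle⟩), ?_⟩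
    ext x
    exact RingHom.liftOfRightInverse_comp_apply (i.app (chart j)).hom _
      (Function.rightInverse_surjInv hsurj) ⟨ev.hom, hle⟩ x
  refine ⟨Spec.map ρ ≫ hV.fromSpec, ?_⟩
  rw [pt_eq_fromSpec, ← hev, ← hρ, Spec.map_comp, Category.assoc, Category.assoc,
    ← IsAffineOpen.SpecMap_appLE_fromSpec i hU hV le_rfl, Scheme.Hom.app_eq_appLE]

end HypersurfacePoints

end CubicSRC

end

noncomputable section

namespace CubicSRC

attribute [local instance] MvPolynomial.gradedAlgebra

open HomogeneousLocalization

/-! ### Morphisms from the projective line given by binary forms -/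

section Curves

variable {k : Type u} [Field k] {n : ℕ} {X : Scheme.{u}} {T : Type u} [CommRing T]

/-- Each monomial of degree d picks up the factor c ^ d. The changes of coordinates below reduce to
this. -/
lemma map_homogeneous_of_map_X {m : ℕ} (θ θ' : MvPolynomial (Fin m) k →+* T) (c : T)
    (hC : ∀ a, θ' (MvPolynomial.C a) = θ (MvPolynomial.C a))
    (hX : ∀ i, θ' (MvPolynomial.X i) = c * θ (MvPolynomial.X i)) (d : ℕ)
    (G : MvPolynomial (Fin m) k) (hG : G.IsHomogeneous d) : θ' G = c ^ d * θ G := by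
  rw [G.as_sum, map_sum, map_sum, Finset.mul_sum]
  refine Finset.sum_congr rfl fun s hs => ?_
  have hs' : s.degree = d := by
    by_contra hne
    exact MvPolynomial.mem_support_iff.1 hs (hG.coeff_eq_zero hne)
  rw [MvPolynomial.monomial_eq, map_mul, map_mul, hC, Finsupp.prod, map_prod, map_prod]
  simp only [map_pow, hX, mul_pow]
  rw [Finset.prod_mul_distrib, Finset.prod_pow_eq_pow_sum, ← Finsupp.degree_apply, hs']
  ring

/-- Binary forms with coefficients in `k`. -/
abbrev Bin (k : Type u) [Field k] := MvPolynomial (Fin (1 + 1)) k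

variable {e : ℕ} (h : Fin (n + 1) → Bin k) (hh : ∀ j, h j ∈ grading k 1 e)

/-- The constants `k` inside the degree zero part of a localization. -/
def constAway {m : ℕ} (f : MvPolynomial (Fin (m + 1)) k) : k →+* Away (grading k m) f :=
  (fromZeroRingHom (grading k m) _).comp (algebraMap k (grading k m 0))

lemma evalAway_constAway {m : ℕ} (χ : MvPolynomial (Fin (m + 1)) k →+* T)
    {f : MvPolynomial (Fin (m + 1)) k} (hf : IsUnit (χ f)) (a : k) :
    evalAway (grading k m) χ hf (constAway f a) = χ (MvPolynomial.C a) := by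
  rw [evalAway, RingHom.comp_apply, HomogeneousLocalization.algebraMap_apply]
  have : (constAway f a).val = algebraMap (MvPolynomial (Fin (m + 1)) k) (Localization.Away f)
      (MvPolynomial.C a) := by
    rw [← Localization.mk_one_eq_algebraMap]
    rfl
  rw [this, IsLocalization.Away.lift_eq]

/-- The restriction to `D₊(h j)` of the tuple of sections `h`, divided by `h j`. -/
def ratioHom (j : Fin (n + 1)) : MvPolynomial (Fin (n + 1)) k →+* Away (grading k 1) (h j) :=
  MvPolynomial.eval₂Hom (constAway (h j))
    (fun i => Away.mk (grading k 1) (hh j) 1 (h i) (by rw [one_smul]; exact hh i))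

lemma ratioHom_X_self (j : Fin (n + 1)) : ratioHom h hh j (MvPolynomial.X j) = 1 := by
  rw [ratioHom, MvPolynomial.eval₂Hom_X']
  apply HomogeneousLocalization.val_injective
  rw [Away.val_mk, HomogeneousLocalization.val_one]
  simp only [pow_one]
  exact Localization.mk_self (⟨h j, _⟩ : Submonoid.powers (h j))

lemma isUnit_ratioHom_X_self (j : Fin (n + 1)) : IsUnit (ratioHom h hh j (MvPolynomial.X j)) := by
  rw [ratioHom_X_self]; exact isUnit_one

lemma evalAway_ratioHom_X (χ : Bin k →+* T) (j l : Fin (n + 1)) (hj : IsUnit (χ (h j))) :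
    evalAway (grading k 1) χ hj (ratioHom h hh j (MvPolynomial.X l)) * χ (h j) = χ (h l) := by
  rw [ratioHom, MvPolynomial.eval₂Hom_X']
  have := evalAway_mk (grading k 1) χ hj (hh j) 1 (h l) (by rw [one_smul]; exact hh l)
  rwa [pow_one] at this

lemma evalAway_ratioHom (χ : Bin k →+* T) (j : Fin (n + 1)) (hj : IsUnit (χ (h j))) (d : ℕ)
    (G : MvPolynomial (Fin (n + 1)) k) (hG : G ∈ grading k n d) :
    χ (MvPolynomial.aeval h G) =
      χ (h j) ^ d * evalAway (grading k 1) χ hj (ratioHom h hh j G) := by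
  refine map_homogeneous_of_map_X ((evalAway (grading k 1) χ hj).comp (ratioHom h hh j))
    (χ.comp (MvPolynomial.aeval h).toRingHom) (χ (h j)) (fun a => ?_) (fun l => ?_) d G hG
  · simp [ratioHom, evalAway_constAway, MvPolynomial.algebraMap_eq]
  · rw [mul_comm, RingHom.comp_apply, RingHom.comp_apply, evalAway_ratioHom_X]
    simp

/-- In the localization at h_j one has F(h) = h_j ^ d · F(h / h_j) with h_j a unit, and the degree
zero part embeds in that localization. -/
lemma ratioHom_eq_zero {d : ℕ} {F : MvPolynomial (Fin (n + 1)) k} (hF : F.IsHomogeneous d)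
    (hFh : MvPolynomial.aeval h F = 0) (j : Fin (n + 1)) : ratioHom h hh j F = 0 := by
  apply HomogeneousLocalization.val_injective
  have hu : IsUnit (algebraMap (Bin k) (Localization.Away (h j)) (h j)) :=
    IsLocalization.Away.algebraMap_isUnit _
  have h1 := evalAway_ratioHom h hh (algebraMap _ (Localization.Away (h j))) j hu d F hF
  rw [hFh, map_zero] at h1
  have h2 := ((hu.pow d).mul_right_eq_zero).1 h1.symm
  have h3 : evalAway (grading k 1) (algebraMap _ (Localization.Away (h j))) hu =
      algebraMap (Away (grading k 1) (h j)) (Localization.Away (h j)) := by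
    refine (evalAway_unique _ _ hu (hh j) _ fun m a ha => ?_).symm
    rw [HomogeneousLocalization.algebraMap_apply, Away.val_mk, ← map_pow,
      Localization.mk_eq_mk', IsLocalization.mk'_spec (M := Submonoid.powers (h j)) _ a ⟨h j ^ m, _⟩]
  rw [h3] at h2
  rw [HomogeneousLocalization.val_zero]
  exact h2

lemma awayMap_ratioHom_mul (j l i : Fin (n + 1)) :
    awayMap (grading k 1) (hh j) (mul_comm (h j) (h l)) (ratioHom h hh l (MvPolynomial.X i)) =
      awayMap (grading k 1) (hh j) (mul_comm (h j) (h l)) (ratioHom h hh l (MvPolynomial.X j)) *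
      awayMap (grading k 1) (hh l) rfl (ratioHom h hh j (MvPolynomial.X i)) := by
  simp only [ratioHom, MvPolynomial.eval₂Hom_X', awayMap_mk]
  apply HomogeneousLocalization.val_injective
  rw [HomogeneousLocalization.val_mul]
  simp only [Away.val_mk, Localization.mk_mul]
  rw [Localization.mk_eq_mk_iff, Localization.r_iff_exists]
  refine ⟨1, ?_⟩
  simp
  ring

lemma awayMap_constAway {m : ℕ} {f g x : MvPolynomial (Fin (m + 1)) k} {e : ℕ}
    (hg : g ∈ grading k m e) (hx : x = f * g) (a : k) :
    awayMap (grading k m) hg hx (constAway f a) = constAway x a :=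
  awayMap_fromZeroRingHom _ hg hx _

/-- On D₊(h_j h_l) the tuples h / h_j and h / h_l differ by the unit h_j / h_l, so they give the
same point. This is the gluing condition for the curve. -/
lemma SpecMap_awayMap_pt_ratioHom (j l : Fin (n + 1)) :
    Spec.map (CommRingCat.ofHom (awayMap (grading k 1) (hh l) rfl)) ≫
      pt (grading k n) (ratioHom h hh j) (isUnit_ratioHom_X_self h hh j) (X_mem k j) one_pos =
    Spec.map (CommRingCat.ofHom (awayMap (grading k 1) (hh j) (mul_comm (h j) (h l)))) ≫
      pt (grading k n) (ratioHom h hh l) (isUnit_ratioHom_X_self h hh l) (X_mem k l) one_pos := by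
  rw [SpecMap_pt, SpecMap_pt]
  set θ := (awayMap (grading k 1) (hh l) rfl).comp (ratioHom h hh j) with hθ
  set θ' := (awayMap (grading k 1) (hh j) (mul_comm (h j) (h l))).comp (ratioHom h hh l) with hθ'
  have hX : ∀ i, θ' (MvPolynomial.X i) = θ' (MvPolynomial.X j) * θ (MvPolynomial.X i) :=
    fun i => awayMap_ratioHom_mul h hh j l i
  have hu : IsUnit (θ' (MvPolynomial.X j)) := by
    refine IsUnit.of_mul_eq_one (θ (MvPolynomial.X l)) ?_
    rw [← hX, hθ', RingHom.comp_apply, ratioHom_X_self, map_one]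
  refine (pt_scale (grading k n) θ θ' (θ' (MvPolynomial.X j)) (fun d a ha => ?_) _ hu
    (X_mem k j) one_pos).trans (pt_eq (grading k n) θ' _ _ _ _ _ _)
  refine map_homogeneous_of_map_X θ θ' _ (fun a => ?_) hX d a ha
  rw [hθ, hθ']
  simp only [RingHom.comp_apply, ratioHom, MvPolynomial.eval₂Hom_C]
  exact (awayMap_constAway _ _ a).trans (awayMap_constAway _ _ a).symm

/-- The open cover of the projective line by the sets `D₊(h j)`. -/
def formsCover (he : 0 < e) (hcov : ∀ y : PP k 1, ∃ j, h j ∉ y.asHomogeneousIdeal) :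
    (PP k 1).AffineOpenCover where
  I₀ := Fin (n + 1)
  X j := .of (Away (grading k 1) (h j))
  f j := Proj.awayι (grading k 1) (h j) (hh j) he
  idx y := (hcov y).choose
  covers y := by
    change y ∈ (Proj.awayι (grading k 1) _ _ _).opensRange
    rw [Proj.opensRange_awayι]
    exact (hcov y).choose_spec

/-- The points h / h_j glue over the sets D₊(h_j), which cover the line because the forms have no
common zero (`hcov`). The second conclusion describes the morphism on T-valued points for every T;
it is applied later to local rings and, apart from compatibility with the structure maps, is all
that is needed about the morphism. -/
theorem exists_morphism_of_forms (hh : ∀ j, h j ∈ grading k 1 e) {i : X ⟶ PP k n} [IsClosedImmersion i] {d : ℕ}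
    {F : MvPolynomial (Fin (n + 1)) k} (hF : F.IsHomogeneous d)
    (hker : ∀ j, RingHom.ker (i.app (chart j)).hom = Ideal.span {dehomogenize F hF j})
    (he : 0 < e) (hcov : ∀ y : PP k 1, ∃ j, h j ∉ y.asHomogeneousIdeal)
    (hFh : MvPolynomial.aeval h F = 0) :
    ∃ g : PP k 1 ⟶ X, g ≫ i ≫ PP.toSpec k n = PP.toSpec k 1 ∧
      ∀ (T : Type u) [CommRing T] (χ : Bin k →+* T) (f : Bin k) (hf : IsUnit (χ f)) (d' : ℕ)
        (hd : f ∈ grading k 1 d') (h0 : 0 < d') (j : Fin (n + 1))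
        (hj : IsUnit ((χ.comp (MvPolynomial.aeval h).toRingHom) (MvPolynomial.X j))),
        pt (grading k 1) χ hf hd h0 ≫ g ≫ i =
          pt (grading k n) (χ.comp (MvPolynomial.aeval h).toRingHom) hj (X_mem k j) one_pos := by
  choose g hg using fun j => exists_lift_pt hF (hker j) (ratioHom h hh j)
    (isUnit_ratioHom_X_self h hh j) (ratioHom_eq_zero h hh hF hFh j)
  have hcompat : ∀ j l : Fin (n + 1),
      Limits.pullback.fst (Proj.awayι (grading k 1) (h j) (hh j) he)
        (Proj.awayι (grading k 1) (h l) (hh l) he) ≫ g j = Limits.pullback.snd _ _ ≫ g l := by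
    intro j l
    rw [← cancel_mono i, Category.assoc, Category.assoc, hg, hg,
      ← cancel_epi (Proj.pullbackAwayιIso (grading k 1) (hh j) he (hh l) he rfl).inv,
      Proj.pullbackAwayιIso_inv_fst_assoc, Proj.pullbackAwayιIso_inv_snd_assoc]
    exact SpecMap_awayMap_pt_ratioHom h hh j l
  let 𝒰 := formsCover h hh he hcov
  let G : PP k 1 ⟶ X := 𝒰.openCover.glueMorphisms g hcompat
  have hG : ∀ j, Proj.awayι (grading k 1) (h j) (hh j) he ≫ G = g j :=
    fun j => 𝒰.openCover.ι_glueMorphisms g hcompat j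
  refine ⟨G, ?_, ?_⟩
  · suffices hto : ∀ j : Fin (n + 1),
        Proj.awayι (grading k 1) (h j) (hh j) he ≫ G ≫ i ≫ PP.toSpec k n =
        Proj.awayι (grading k 1) (h j) (hh j) he ≫ PP.toSpec k 1 from
      𝒰.openCover.hom_ext _ _ fun j => hto j
    intro j
    rw [reassoc_of% hG, reassoc_of% hg, PP.toSpec, PP.toSpec, Proj.awayι_toSpecZero_assoc,
      ← Category.assoc, pt_toSpecZero, ← Spec.map_comp, ← Spec.map_comp, ← CommRingCat.ofHom_comp,
      ← CommRingCat.ofHom_comp]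
    congr 2
    refine RingHom.ext fun a => ?_
    simp only [RingHom.comp_apply]
    exact MvPolynomial.eval₂Hom_C (constAway (h j)) _ a
  · intro T _ χ f hf d' hd h0 j hj
    have hj' : IsUnit (χ (h j)) := by simpa using hj
    rw [pt_eq (grading k 1) χ hf hd h0 hj' (hh j) he, pt, Category.assoc, reassoc_of% hG, hg,
      SpecMap_pt]
    refine pt_scale (grading k n) _ _ (χ (h j)) (fun d a ha => ?_) _ _ _ _
    exact evalAway_ratioHom h hh χ j hj' d a ha

end Curves

end CubicSRC

end

/-! ### First order deformations as sections of the pulled back tangent sheaf. -/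

noncomputable section

namespace CubicSRC

open TrivSqZeroExt

/-! ### Dual numbers -/

section Dual

variable {R S T : Type*} [CommRing R] [CommRing S] [CommRing T]

/-- Functoriality of the ring of dual numbers. -/
def dualMap (φ : R →+* S) : DualNumber R →+* DualNumber S where
  toFun x := (φ x.fst, φ x.snd)
  map_one' := by ext <;> simp [TrivSqZeroExt.fst, TrivSqZeroExt.snd]; exacts [φ.map_one, φ.map_zero]
  map_zero' := by ext; exacts [φ.map_zero, φ.map_zero]
  map_add' x y := by ext; exacts [φ.map_add _ _, φ.map_add _ _]
  map_mul' x y := by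
    ext
    · exact φ.map_mul _ _
    · change φ (x * y).snd = _
      simp only [DualNumber.snd_mul, map_add, map_mul]
      rfl

@[simp] lemma fst_dualMap (φ : R →+* S) (x : DualNumber R) : (dualMap φ x).fst = φ x.fst := rfl
@[simp] lemma snd_dualMap (φ : R →+* S) (x : DualNumber R) : (dualMap φ x).snd = φ x.snd := rfl

/-- Reduction of dual numbers modulo `ε`. -/
def dualFst (R : Type*) [CommRing R] : DualNumber R →+* R := (TrivSqZeroExt.fstHom R R R).toRingHom

@[simp] lemma dualFst_apply (x : DualNumber R) : dualFst R x = x.fst := rfl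

instance [IsLocalRing R] : IsLocalRing (DualNumber R) :=
  .of_isUnit_or_isUnit_of_isUnit_add fun a b h => by
    simp only [TrivSqZeroExt.isUnit_iff_isUnit_fst, fst_add] at h ⊢
    exact IsLocalRing.isUnit_or_isUnit_of_isUnit_add h

instance : IsLocalHom (dualFst R) :=
  ⟨fun _ h => TrivSqZeroExt.isUnit_iff_isUnit_fst.2 h⟩

end Dual

/-! ### Evaluation of functions at points with values in a ring -/

section EvalPt

variable {X Y : Scheme.{u}} {T T₂ : Type u} [CommRing T] [CommRing T₂]

/-- The evaluation of the functions on `U` at a `T`-valued point of `U`. -/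
def evalPt (f : Spec (.of T) ⟶ X) (U : X.Opens) (h : ⊤ ≤ f ⁻¹ᵁ U) : Γ(X, U) →+* T :=
  (f.appLE U ⊤ h ≫ (Scheme.ΓSpecIso (.of T)).hom).hom

lemma evalPt_SpecMap_comp (φ : T →+* T₂) (f : Spec (.of T) ⟶ X) (U : X.Opens) (h : ⊤ ≤ f ⁻¹ᵁ U)
    (h' : ⊤ ≤ (Spec.map (CommRingCat.ofHom φ) ≫ f) ⁻¹ᵁ U) (a : Γ(X, U)) :
    evalPt (Spec.map (CommRingCat.ofHom φ) ≫ f) U h' a = φ (evalPt f U h a) := by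
  have h2 : (Spec.map (CommRingCat.ofHom φ)).appLE ⊤ ⊤ le_top =
      (Spec.map (CommRingCat.ofHom φ)).appTop := (Scheme.Hom.app_eq_appLE _).symm
  have h3 : (Spec.map (CommRingCat.ofHom φ) ≫ f).appLE U ⊤ h' ≫ (Scheme.ΓSpecIso (.of T₂)).hom =
      (f.appLE U ⊤ h ≫ (Scheme.ΓSpecIso (.of T)).hom) ≫ CommRingCat.ofHom φ := by
    rw [← Scheme.Hom.appLE_comp_appLE _ _ U ⊤ ⊤ h le_top, h2, Category.assoc,
      Scheme.ΓSpecIso_naturality, Category.assoc]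
  exact congrArg (fun g => g.hom a) h3

lemma evalPt_SpecMap (φ : T →+* T₂) (h : ⊤ ≤ Spec.map (CommRingCat.ofHom φ) ⁻¹ᵁ ⊤)
    (a : Γ(Spec (.of T), ⊤)) : evalPt (Spec.map (CommRingCat.ofHom φ)) ⊤ h a =
      φ ((Scheme.ΓSpecIso (.of T)).hom a) := by
  have h2 : (Spec.map (CommRingCat.ofHom φ)).appLE ⊤ ⊤ h =
      (Spec.map (CommRingCat.ofHom φ)).appTop := (Scheme.Hom.app_eq_appLE _).symm
  have h3 : (Spec.map (CommRingCat.ofHom φ)).appLE ⊤ ⊤ h ≫ (Scheme.ΓSpecIso (.of T₂)).hom =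
      (Scheme.ΓSpecIso (.of T)).hom ≫ CommRingCat.ofHom φ := by
    rw [h2, Scheme.ΓSpecIso_naturality]
  exact congrArg (fun g => g.hom a) h3

lemma evalPt_comp (f : Spec (.of T) ⟶ Y) (g : Y ⟶ X) (U : X.Opens) (h : ⊤ ≤ (f ≫ g) ⁻¹ᵁ U)
    (V : Y.Opens) (hV : ⊤ ≤ f ⁻¹ᵁ V) (hVU : V ≤ g ⁻¹ᵁ U) (a : Γ(X, U)) :
    evalPt (f ≫ g) U h a = evalPt f V hV (g.appLE U V hVU a) := by
  have h3 : (f ≫ g).appLE U ⊤ h = g.appLE U V hVU ≫ f.appLE V ⊤ hV :=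
    (Scheme.Hom.appLE_comp_appLE _ _ _ _ _ _ _).symm
  rw [evalPt, evalPt, h3]
  rfl

lemma evalPt_map (f : Spec (.of T) ⟶ X) {U V : X.Opens} (i : V ≤ U) (h : ⊤ ≤ f ⁻¹ᵁ V)
    (h' : ⊤ ≤ f ⁻¹ᵁ U) (a : Γ(X, U)) :
    evalPt f V h (X.presheaf.map (homOfLE i).op a) = evalPt f U h' a := by
  have : X.presheaf.map (homOfLE i).op ≫ f.appLE V ⊤ h = f.appLE U ⊤ h' :=
    Scheme.Hom.map_appLE _ _ _
  rw [evalPt, evalPt, ← this]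
  rfl

lemma evalPt_congr {f g : Spec (.of T) ⟶ X} (hfg : f = g) {U : X.Opens} (h : ⊤ ≤ f ⁻¹ᵁ U)
    (h' : ⊤ ≤ g ⁻¹ᵁ U) : evalPt f U h = evalPt g U h' := by
  subst hfg; rfl

lemma evalPt_fromSpecStalk {y : Y} {V : Y.Opens} (hy : y ∈ V)
    (h : ⊤ ≤ (Y.fromSpecStalk y) ⁻¹ᵁ V) (a : Γ(Y, V)) :
    evalPt (T := Y.presheaf.stalk y) (Y.fromSpecStalk y) V h a = Y.presheaf.germ V y hy a := by
  have : (Y.fromSpecStalk y).appLE V ⊤ h ≫ (Scheme.ΓSpecIso (Y.presheaf.stalk y)).hom =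
      Y.presheaf.germ V y hy := by
    rw [Scheme.Hom.appLE, Scheme.fromSpecStalk_app hy, Category.assoc, Category.assoc,
      Category.assoc, ← Functor.map_comp_assoc]
    have : ∀ (g : (Opposite.op ⊤ : (Spec (Y.presheaf.stalk y)).Opensᵒᵖ) ⟶ Opposite.op ⊤),
        (Spec (Y.presheaf.stalk y)).presheaf.map g = 𝟙 _ := fun g => by
      rw [Subsingleton.elim g (𝟙 _), CategoryTheory.Functor.map_id]
    rw [this, Category.id_comp, Iso.inv_hom_id, Category.comp_id]
  exact congrArg (fun g => g.hom a) this

end EvalPt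

/-! ### Gluing on integral schemes -/

section Glue

variable {Y : Scheme.{u}}

lemma germ_ext {V : Y.Opens} {s t : Γ(Y, V)}
    (h : ∀ (y : Y) (hy : y ∈ V), Y.presheaf.germ V y hy s = Y.presheaf.germ V y hy t) : s = t :=
  TopCat.Presheaf.section_ext Y.sheaf V s t h

variable [IsIntegral Y]

/-- All stalks of an integral scheme embed in the function field. A germ z y spreads out to a
neighbourhood, where its germs are the other z w because they agree generically; the local sections
therefore glue. -/
lemma exists_section_of_germs (V : Y.Opens) (z : ∀ y ∈ V, Y.presheaf.stalk y)
    (hz : ∀ y hy y' hy', algebraMap (Y.presheaf.stalk y) Y.functionField (z y hy) =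
      algebraMap (Y.presheaf.stalk y') Y.functionField (z y' hy')) :
    ∃ s : Γ(Y, V), ∀ y (hy : y ∈ V), Y.presheaf.germ V y hy s = z y hy := by
  choose N hN t ht using fun y : V => Y.presheaf.exists_germ_eq (z y y.2)
  let M : V → Y.Opens := fun y => N y ⊓ V
  let t' : ∀ y : V, Γ(Y, M y) := fun y => Y.presheaf.map (homOfLE inf_le_left).op (t y)
  have hM : ∀ y : V, (y : Y) ∈ M y := fun y => ⟨hN y, y.2⟩
  have hne : ∀ y : V, Nonempty (M y) := fun y => ⟨⟨y, hM y⟩⟩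
  have key : ∀ (y : V) (w : Y) (hw : w ∈ M y), Y.presheaf.germ (M y) w hw (t' y) = z w hw.2 := by
    intro y w hw
    apply IsFractionRing.injective (Y.presheaf.stalk w) Y.functionField
    rw [hz w hw.2 y y.2, ← ht y]
    have e1 := Scheme.algebraMap_germ_eq_germToFunctionField (X := Y) hw (t' y)
    have e2 := Scheme.algebraMap_germ_eq_germToFunctionField (X := Y) (hM y) (t' y)
    rw [e1, ← e2]
    congr 1
    exact TopCat.Presheaf.germ_res_apply _ _ _ _ _
  obtain ⟨s, hs, -⟩ := Y.sheaf.existsUnique_gluing' M V (fun y => homOfLE inf_le_right)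
    (fun y hy => TopologicalSpace.Opens.mem_iSup.2 ⟨⟨y, hy⟩, hM ⟨y, hy⟩⟩) t' (by
      intro a b
      refine germ_ext fun w hw => ?_
      exact ((TopCat.Presheaf.germ_res_apply Y.presheaf _ _ _ _).trans (key a w hw.1)).trans
        ((TopCat.Presheaf.germ_res_apply Y.presheaf _ _ _ _).trans (key b w hw.2)).symm)
  refine ⟨s, fun y hy => ?_⟩
  rw [← key ⟨y, hy⟩ y (hM _), ← hs ⟨y, hy⟩]
  exact (TopCat.Presheaf.germ_res_apply Y.presheaf _ _ _ _).symm

end Glue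

/-! ### Sections of the pulled back tangent bundle from infinitesimal deformations -/

section Deformation

variable {X Y : Scheme.{u}} [IsIntegral Y] {k : Type u} [Field k]

/-- A tangent vector along g at the local ring of y is an extension of Spec O_y ⟶ X to Spec O_y[ε].
The ε-part of pulling back functions is a derivation along g, and agreement of all the Ψ y at the
generic point lets the germs of its values glue. -/
theorem exists_tangentSection (s : X ⟶ Spec (.of k)) (g : Y ⟶ X) (W : Y.Opens)
    (Ψ : ∀ y ∈ W, Spec (.of (DualNumber (Y.presheaf.stalk y))) ⟶ X)
    (hη : genericPoint Y ∈ W)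
    (hspec : ∀ y hy, Spec.map (CommRingCat.ofHom (dualMap (algebraMap (Y.presheaf.stalk y)
      Y.functionField))) ≫ Ψ y hy = Ψ (genericPoint Y) hη)
    (hfst : ∀ y hy, Spec.map (CommRingCat.ofHom (dualFst (Y.presheaf.stalk y))) ≫ Ψ y hy =
      Y.fromSpecStalk y ≫ g)
    (hconst : ∀ y hy, ∃ c : k →+* Y.presheaf.stalk y, Ψ y hy ≫ s =
      Spec.map (CommRingCat.ofHom ((inlHom (Y.presheaf.stalk y) (Y.presheaf.stalk y)).comp c))) :
    ∃ σ : tangentSections s g W, ∀ (U : X.Opens) (f : Γ(X, U)) (y : Y) (hyW : y ∈ W)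
      (hyU : y ∈ g ⁻¹ᵁ U) (h : ⊤ ≤ Ψ y hyW ⁻¹ᵁ U),
      Y.presheaf.germ (W ⊓ g ⁻¹ᵁ U) y ⟨hyW, hyU⟩ (σ.1 U f) = (evalPt (Ψ y hyW) U h f).snd := by
  -- Ψ y sends the closed point of Spec O_y[ε] to g y, and an open set containing the image of the
  -- closed point of a local scheme contains the whole image.
  have htop : ∀ (U : X.Opens) (y : Y) (hyW : y ∈ W) (hyU : y ∈ g ⁻¹ᵁ U), ⊤ ≤ Ψ y hyW ⁻¹ᵁ U := by
    intro U y hyW hyU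
    refine (Scheme.preimage_eq_top_of_closedPoint_mem (Ψ y hyW) ?_).ge
    let p : Spec (Y.presheaf.stalk y) := IsLocalRing.closedPoint (Y.presheaf.stalk y)
    let q : Spec (.of (DualNumber (Y.presheaf.stalk y))) :=
      IsLocalRing.closedPoint (DualNumber (Y.presheaf.stalk y))
    have h1 : Spec.map (CommRingCat.ofHom (dualFst (Y.presheaf.stalk y))) p = q :=
      IsLocalRing.comap_closedPoint (dualFst (Y.presheaf.stalk y))
    have h2 : (Y.fromSpecStalk y ≫ g) p = g y := by
      rw [Scheme.Hom.comp_apply, Scheme.fromSpecStalk_closedPoint]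
    have h3 : (Spec.map (CommRingCat.ofHom (dualFst (Y.presheaf.stalk y))) ≫ Ψ y hyW) p =
        Ψ y hyW q := by
      rw [Scheme.Hom.comp_apply, h1]
    change Ψ y hyW q ∈ U
    rw [← h3, hfst, h2]
    exact hyU
  have hfstval : ∀ (U : X.Opens) (f : Γ(X, U)) (y : Y) (hyW : y ∈ W) (hyU : y ∈ g ⁻¹ᵁ U),
      (evalPt (Ψ y hyW) U (htop U y hyW hyU) f).fst = Y.presheaf.germ (W ⊓ g ⁻¹ᵁ U) y ⟨hyW, hyU⟩
        (g.appLE U (W ⊓ g ⁻¹ᵁ U) inf_le_right f) := by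
    intro U f y hyW hyU
    have hU := htop U y hyW hyU
    have hU1 : ⊤ ≤ (Spec.map (CommRingCat.ofHom (dualFst (Y.presheaf.stalk y))) ≫ Ψ y hyW) ⁻¹ᵁ U :=
      fun p _ => hU (x := Spec.map (CommRingCat.ofHom (dualFst (Y.presheaf.stalk y))) p) trivial
    have hU2 := hU1
    rw [hfst] at hU2
    have hV : ⊤ ≤ (Y.fromSpecStalk y) ⁻¹ᵁ (W ⊓ g ⁻¹ᵁ U) :=
      (Scheme.preimage_eq_top_of_closedPoint_mem (Y.fromSpecStalk y) (by
        rw [Scheme.fromSpecStalk_closedPoint]; exact ⟨hyW, hyU⟩)).ge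
    have e1 := evalPt_SpecMap_comp (dualFst (Y.presheaf.stalk y)) (Ψ y hyW) U hU hU1 f
    rw [evalPt_congr (hfst y hyW) hU1 hU2] at e1
    exact e1.symm.trans ((evalPt_comp (T := Y.presheaf.stalk y) (Y.fromSpecStalk y) g U hU2 _ hV
      inf_le_right f).trans (evalPt_fromSpecStalk (V := W ⊓ g ⁻¹ᵁ U)
        ⟨hyW, hyU⟩ hV _))
  have hglue : ∀ (U : X.Opens) (f : Γ(X, U)), ∃ t : Γ(Y, W ⊓ g ⁻¹ᵁ U), ∀ y (hy : y ∈ W ⊓ g ⁻¹ᵁ U),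
      Y.presheaf.germ _ y hy t = (evalPt (Ψ y hy.1) U (htop U y hy.1 hy.2) f).snd := by
    intro U f
    apply exists_section_of_germs
    have aux : ∀ y (hy : y ∈ W ⊓ g ⁻¹ᵁ U) (hU : ⊤ ≤ Ψ (genericPoint Y) hη ⁻¹ᵁ U),
        algebraMap (Y.presheaf.stalk y) Y.functionField
          (evalPt (Ψ y hy.1) U (htop U y hy.1 hy.2) f).snd =
        (evalPt (Ψ (genericPoint Y) hη) U hU f).snd := by
      intro y hy hU
      have hU' := hU
      rw [← hspec y hy.1] at hU'
      rw [← evalPt_congr (hspec y hy.1) hU' hU, evalPt_SpecMap_comp, snd_dualMap]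
    intro y hy y' hy'
    have hU : ⊤ ≤ Ψ (genericPoint Y) hη ⁻¹ᵁ U := htop U _ hη
      (((genericPoint_spec Y).mem_open_set_iff (g ⁻¹ᵁ U).isOpen).2 ⟨y, trivial, hy.2⟩)
    rw [aux y hy hU, aux y' hy' hU]
  choose t ht using hglue
  refine ⟨⟨fun U => AddMonoidHom.mk' (t U) fun a b => germ_ext fun y hy => ?_,
    fun U a b => germ_ext fun y hy => ?_, fun U c => germ_ext fun y hy => ?_,
    fun U V i f => germ_ext fun y hy => ?_⟩, fun U f y hyW hyU h => ht U f y ⟨hyW, hyU⟩⟩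
  · rw [map_add, ht, ht, ht, map_add, snd_add]
  · change Y.presheaf.germ _ y hy (t U (a * b)) = Y.presheaf.germ _ y hy (_ * t U b + _ * t U a)
    rw [map_add, map_mul, map_mul, ht, ht, ht, map_mul, DualNumber.snd_mul, hfstval _ _ _ _ hy.2,
      hfstval _ _ _ _ hy.2]
    ring
  · change Y.presheaf.germ _ y hy (t U _) = _
    rw [ht, map_zero]
    obtain ⟨c', hc'⟩ := hconst y hy.1
    have hU := htop U y hy.1 hy.2
    rw [← evalPt_comp (Ψ y hy.1) s ⊤ le_top U hU le_top]
    have e2 := (congrArg (fun φ => φ c) (evalPt_congr hc' (U := ⊤) le_top le_top)).trans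
      (evalPt_SpecMap _ le_top c)
    exact (congrArg TrivSqZeroExt.snd e2).trans (snd_inl _ _)
  · change Y.presheaf.germ _ y hy (t V _) = Y.presheaf.germ _ y hy (Y.presheaf.map _ (t U f))
    rw [ht, evalPt_map _ i _ (htop U y hy.1 (g.preimage_mono i hy.2))]
    exact (ht U f y _).symm.trans (TopCat.Presheaf.germ_res_apply Y.presheaf _ _ _ _).symm

end Deformation

end CubicSRC

end

/-! ### Affine coordinates on projective space, and integrality of hypersurfaces. -/

noncomputable section

namespace CubicSRC

attribute [local instance] MvPolynomial.gradedAlgebra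

open HomogeneousLocalization

lemma presheaf_map_map {Y : Scheme.{u}} {U V W : Y.Opens} (i : V ≤ U) (j : W ≤ V) (z : Γ(Y, U)) :
    Y.presheaf.map (homOfLE j).op (Y.presheaf.map (homOfLE i).op z) =
      Y.presheaf.map (homOfLE (j.trans i)).op z := by
  rw [← CommRingCat.comp_apply, ← Functor.map_comp]
  rfl

/-! ### Coordinates on the complement of a hyperplane -/

section Coordinates

variable {k : Type u} [Field k] {m : ℕ} {T : Type u} [CommRing T]
  {f g : MvPolynomial (Fin (m + 1)) k} (hf : f ∈ grading k m 1) (hg : g ∈ grading k m 1)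

/-- Dehomogenization with respect to a linear form `f`: the substitution `x_i ↦ x_i / f`. -/
def linRatio : MvPolynomial (Fin (m + 1)) k →+* Away (grading k m) f :=
  MvPolynomial.eval₂Hom (constAway f)
    (fun i => Away.mk (grading k m) hf 1 (MvPolynomial.X i) (by rw [one_smul]; exact X_mem k i))

lemma linRatio_eq_mk {d : ℕ} {G : MvPolynomial (Fin (m + 1)) k} (hG : G ∈ grading k m d)
    (hG' : G ∈ grading k m (d • 1)) : linRatio hf G = Away.mk (grading k m) hf d G hG' := by
  have hu : IsUnit (algebraMap _ (Localization.Away f) f) :=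
    IsLocalization.Away.algebraMap_isUnit _
  have h1 := map_homogeneous_of_map_X
    ((algebraMap (Away (grading k m) f) (Localization.Away f)).comp (linRatio hf))
    (algebraMap (MvPolynomial (Fin (m + 1)) k) (Localization.Away f)) (algebraMap _ _ f)
    (fun a => by
      rw [RingHom.comp_apply, linRatio, MvPolynomial.eval₂Hom_C,
        HomogeneousLocalization.algebraMap_apply, ← Localization.mk_one_eq_algebraMap]
      rfl)
    (fun i => by
      rw [RingHom.comp_apply, linRatio, MvPolynomial.eval₂Hom_X',
        HomogeneousLocalization.algebraMap_apply, Away.val_mk, Localization.mk_eq_mk', mul_comm]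
      have := IsLocalization.mk'_spec (Localization.Away f) (MvPolynomial.X i)
        (⟨f ^ 1, 1, rfl⟩ : Submonoid.powers f)
      rw [← this]
      simp) d G hG
  apply HomogeneousLocalization.val_injective
  rw [Away.val_mk, Localization.mk_eq_mk', IsLocalization.eq_mk'_iff_mul_eq, h1,
    RingHom.comp_apply, HomogeneousLocalization.algebraMap_apply]
  simp [mul_comm]

/-- The regular functions on `D₊(f)`, for a linear form `f`, obtained by dehomogenization. -/
def coordHom : MvPolynomial (Fin (m + 1)) k →+* Γ(PP k m, Proj.basicOpen (grading k m) f) :=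
  (Proj.awayToSection (grading k m) f).hom.comp (linRatio hf)

lemma coordHom_eq_mk {d : ℕ} {G : MvPolynomial (Fin (m + 1)) k} (hG : G ∈ grading k m d)
    (hG' : G ∈ grading k m (d • 1)) : coordHom hf G =
      Proj.awayToSection (grading k m) f (Away.mk (grading k m) hf d G hG') := by
  rw [coordHom, RingHom.comp_apply, linRatio_eq_mk hf hG hG']

lemma dehomogenize_eq_coordHom {d : ℕ} (F : MvPolynomial (Fin (m + 1)) k)
    (hF : F.IsHomogeneous d) (j : Fin (m + 1)) :
    dehomogenize F hF j = coordHom (X_mem k j) F :=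
  (coordHom_eq_mk (X_mem k j) hF _).symm

lemma coordHom_self : coordHom hf f = 1 := by
  rw [coordHom_eq_mk hf hf (by rw [smul_eq_mul, mul_one]; exact hf), ← map_one (Proj.awayToSection (grading k m) f).hom]
  congr 1
  apply HomogeneousLocalization.val_injective
  rw [Away.val_mk, HomogeneousLocalization.val_one]
  simp only [pow_one]
  exact Localization.mk_self (⟨f, _⟩ : Submonoid.powers f)

lemma awayToSection_bijective (hf : f ∈ grading k m 1) :
    Function.Bijective (Proj.awayToSection (grading k m) f).hom := by
  have := isIso_awayToSection (grading k m) hf one_pos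
  exact ConcreteCategory.bijective_of_isIso (Proj.awayToSection (grading k m) f)

lemma exists_homogeneous_coordHom_eq (z : Γ(PP k m, Proj.basicOpen (grading k m) f)) :
    ∃ (d : ℕ) (G : MvPolynomial (Fin (m + 1)) k), G ∈ grading k m d ∧ coordHom hf G = z := by
  obtain ⟨x, rfl⟩ := (awayToSection_bijective hf).2 z
  obtain ⟨d, G, hG, rfl⟩ := Away.mk_surjective (grading k m) hf x
  have hG2 : G ∈ grading k m d := by rwa [smul_eq_mul, mul_one] at hG
  exact ⟨d, G, hG2, coordHom_eq_mk hf hG2 hG⟩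

lemma coordHom_surjective : Function.Surjective (coordHom hf) := fun z => by
  obtain ⟨d, G, -, h⟩ := exists_homogeneous_coordHom_eq hf z
  exact ⟨G, h⟩

lemma eq_zero_of_coordHom_eq_zero (hf0 : f ≠ 0) {d : ℕ} {G : MvPolynomial (Fin (m + 1)) k}
    (hG : G ∈ grading k m d) (h : coordHom hf G = 0) : G = 0 := by
  rw [coordHom_eq_mk hf hG (by rwa [smul_eq_mul, mul_one]), ← map_zero (Proj.awayToSection (grading k m) f).hom] at h
  have h2 := congrArg HomogeneousLocalization.val ((awayToSection_bijective hf).1 h)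
  rw [Away.val_mk, HomogeneousLocalization.val_zero, Localization.mk_eq_mk',
    IsLocalization.mk'_eq_zero_iff] at h2
  obtain ⟨⟨-, r, rfl⟩, hr⟩ := h2
  exact (mul_eq_zero.1 hr).resolve_left (pow_ne_zero _ hf0)

/-- Change of coordinates. -/
lemma map_coordHom_eq (V : (PP k m).Opens) (hVf : V ≤ Proj.basicOpen (grading k m) f)
    (hVg : V ≤ Proj.basicOpen (grading k m) g) {d : ℕ} {G : MvPolynomial (Fin (m + 1)) k}
    (hG : G ∈ grading k m d) :
    (PP k m).presheaf.map (homOfLE hVf).op (coordHom hf G) =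
      (PP k m).presheaf.map (homOfLE hVf).op (coordHom hf g) ^ d *
        (PP k m).presheaf.map (homOfLE hVg).op (coordHom hg G) := by
  have hV : V ≤ Proj.basicOpen (grading k m) (f * g) := by
    rw [Proj.basicOpen_mul]; exact le_inf hVf hVg
  have e1 : ∀ z : Away (grading k m) f, (PP k m).presheaf.map (homOfLE hVf).op
      (Proj.awayToSection (grading k m) f z) = (PP k m).presheaf.map (homOfLE hV).op
        (Proj.awayToSection (grading k m) (f * g) (awayMap (grading k m) hg rfl z)) := by
    intro z
    have := congrArg (fun φ => (PP k m).presheaf.map (homOfLE hV).op (φ.hom z))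
      (Proj.awayMap_awayToSection (grading k m) (f := f) hg rfl)
    exact (presheaf_map_map _ _ _).symm.trans this.symm
  have e2 : ∀ z : Away (grading k m) g, (PP k m).presheaf.map (homOfLE hVg).op
      (Proj.awayToSection (grading k m) g z) = (PP k m).presheaf.map (homOfLE hV).op
        (Proj.awayToSection (grading k m) (f * g)
          (awayMap (grading k m) hf (mul_comm f g) z)) := by
    intro z
    have := congrArg (fun φ => (PP k m).presheaf.map (homOfLE hV).op (φ.hom z))
      (Proj.awayMap_awayToSection (grading k m) (f := g) hf (mul_comm f g))
    exact (presheaf_map_map _ _ _).symm.trans this.symm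
  have key := map_homogeneous_of_map_X
    ((awayMap (grading k m) hf (mul_comm f g)).comp (linRatio hg))
    ((awayMap (grading k m) hg rfl).comp (linRatio hf))
    (awayMap (grading k m) hg rfl (linRatio hf g))
    (fun a => by
      simp only [RingHom.comp_apply, linRatio, MvPolynomial.eval₂Hom_C]
      exact (awayMap_constAway hg rfl a).trans (awayMap_constAway hf (mul_comm f g) a).symm)
    (fun i => by
      have hi : (MvPolynomial.X i : MvPolynomial (Fin (m + 1)) k) ∈ grading k m (1 • 1) := X_mem k i
      have hg' : g ∈ grading k m (1 • 1) := hg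
      simp only [RingHom.comp_apply]
      rw [linRatio_eq_mk hf (X_mem k i) hi, linRatio_eq_mk hg (X_mem k i) hi,
        linRatio_eq_mk hf hg hg']
      simp only [awayMap_mk]
      apply HomogeneousLocalization.val_injective
      rw [HomogeneousLocalization.val_mul]
      simp only [Away.val_mk, Localization.mk_mul]
      rw [Localization.mk_eq_mk_iff, Localization.r_iff_exists]
      refine ⟨1, ?_⟩
      simp
      ring) d G hG
  simp only [coordHom, RingHom.comp_apply] at key ⊢
  refine (e1 _).trans ?_
  rw [key, map_mul, map_mul, map_pow, map_pow]
  exact congrArg₂ (· * ·) (congrArg (· ^ d) (e1 _).symm) (e2 _).symm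

lemma evalAway_linRatio (ψ : Away (grading k m) f →+* T) (hu : IsUnit ((ψ.comp (linRatio hf)) f)) :
    evalAway (grading k m) (ψ.comp (linRatio hf)) hu = ψ := by
  refine (evalAway_unique (grading k m) _ hu hf ψ fun d a ha => ?_).symm
  have ha2 : a ∈ grading k m d := by rwa [smul_eq_mul, mul_one] at ha
  have hself : linRatio hf f = 1 := by
    apply (awayToSection_bijective hf).1
    rw [map_one]
    exact coordHom_self hf
  rw [RingHom.comp_apply, RingHom.comp_apply, hself, map_one, one_pow, mul_one,
    linRatio_eq_mk hf ha2 ha]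

/-- The point of `D₊(f)` with coordinates `ψ (x_i / f)`. -/
lemma pt_comp_coordHom (ψ : Γ(PP k m, Proj.basicOpen (grading k m) f) →+* T)
    (hu : IsUnit ((ψ.comp (coordHom hf)) f)) :
    pt (grading k m) (ψ.comp (coordHom hf)) hu hf one_pos = Spec.map (CommRingCat.ofHom ψ) ≫
      (Proj.isAffineOpen_basicOpen (grading k m) f hf one_pos).fromSpec := by
  rw [← SpecMap_awayToSection_awayι (grading k m) hf one_pos, pt, ← Category.assoc,
    ← Spec.map_comp]
  exact congrArg (fun φ => Spec.map (CommRingCat.ofHom φ) ≫ _)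
    (evalAway_linRatio hf (ψ.comp (Proj.awayToSection (grading k m) f).hom) hu)

/-- The homogeneous coordinates of a point, normalized by `f = 1`, with values in the
local ring. -/
def stalkCoord (y : PP k m) (hy : y ∈ Proj.basicOpen (grading k m) f) :
    MvPolynomial (Fin (m + 1)) k →+* (PP k m).presheaf.stalk y :=
  ((PP k m).presheaf.germ _ y hy).hom.comp (coordHom hf)

lemma stalkCoord_self (y : PP k m) (hy : y ∈ Proj.basicOpen (grading k m) f) :
    stalkCoord hf y hy f = 1 := by
  rw [stalkCoord, RingHom.comp_apply, coordHom_self, map_one]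

lemma isUnit_stalkCoord (y : PP k m) (hy : y ∈ Proj.basicOpen (grading k m) f) :
    IsUnit (stalkCoord hf y hy f) := by
  rw [stalkCoord_self]; exact isUnit_one

lemma pt_stalkCoord (y : PP k m) (hy : y ∈ Proj.basicOpen (grading k m) f)
    (hu : IsUnit (stalkCoord hf y hy f)) :
    pt (grading k m) (stalkCoord hf y hy) hu hf one_pos = (PP k m).fromSpecStalk y := by
  rw [← (Proj.isAffineOpen_basicOpen (grading k m) f hf one_pos).fromSpecStalk_eq_fromSpecStalk hy]
  exact pt_comp_coordHom hf ((PP k m).presheaf.germ _ y hy).hom hu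

/-- The evaluation of coordinates at a point. -/
lemma evalPt_pt_coordHom (θ : MvPolynomial (Fin (m + 1)) k →+* T) (hu : IsUnit (θ f))
    (h : ⊤ ≤ pt (grading k m) θ hu hf one_pos ⁻¹ᵁ Proj.basicOpen (grading k m) f) {d : ℕ}
    {G : MvPolynomial (Fin (m + 1)) k} (hG : G ∈ grading k m d) :
    evalPt (pt (grading k m) θ hu hf one_pos) (Proj.basicOpen (grading k m) f) h (coordHom hf G) *
      θ f ^ d = θ G := by
  have h1 := pt_appLE (grading k m) θ hu hf one_pos h
  have h2 := congrArg (fun φ => φ.hom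
    (Away.mk (grading k m) hf d G (by rwa [smul_eq_mul, mul_one])))
    (awayToSection_evalSection (grading k m) θ hu hf one_pos)
  rw [evalPt, h1, coordHom_eq_mk hf hG (by rwa [smul_eq_mul, mul_one]),
    ← evalAway_mk (grading k m) θ hu hf d G (by rwa [smul_eq_mul, mul_one])]
  exact congrArg (· * _) h2

lemma coordHom_C (a : k) : coordHom hf (MvPolynomial.C a) =
    (PP.toSpec k m).appLE ⊤ (Proj.basicOpen (grading k m) f) le_top
      ((Scheme.ΓSpecIso (.of k)).inv a) := by
  refine germ_ext fun y hy => ?_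
  have htop : ⊤ ≤ (PP k m).fromSpecStalk y ⁻¹ᵁ Proj.basicOpen (grading k m) f :=
    (Scheme.preimage_eq_top_of_closedPoint_mem ((PP k m).fromSpecStalk y) (by
        rw [Scheme.fromSpecStalk_closedPoint]; exact hy)).ge
  rw [← evalPt_fromSpecStalk hy htop, ← evalPt_fromSpecStalk hy htop]
  have hst := pt_stalkCoord hf y hy (isUnit_stalkCoord hf y hy)
  have e1 := (evalPt_comp (T := (PP k m).presheaf.stalk y) ((PP k m).fromSpecStalk y) (PP.toSpec k m) ⊤ le_top _ htop
    le_top ((Scheme.ΓSpecIso (.of k)).inv a))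
  refine Eq.trans ?_ e1
  have e2 : (PP k m).fromSpecStalk y ≫ PP.toSpec k m =
      Spec.map (CommRingCat.ofHom ((stalkCoord hf y hy).comp MvPolynomial.C)) := by
    rw [← hst, PP.toSpec, ← Category.assoc, pt_toSpecZero, ← Spec.map_comp,
      ← CommRingCat.ofHom_comp]
    rfl
  have e3 := (congrArg (fun φ => φ ((Scheme.ΓSpecIso (.of k)).inv a))
    (evalPt_congr (T := (PP k m).presheaf.stalk y) e2 (U := ⊤) le_top le_top)).trans
      (evalPt_SpecMap _ le_top _)
  refine Eq.trans ?_ e3.symm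
  rw [evalPt_fromSpecStalk hy htop]
  rw [← CommRingCat.comp_apply, Iso.inv_hom_id]
  rfl

/-- A linear form does not vanish at a `T`-valued point exactly where its value is invertible. -/
lemma mem_preimage_pt_basicOpen (θ : MvPolynomial (Fin (m + 1)) k →+* T) (hu : IsUnit (θ f))
    {d : ℕ} (hd : 0 < d) {G : MvPolynomial (Fin (m + 1)) k} (hG : G ∈ grading k m d)
    (p : Spec (.of T)) :
    pt (grading k m) θ hu hf one_pos p ∈ Proj.basicOpen (grading k m) G ↔
      θ G ∉ PrimeSpectrum.asIdeal p := by
  rw [pt, Scheme.Hom.comp_apply]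
  have h1 := Proj.awayι_preimage_basicOpen (grading k m) hf one_pos hG hd
  have h2 : ∀ q, Proj.awayι (grading k m) f hf one_pos q ∈ Proj.basicOpen (grading k m) G ↔
      q ∈ PrimeSpectrum.basicOpen (Away.isLocalizationElem hf hG) := fun q => by
    rw [← h1]; rfl
  rw [h2]
  change evalAway (grading k m) θ hu (Away.isLocalizationElem hf hG) ∉ PrimeSpectrum.asIdeal p ↔ _
  have h3 := evalAway_mk (grading k m) θ hu hf d (G ^ 1) (by
    rw [pow_one, smul_eq_mul, mul_one]; exact hG)
  refine not_congr ((Ideal.mul_unit_mem_iff_mem (PrimeSpectrum.asIdeal (R := T) p)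
    (hu.pow d)).symm.trans ?_)
  exact iff_of_eq (congrArg (· ∈ PrimeSpectrum.asIdeal (R := T) p)
    (h3.trans (congrArg θ (pow_one G))))

end Coordinates

end CubicSRC

end

noncomputable section

namespace CubicSRC

attribute [local instance] MvPolynomial.gradedAlgebra

open HomogeneousLocalization

/-! ### Integral hypersurfaces -/

section Integral

variable {k : Type u} [Field k] {n : ℕ} {X : Scheme.{u}}

lemma exists_mem_chart (y : PP k n) : ∃ j : Fin (n + 1), y ∈ (chart j : (PP k n).Opens) := by
  have h := Proj.iSup_basicOpen_eq_top' (grading k n)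
    (fun j : Fin (n + 1) => (MvPolynomial.X j : MvPolynomial (Fin (n + 1)) k))
    (fun j => ⟨1, X_mem k j⟩) (by
      refine eq_top_iff.2 fun p _ => ?_
      induction p using MvPolynomial.induction_on with
      | C a =>
        exact Subalgebra.algebraMap_mem (Algebra.adjoin (grading k n 0) _)
          (⟨MvPolynomial.C a, MvPolynomial.isHomogeneous_C _ a⟩ : grading k n 0)
      | add p q hp hq => exact add_mem (hp trivial) (hq trivial)
      | mul_X p j hp => exact mul_mem (hp trivial) (Algebra.subset_adjoin ⟨j, rfl⟩))
  have hy : y ∈ (⊤ : (PP k n).Opens) := trivial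
  rw [← h] at hy
  exact TopologicalSpace.Opens.mem_iSup.1 hy

/-- A form does not vanish at a point if and only if its germ there is a unit. -/
lemma mem_basicOpen_iff_isUnit_stalkCoord {f : MvPolynomial (Fin (n + 1)) k}
    (hf : f ∈ grading k n 1) (y : PP k n)
    (hy : y ∈ Proj.basicOpen (grading k n) f) {d : ℕ} (hd : 0 < d)
    {G : MvPolynomial (Fin (n + 1)) k} (hG : G ∈ grading k n d) :
    y ∈ Proj.basicOpen (grading k n) G ↔ IsUnit (stalkCoord hf y hy G) := by
  have h1 := mem_preimage_pt_basicOpen hf (stalkCoord hf y hy) (isUnit_stalkCoord hf y hy) hd hG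
    (IsLocalRing.closedPoint ((PP k n).presheaf.stalk y))
  rw [pt_stalkCoord] at h1
  have h2 := Scheme.fromSpecStalk_closedPoint (X := PP k n) (x := y)
  have h3 : IsUnit (stalkCoord hf y hy G) ↔
      stalkCoord hf y hy G ∉ IsLocalRing.maximalIdeal ((PP k n).presheaf.stalk y) := by
    rw [IsLocalRing.mem_maximalIdeal, mem_nonunits_iff, not_not]
  rw [h3]
  refine Iff.trans (iff_of_eq ?_) h1
  exact congrArg (· ∈ Proj.basicOpen (grading k n) G) h2.symm

variable {i : X ⟶ PP k n} {d : ℕ} {F : MvPolynomial (Fin (n + 1)) k}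

lemma mem_of_mem_range (hd : 0 < d) (hF : F.IsHomogeneous d)
    (hker : ∀ j, RingHom.ker (i.app (chart j)).hom = Ideal.span {dehomogenize F hF j}) (x : X) :
    F ∈ (i x).asHomogeneousIdeal := by
  by_contra hcon
  obtain ⟨j, hj⟩ := exists_mem_chart (i x)
  have hu := (mem_basicOpen_iff_isUnit_stalkCoord (X_mem k j) (i x) hj hd hF).1 hcon
  have h0 : i.app (chart j) (dehomogenize F hF j) = 0 := by
    have : dehomogenize F hF j ∈ RingHom.ker (i.app (chart j)).hom := by
      rw [hker]; exact Ideal.mem_span_singleton_self _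
    exact this
  have h1 := hu.map (i.stalkMap x).hom
  rw [stalkCoord, RingHom.comp_apply, ← dehomogenize_eq_coordHom F hF] at h1
  have h2 := Scheme.Hom.germ_stalkMap_apply i (chart j) x hj (dehomogenize F hF j)
  rw [h0, map_zero] at h2
  have h3 : (i.stalkMap x).hom (((PP k n).presheaf.germ (chart j) (i x) hj).hom
    (dehomogenize F hF j)) = 0 := h2
  rw [h3] at h1
  exact not_isUnit_zero h1

lemma coordHom_mem_span_iff (hF : F.IsHomogeneous d) (j : Fin (n + 1)) {e : ℕ}
    {G : MvPolynomial (Fin (n + 1)) k} (hG : G ∈ grading k n e) :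
    coordHom (X_mem k j) G ∈ Ideal.span {coordHom (X_mem k j) F} ↔
      ∃ r, MvPolynomial.X j ^ r * G ∈ Ideal.span {F} := by
  constructor
  · intro h
    obtain ⟨z, hz⟩ := Ideal.mem_span_singleton'.1 h
    obtain ⟨p, b, hb, rfl⟩ := exists_homogeneous_coordHom_eq (X_mem k j) z
    refine ⟨p + d, ?_⟩
    -- The powers of x_j bring both terms to the common degree p + d + e; on forms of one degree,
    -- setting x_j = 1 is injective.
    have hG1 : MvPolynomial.X j ^ (p + d) * G - MvPolynomial.X j ^ e * (b * F) ∈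
        grading k n (p + d + e) := by
      refine Submodule.sub_mem _ ?_ ?_
      · have := (MvPolynomial.isHomogeneous_X_pow (R := k) j (p + d)).mul hG
        exact this
      · have := (MvPolynomial.isHomogeneous_X_pow (R := k) j e).mul (hb.mul hF)
        rw [add_comm e (p + d)] at this
        exact this
    have h0 := eq_zero_of_coordHom_eq_zero (X_mem k j) (MvPolynomial.X_ne_zero j) hG1 (by
      rw [map_sub, map_mul, map_mul, map_mul, map_pow, map_pow, coordHom_self, hz, one_pow, one_pow,
        sub_self])
    rw [sub_eq_zero] at h0
    rw [h0, ← mul_assoc]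
    exact Ideal.mul_mem_left _ _ (Ideal.mem_span_singleton_self F)
  · rintro ⟨r, h⟩
    obtain ⟨b, hb⟩ := Ideal.mem_span_singleton'.1 h
    have := congrArg (coordHom (X_mem k j)) hb
    rw [map_mul, map_mul, map_pow, coordHom_self, one_pow, one_mul] at this
    exact Ideal.mem_span_singleton'.2 ⟨_, this⟩

lemma isReduced_of_isPrime [IsClosedImmersion i] (hF : F.IsHomogeneous d)
    (hker : ∀ j, RingHom.ker (i.app (chart j)).hom = Ideal.span {dehomogenize F hF j})
    (hP : (Ideal.span {F}).IsPrime) : AlgebraicGeometry.IsReduced X := by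
  have hred : ∀ j, _root_.IsReduced Γ(X, i ⁻¹ᵁ chart j) := by
    intro j
    refine ⟨fun a ⟨r, hr⟩ => ?_⟩
    have hU := Proj.isAffineOpen_basicOpen (grading k n) (MvPolynomial.X j) (X_mem k j) one_pos
    obtain ⟨z, rfl⟩ := i.app_surjective (chart j) hU a
    obtain ⟨e, G, hG, rfl⟩ := exists_homogeneous_coordHom_eq (X_mem k j) z
    rw [← map_pow, ← map_pow] at hr
    have h1 : coordHom (X_mem k j) (G ^ r) ∈ RingHom.ker (i.app (chart j)).hom := hr
    rw [hker, dehomogenize_eq_coordHom, coordHom_mem_span_iff hF j (SetLike.pow_mem_graded r hG)] at h1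
    obtain ⟨s, hs⟩ := h1
    suffices h2 : coordHom (X_mem k j) G ∈ RingHom.ker (i.app (chart j)).hom from h2
    rw [hker, dehomogenize_eq_coordHom, coordHom_mem_span_iff hF j hG]
    rcases hP.mem_or_mem hs with h | h
    · exact ⟨s, Ideal.mul_mem_right _ _ h⟩
    · exact ⟨0, by rw [pow_zero, one_mul]; exact hP.mem_of_pow_mem _ h⟩
  have : ∀ x : X, _root_.IsReduced (X.presheaf.stalk x) := by
    intro x
    obtain ⟨j, hj⟩ := exists_mem_chart (i x)
    have hU := (Proj.isAffineOpen_basicOpen (grading k n) (MvPolynomial.X j) (X_mem k j)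
      one_pos).preimage i
    let x' : (i ⁻¹ᵁ chart j : X.Opens) := ⟨x, hj⟩
    have hloc := hU.isLocalization_stalk x'
    let : Algebra Γ(X, i ⁻¹ᵁ chart j) (X.presheaf.stalk x) :=
      ((X.presheaf.germ (i ⁻¹ᵁ chart j) x hj).hom).toAlgebra
    exact isReduced_localizationPreserves (hU.primeIdealOf x').asIdeal.primeCompl
      (X.presheaf.stalk x) (hred j)
  exact isReduced_of_isReduced_stalk X

lemma le_of_homogeneous (x y : PP k n)
    (h : ∀ (e : ℕ) (a : MvPolynomial (Fin (n + 1)) k), 0 < e → a ∈ grading k n e →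
      a ∈ x.asHomogeneousIdeal → a ∈ y.asHomogeneousIdeal) : x ⤳ y := by
  refine specializes_iff_mem_closure.2 ((ProjectiveSpectrum.le_iff_mem_closure _ x y).1 ?_)
  obtain ⟨j, hj⟩ := exists_mem_chart y
  intro a ha
  classical
  rw [← DirectSum.sum_support_decompose (grading k n) a]
  refine Ideal.sum_mem _ fun e _ => ?_
  -- The hypothesis covers positive degrees only; a component of degree e is first multiplied by a
  -- coordinate x_j that does not vanish at y.
  have h1 := x.asHomogeneousIdeal.isHomogeneous e ha
  have h2 := h (1 + e) _ (by lia) (SetLike.mul_mem_graded (X_mem k j) (SetLike.coe_mem _))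
    (Ideal.mul_mem_left _ (MvPolynomial.X j) h1)
  exact (y.isPrime.mem_or_mem h2).resolve_left hj

/-- The tautological point with values in the fraction field of k[x]/(F) is a generic point of X: a
form vanishing there is a multiple of F and so vanishes on all of X. Together with reducedness this
gives integrality. -/
theorem isIntegral_of_isPrime [IsClosedImmersion i] (hd : 0 < d) (hF : F.IsHomogeneous d)
    (hker : ∀ j, RingHom.ker (i.app (chart j)).hom = Ideal.span {dehomogenize F hF j})
    (hP : (Ideal.span {F}).IsPrime) (hX : ∃ j, MvPolynomial.X j ∉ Ideal.span {F}) :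
    AlgebraicGeometry.IsIntegral X := by
  have := isReduced_of_isPrime hF hker hP
  obtain ⟨j, hj⟩ := hX
  let T := FractionRing (MvPolynomial (Fin (n + 1)) k ⧸ Ideal.span {F})
  let θ : MvPolynomial (Fin (n + 1)) k →+* T := 
    (algebraMap (MvPolynomial (Fin (n + 1)) k ⧸ Ideal.span {F}) T).comp (Ideal.Quotient.mk _)
  have hθ : ∀ a, θ a = 0 ↔ a ∈ Ideal.span {F} := fun a => by
    rw [RingHom.comp_apply, ← Ideal.Quotient.eq_zero_iff_mem]
    exact map_eq_zero_iff _ (IsFractionRing.injective _ T)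
  have hu : IsUnit (θ (MvPolynomial.X j)) := isUnit_iff_ne_zero.2 (mt (hθ _).1 hj)
  obtain ⟨g, hg⟩ := exists_lift_pt hF (hker j) θ hu ((hθ F).2 (Ideal.mem_span_singleton_self F))
  let p : Spec (.of T) := (⊥ : PrimeSpectrum T)
  have hgen : ∀ x : X, g p ⤳ x := by
    intro x
    rw [← i.isClosedEmbedding.isInducing.specializes_iff]
    refine le_of_homogeneous _ _ fun e a he ha h => ?_
    have h1 : i (g p) = pt (grading k n) θ hu (X_mem k j) one_pos p := by
      rw [← hg, Scheme.Hom.comp_apply]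
    have h2 := mem_preimage_pt_basicOpen (X_mem k j) θ hu he ha p
    rw [← h1] at h2
    have h3 : θ a ∈ (⊥ : Ideal T) := by
      by_contra hcon
      exact h2.2 hcon h
    have h4 := (hθ a).1 h3
    obtain ⟨b, rfl⟩ := Ideal.mem_span_singleton'.1 h4
    exact Ideal.mul_mem_left _ _ (mem_of_mem_range hd hF hker x)
  have : IrreducibleSpace X := by
    have huniv : closure ({g p} : Set X) = Set.univ :=
      Set.eq_univ_of_forall fun x => (hgen x).mem_closure
    refine { toNonempty := ⟨g p⟩, isPreirreducible_univ := ?_ }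
    rw [← huniv]
    exact (isIrreducible_singleton (x := g p)).closure.isPreirreducible
  exact isIntegral_of_irreducibleSpace_of_isReduced X

instance : AlgebraicGeometry.IsIntegral (PP k n) := by
  -- Projective space is the hypersurface of the zero form in itself; the degree 1 is assigned to
  -- the zero form because a positive degree is required.
  refine isIntegral_of_isPrime (i := 𝟙 (PP k n)) (d := 1) (F := 0) one_pos
    (MvPolynomial.isHomogeneous_zero _ _ _) (fun j => ?_) ?_ ⟨0, ?_⟩
  · rw [dehomogenize_eq_coordHom, map_zero, Ideal.span_singleton_eq_bot.2 rfl, ← RingHom.injective_iff_ker_eq_bot]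
    exact (ConcreteCategory.bijective_of_isIso ((𝟙 (PP k n) : PP k n ⟶ PP k n).app (chart j))).1
  · rw [Ideal.span_singleton_eq_bot.2 rfl]
    exact Ideal.isPrime_bot
  · rw [Ideal.span_singleton_eq_bot.2 rfl]
    exact MvPolynomial.X_ne_zero _

end Integral

end CubicSRC

end

/-! ### Sections of the tangent sheaf attached to tuples of forms, and their values on coordinates.
-/

noncomputable section

namespace CubicSRC

attribute [local instance] MvPolynomial.gradedAlgebra

open HomogeneousLocalization TrivSqZeroExt

/-! ### First order deformations of tuples of forms -/

section DualEval

variable {k : Type u} [Field k] {n : ℕ} {T T₂ : Type u} [CommRing T] [CommRing T₂]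

/-- The substitution `x_i ↦ h_i`. -/
abbrev formHom (h : Fin (n + 1) → Bin k) : MvPolynomial (Fin (n + 1)) k →+* Bin k :=
  (MvPolynomial.aeval h).toRingHom

/-- The substitution `x_i ↦ h_i + ε s_i`. -/
def dualEval (χ : Bin k →+* T) (h s : Fin (n + 1) → Bin k) :
    MvPolynomial (Fin (n + 1)) k →+* DualNumber T :=
  MvPolynomial.eval₂Hom ((inlHom T T).comp (χ.comp MvPolynomial.C))
    (fun i => inl (χ (h i)) + inr (χ (s i)))

lemma fst_dualEval (χ : Bin k →+* T) (h s : Fin (n + 1) → Bin k)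
    (G : MvPolynomial (Fin (n + 1)) k) :
    (dualEval χ h s G).fst = χ (MvPolynomial.aeval h G) := by
  induction G using MvPolynomial.induction_on with
  | C a => simp [dualEval, MvPolynomial.algebraMap_eq]
  | add p q hp hq => simp [hp, hq]
  | mul_X p i hp => rw [map_mul, fst_mul, hp]; simp [dualEval]

lemma snd_dualEval (χ : Bin k →+* T) (h s : Fin (n + 1) → Bin k)
    (G : MvPolynomial (Fin (n + 1)) k) :
    (dualEval χ h s G).snd =
      ∑ i, χ (s i) * χ (MvPolynomial.aeval h (MvPolynomial.pderiv i G)) := by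
  induction G using MvPolynomial.induction_on with
  | C a => simp [dualEval]
  | add p q hp hq => simp [hp, hq, mul_add, Finset.sum_add_distrib]
  | mul_X p i hp =>
    rw [map_mul, DualNumber.snd_mul, fst_dualEval, hp]
    have h1 : (dualEval χ h s (MvPolynomial.X i)).fst = χ (h i) := by simp [dualEval]
    have h2 : (dualEval χ h s (MvPolynomial.X i)).snd = χ (s i) := by simp [dualEval]
    rw [h1, h2]
    simp only [Derivation.leibniz, smul_eq_mul, map_add, map_mul, MvPolynomial.aeval_X,
      MvPolynomial.pderiv_X, mul_add, Finset.sum_add_distrib]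
    congr 1
    · rw [Finset.sum_eq_single i]
      · simp [mul_comm]
      · intro b _ hb
        simp [hb.symm]
      · simp
    · rw [Finset.sum_mul]
      exact Finset.sum_congr rfl fun j _ => by ring

lemma dualFst_comp_dualEval (χ : Bin k →+* T) (h s : Fin (n + 1) → Bin k) :
    (dualFst T).comp (dualEval χ h s) = χ.comp (formHom h) :=
  RingHom.ext fun G => fst_dualEval χ h s G

lemma dualMap_comp_dualEval (φ : T →+* T₂) (χ : Bin k →+* T) (h s : Fin (n + 1) → Bin k) :
    (dualMap φ).comp (dualEval χ h s) = dualEval (φ.comp χ) h s := by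
  refine RingHom.ext fun G => TrivSqZeroExt.ext ?_ ?_
  · simp [fst_dualEval]
  · simp [snd_dualEval]

lemma dualEval_eq_zero (χ : Bin k →+* T) {h s : Fin (n + 1) → Bin k}
    {F : MvPolynomial (Fin (n + 1)) k} (hF : MvPolynomial.aeval h F = 0)
    (hs : ∑ i, s i * MvPolynomial.aeval h (MvPolynomial.pderiv i F) = 0) :
    dualEval χ h s F = 0 := by
  refine TrivSqZeroExt.ext ?_ ?_
  · rw [fst_dualEval, hF, map_zero, fst_zero]
  · rw [snd_dualEval, snd_zero, ← map_zero χ, ← hs, map_sum]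
    simp

end DualEval

/-! ### The tangent sections attached to first order deformations -/

section Curve

variable {k : Type u} [Field k] {n : ℕ} {X : Scheme.{u}}

lemma exists_isUnit_of_pow_mem_span {R : Type*} [CommRing R] [IsLocalRing R] (χ : Bin k →+* R)
    (h : Fin (n + 1) → Bin k) {c : Fin (1 + 1)} (hc : χ (MvPolynomial.X c) = 1) {N : ℕ}
    (hN : MvPolynomial.X c ^ N ∈ Ideal.span (Set.range h)) : ∃ j, IsUnit (χ (h j)) := by
  by_contra! hcon
  have h1 : Ideal.span (Set.range h) ≤ (IsLocalRing.maximalIdeal R).comap χ := by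
    rw [Ideal.span_le]
    rintro _ ⟨j, rfl⟩
    exact (IsLocalRing.mem_maximalIdeal _).2 (hcon j)
  have h2 : χ (MvPolynomial.X c ^ N) ∈ IsLocalRing.maximalIdeal R := h1 hN
  rw [map_pow, hc, one_pow] at h2
  exact (IsLocalRing.mem_maximalIdeal _).1 h2 isUnit_one

lemma exists_notMem_of_pow_mem_span (h : Fin (n + 1) → Bin k)
    (hN : ∀ c : Fin (1 + 1), ∃ N : ℕ, MvPolynomial.X c ^ N ∈ Ideal.span (Set.range h))
    (y : PP k 1) : ∃ j, h j ∉ y.asHomogeneousIdeal := by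
  by_contra! hcon
  obtain ⟨c, hc⟩ := exists_mem_chart y
  obtain ⟨N, hN⟩ := hN c
  have h1 : Ideal.span (Set.range h) ≤ y.asHomogeneousIdeal.toIdeal := by
    rw [Ideal.span_le]
    rintro _ ⟨j, rfl⟩
    exact hcon j
  exact hc (y.isPrime.mem_of_pow_mem _ (h1 hN))

/-- A morphism `g : ℙ¹ ⟶ X` is given by the tuple of forms `h`. -/
def IsGivenBy (i : X ⟶ PP k n) (g : PP k 1 ⟶ X) (h : Fin (n + 1) → Bin k) : Prop :=
  ∀ (T : Type u) [CommRing T] (χ : Bin k →+* T) (f : Bin k) (hf : IsUnit (χ f)) (d' : ℕ)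
    (hd : f ∈ grading k 1 d') (h0 : 0 < d') (j : Fin (n + 1))
    (hj : IsUnit ((χ.comp (formHom h)) (MvPolynomial.X j))),
    pt (grading k 1) χ hf hd h0 ≫ g ≫ i =
      pt (grading k n) (χ.comp (formHom h)) hj (X_mem k j) one_pos

variable {i : X ⟶ PP k n} {d : ℕ} {F : MvPolynomial (Fin (n + 1)) k}
  {g : PP k 1 ⟶ X} {h : Fin (n + 1) → Bin k}

lemma genericPoint_mem_chart {m : ℕ} (c : Fin (m + 1)) :
    genericPoint (PP k m) ∈ (chart c : (PP k m).Opens) := by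
  let θ : MvPolynomial (Fin (m + 1)) k →+* k := MvPolynomial.eval fun _ => 1
  have hu : IsUnit (θ (MvPolynomial.X c)) := by simp [θ]
  have h := range_pt_subset (grading k m) θ hu (X_mem k c) one_pos
  let p : Spec (.of k) := IsLocalRing.closedPoint k
  have hp : p ∈ (⊤ : (Spec (.of k)).Opens) := trivial
  rw [← h] at hp
  exact ((genericPoint_spec (PP k m)).mem_open_set_iff (chart c).isOpen).2 ⟨_, trivial, hp⟩

lemma algebraMap_comp_stalkCoord {m : ℕ} {f : MvPolynomial (Fin (m + 1)) k}
    (hf : f ∈ grading k m 1) (y : PP k m) (hy : y ∈ Proj.basicOpen (grading k m) f)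
    (hη : genericPoint (PP k m) ∈ Proj.basicOpen (grading k m) f) :
    (algebraMap ((PP k m).presheaf.stalk y) (PP k m).functionField).comp (stalkCoord hf y hy) =
      stalkCoord hf (genericPoint (PP k m)) hη := by
  refine RingHom.ext fun G => ?_
  have : Nonempty (Proj.basicOpen (grading k m) f : (PP k m).Opens) := ⟨⟨y, hy⟩⟩
  exact Scheme.algebraMap_germ_eq_germToFunctionField (X := PP k m) hy (coordHom hf G)

lemma IsGivenBy.fromSpecStalk_comp (hg : IsGivenBy i g h)
    (hN : ∀ c : Fin (1 + 1), ∃ N : ℕ, MvPolynomial.X c ^ N ∈ Ideal.span (Set.range h))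
    {c : Fin (1 + 1)} (y : PP k 1) (hy : y ∈ (chart c : (PP k 1).Opens))
    {f : MvPolynomial (Fin (n + 1)) k} (hf : f ∈ grading k n 1)
    (hu : IsUnit (((stalkCoord (X_mem k c) y hy).comp (formHom h)) f)) :
    (PP k 1).fromSpecStalk y ≫ g ≫ i = pt (T := (PP k 1).presheaf.stalk y) (grading k n)
      ((stalkCoord (X_mem k c) y hy).comp (formHom h)) hu hf one_pos := by
  obtain ⟨N, hN⟩ := hN c
  obtain ⟨j, hj⟩ := exists_isUnit_of_pow_mem_span (stalkCoord (X_mem k c) y hy) h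
    (stalkCoord_self _ _ _) hN
  have hj' : IsUnit (((stalkCoord (X_mem k c) y hy).comp (formHom h))
    (MvPolynomial.X j)) := by simpa using hj
  rw [← pt_stalkCoord (X_mem k c) y hy (isUnit_stalkCoord _ _ _),
    pt_eq (grading k n) _ hu hf one_pos hj' (X_mem k j) one_pos]
  exact hg _ _ _ _ _ _ _ j hj'

/-- The tuple h + εs satisfies F to first order, so it is a point of X over the dual numbers of each
local ring. The formula is the quotient rule for x_l / f with the denominator f(h)² cleared. Binary
forms are evaluated with the c-th coordinate equal to 1, so the section depends on the chart; for s
of degree one less than h the two charts differ by a factor u / v, as for a section of (h^*T_X)(-1).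
-/
theorem IsGivenBy.exists_tangentSection [IsClosedImmersion i] (hg : IsGivenBy i g h)
    (hF : F.IsHomogeneous d)
    (hker : ∀ j, RingHom.ker (i.app (chart j)).hom = Ideal.span {dehomogenize F hF j})
    (hFh : MvPolynomial.aeval h F = 0)
    (hN : ∀ c : Fin (1 + 1), ∃ N : ℕ, MvPolynomial.X c ^ N ∈ Ideal.span (Set.range h))
    (s : Fin (n + 1) → Bin k)
    (hs : ∑ i, s i * MvPolynomial.aeval h (MvPolynomial.pderiv i F) = 0) (c : Fin (1 + 1)) :
    ∃ σ : tangentSections (i ≫ PP.toSpec k n) g (chart c),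
      ∀ (f : MvPolynomial (Fin (n + 1)) k) (hf : f ∈ grading k n 1) (l : Fin (n + 1))
        (y : PP k 1) (hyW : y ∈ (chart c : (PP k 1).Opens))
        (hyU : y ∈ g ⁻¹ᵁ i ⁻¹ᵁ Proj.basicOpen (grading k n) f),
        IsUnit (stalkCoord (X_mem k c) y hyW (MvPolynomial.aeval h f)) →
        (PP k 1).presheaf.germ (chart c ⊓ g ⁻¹ᵁ i ⁻¹ᵁ Proj.basicOpen (grading k n) f) y ⟨hyW, hyU⟩
          (σ.1 (i ⁻¹ᵁ Proj.basicOpen (grading k n) f)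
            (i.app (Proj.basicOpen (grading k n) f) (coordHom hf (MvPolynomial.X l)))) *
          stalkCoord (X_mem k c) y hyW (MvPolynomial.aeval h f) ^ 2 =
        stalkCoord (X_mem k c) y hyW (s l * MvPolynomial.aeval h f -
          h l * ∑ a, s a * MvPolynomial.aeval h (MvPolynomial.pderiv a f)) := by
  have hexj : ∀ (y : PP k 1) (hy : y ∈ (chart c : (PP k 1).Opens)), ∃ j : Fin (n + 1),
      IsUnit (stalkCoord (X_mem k c) y hy (h j)) := fun y hy => by
    obtain ⟨N, hN⟩ := hN c
    exact exists_isUnit_of_pow_mem_span _ h (stalkCoord_self _ _ _) hN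
  choose j hj using hexj
  have hθu : ∀ (y : PP k 1) (hy : y ∈ (chart c : (PP k 1).Opens))
      (G : MvPolynomial (Fin (n + 1)) k),
      IsUnit (stalkCoord (X_mem k c) y hy (MvPolynomial.aeval h G)) →
      IsUnit (dualEval (stalkCoord (X_mem k c) y hy) h s G) := fun y hy G hG => by
    rw [TrivSqZeroExt.isUnit_iff_isUnit_fst, fst_dualEval]
    exact hG
  have hj' : ∀ (y : PP k 1) (hy : y ∈ (chart c : (PP k 1).Opens)),
      IsUnit (stalkCoord (X_mem k c) y hy (MvPolynomial.aeval h
        (MvPolynomial.X (j y hy) : MvPolynomial (Fin (n + 1)) k))) :=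
    fun y hy => by rw [MvPolynomial.aeval_X]; exact hj y hy
  choose Ψ hΨ using fun (y : PP k 1) (hy : y ∈ (chart c : (PP k 1).Opens)) =>
    exists_lift_pt (T := DualNumber ((PP k 1).presheaf.stalk y)) hF (hker (j y hy))
      (dualEval (stalkCoord (X_mem k c) y hy) h s)
      (hθu y hy _ (hj' y hy)) (dualEval_eq_zero _ hFh hs)
  have hη : genericPoint (PP k 1) ∈ (chart c : (PP k 1).Opens) :=
    genericPoint_mem_chart c
  obtain ⟨σ, hσ⟩ := CubicSRC.exists_tangentSection (i ≫ PP.toSpec k n) g (chart c) Ψ hη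
    (fun y hy => by
      rw [← cancel_mono i, Category.assoc, hΨ, hΨ, SpecMap_pt]
      have e1 := (dualMap_comp_dualEval (algebraMap ((PP k 1).presheaf.stalk y)
        (PP k 1).functionField) (stalkCoord (X_mem k c) y hy) h s).trans
        (congrArg (fun χ => dualEval χ h s) (algebraMap_comp_stalkCoord (X_mem k c) y hy hη))
      exact (pt_congr _ e1 _ _ _).trans (pt_eq _ _ _ _ _ _ _ _))
    (fun y hy => by
      rw [← cancel_mono i, Category.assoc, hΨ, SpecMap_pt, Category.assoc,
        hg.fromSpecStalk_comp hN y hy (X_mem k (j y hy)) (hj' y hy)]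
      exact pt_congr _ (dualFst_comp_dualEval _ h s) _ _ _)
    (fun y hy => by
      refine ⟨(stalkCoord (X_mem k c) y hy).comp MvPolynomial.C, ?_⟩
      rw [reassoc_of% hΨ, PP.toSpec, ← Category.assoc, pt_toSpecZero, ← Spec.map_comp,
        ← CommRingCat.ofHom_comp]
      congr 2
      refine RingHom.ext fun a => ?_
      exact MvPolynomial.eval₂Hom_C _ _ a)
  refine ⟨σ, fun f hf l y hyW hyU hu => ?_⟩
  have hpt : Ψ y hyW ≫ i = pt (grading k n) (dualEval (stalkCoord (X_mem k c) y hyW) h s)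
      (hθu y hyW f hu) hf one_pos := (hΨ y hyW).trans (pt_eq _ _ _ _ _ _ _ _)
  have htop2 : ⊤ ≤ pt (grading k n) (dualEval (stalkCoord (X_mem k c) y hyW) h s)
      (hθu y hyW f hu) hf one_pos ⁻¹ᵁ Proj.basicOpen (grading k n) f :=
    (range_pt_subset _ _ _ _ _).ge
  have htop1 : ⊤ ≤ (Ψ y hyW ≫ i) ⁻¹ᵁ Proj.basicOpen (grading k n) f := by
    rw [hpt]; exact htop2
  have htop : ⊤ ≤ Ψ y hyW ⁻¹ᵁ i ⁻¹ᵁ Proj.basicOpen (grading k n) f := htop1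
  rw [hσ _ _ y hyW hyU htop, Scheme.Hom.app_eq_appLE,
    ← evalPt_comp (Ψ y hyW) i _ htop1 _ htop le_rfl, evalPt_congr hpt htop1 htop2]
  have hz := evalPt_pt_coordHom hf (dualEval (stalkCoord (X_mem k c) y hyW) h s)
    (hθu y hyW f hu) htop2 (X_mem k l)
  set z := evalPt _ _ htop2 (coordHom hf (MvPolynomial.X l)) with hzdef
  rw [pow_one] at hz
  have hz1 := congrArg TrivSqZeroExt.fst hz
  have hz2 := congrArg TrivSqZeroExt.snd hz
  rw [fst_mul, fst_dualEval, fst_dualEval, MvPolynomial.aeval_X] at hz1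
  have hXl : (dualEval (stalkCoord (X_mem k c) y hyW) h s (MvPolynomial.X l)).snd =
      stalkCoord (X_mem k c) y hyW (s l) := by simp [dualEval]
  rw [DualNumber.snd_mul, fst_dualEval, hXl, snd_dualEval] at hz2
  rw [map_sub, map_mul, map_mul, map_sum, ← hz1, ← hz2]
  simp only [map_mul]
  ring

end Curve

end CubicSRC

end

noncomputable section

namespace CubicSRC

attribute [local instance] MvPolynomial.gradedAlgebra

open HomogeneousLocalization TrivSqZeroExt

/-! ### Tangent sections are determined by their values on coordinates -/

section Determined

variable {k : Type u} [Field k] {n : ℕ} {X : Scheme.{u}} {i : X ⟶ PP k n} {d : ℕ}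
  {F : MvPolynomial (Fin (n + 1)) k} {Y : Scheme.{u}} {g : Y ⟶ X}
  {f : MvPolynomial (Fin (n + 1)) k} (hf : f ∈ grading k n 1)

/-- The affine coordinates `x_l / f` on `X ∩ D₊(f)`. -/
def restrictedCoord (i : X ⟶ PP k n) :
    MvPolynomial (Fin (n + 1)) k →+* Γ(X, i ⁻¹ᵁ Proj.basicOpen (grading k n) f) :=
  (i.app (Proj.basicOpen (grading k n) f)).hom.comp (coordHom hf)

lemma restrictedCoord_surjective [IsClosedImmersion i] :
    Function.Surjective (restrictedCoord hf i) :=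
  (i.app_surjective _ (Proj.isAffineOpen_basicOpen (grading k n) f hf one_pos)).comp
    (coordHom_surjective hf)

/-- The chain rule for a derivation that kills constants. Applied to F and to f below, it yields the
linear conditions on the values at the coordinates. -/
lemma tangentSections_restrictedCoord {W : Y.Opens}
    (E : tangentSections (i ≫ PP.toSpec k n) g W) (G : MvPolynomial (Fin (n + 1)) k) :
    E.1 (i ⁻¹ᵁ Proj.basicOpen (grading k n) f) (restrictedCoord hf i G) =
      ∑ l, g.appLE (i ⁻¹ᵁ Proj.basicOpen (grading k n) f) _ inf_le_right
        (restrictedCoord hf i (MvPolynomial.pderiv l G)) *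
        E.1 (i ⁻¹ᵁ Proj.basicOpen (grading k n) f) (restrictedCoord hf i (MvPolynomial.X l)) := by
  obtain ⟨E, hE₁, hE₂, hE₃⟩ := E
  induction G using MvPolynomial.induction_on with
  | C a =>
    have h1 : restrictedCoord hf i (MvPolynomial.C a) = (i ≫ PP.toSpec k n).appLE ⊤
        (i ⁻¹ᵁ Proj.basicOpen (grading k n) f) le_top ((Scheme.ΓSpecIso (.of k)).inv a) := by
      rw [restrictedCoord, RingHom.comp_apply, coordHom_C, ← Scheme.Hom.appLE_comp_appLE i
        (PP.toSpec k n) ⊤ (Proj.basicOpen (grading k n) f) _ le_top le_rfl, CommRingCat.comp_apply,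
        Scheme.Hom.app_eq_appLE]
    rw [h1]
    simp only [hE₂]
    simp
  | add p q hp hq =>
    simp only [map_add, add_mul, Finset.sum_add_distrib] at hp hq ⊢
    rw [hp, hq]
  | mul_X p l hp =>
    rw [map_mul]
    simp only [hE₁] at hp ⊢
    rw [hp]
    simp only [Derivation.leibniz, smul_eq_mul, map_add, map_mul, MvPolynomial.pderiv_X, add_mul,
      Finset.sum_add_distrib]
    congr 1
    · rw [Finset.sum_eq_single l]
      · simp
      · intro b _ hb
        simp [hb.symm]
      · simp
    · rw [Finset.mul_sum]
      exact Finset.sum_congr rfl fun j _ => by ring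

/-- The equation of X is given on the standard charts only. On D₊(f) ∩ D₊(x_j) the dehomogenizations
by f and by x_j differ by the factor (x_j / f) ^ d. -/
lemma restrictedCoord_eq_zero (hF : F.IsHomogeneous d)
    (hker : ∀ j, RingHom.ker (i.app (chart j)).hom = Ideal.span {dehomogenize F hF j}) :
    restrictedCoord hf i F = 0 := by
  refine germ_ext fun x hx => ?_
  obtain ⟨j, hj⟩ := exists_mem_chart (i x)
  let V : (PP k n).Opens := Proj.basicOpen (grading k n) f ⊓ chart j
  have h1 := map_coordHom_eq hf (X_mem k j) V inf_le_left inf_le_right (G := F) (d := d) hF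
  have h0 : i.app (chart j) (coordHom (X_mem k j) F) = 0 := by
    have : dehomogenize F hF j ∈ RingHom.ker (i.app (chart j)).hom := by
      rw [hker]; exact Ideal.mem_span_singleton_self _
    rw [dehomogenize_eq_coordHom] at this
    exact this
  have hnat : ∀ (U : (PP k n).Opens) (hVU : V ≤ U) (z : Γ(PP k n, U)),
      i.app V ((PP k n).presheaf.map (homOfLE hVU).op z) =
        X.presheaf.map (homOfLE (i.preimage_mono hVU)).op (i.app U z) := fun U hVU z => by
    rw [← CommRingCat.comp_apply, ← CommRingCat.comp_apply]
    exact congrArg (fun φ => φ.hom z) (i.naturality (homOfLE hVU).op)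
  have h2 := congrArg (i.app V) h1
  rw [map_mul, hnat, hnat _ _ (coordHom (X_mem k j) F), h0, map_zero, mul_zero] at h2
  have hxV : x ∈ i ⁻¹ᵁ V := ⟨hx, hj⟩
  rw [map_zero, ← TopCat.Presheaf.germ_res_apply X.presheaf
    (homOfLE (i.preimage_mono (inf_le_left : V ≤ _))) x hxV]
  exact (congrArg _ h2).trans (map_zero _)

/-- Since W maps into the single affine chart D₊(f), a derivation is determined by the coordinates
there: functions on that chart are polynomials in them, and functions on smaller opens are locally
fractions a / r ^ m. -/
theorem tangentSections_eq_zero [IsClosedImmersion i] {W : Y.Opens}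
    (E : tangentSections (i ≫ PP.toSpec k n) g W)
    (hW : W ≤ g ⁻¹ᵁ i ⁻¹ᵁ Proj.basicOpen (grading k n) f)
    (hE : ∀ l, E.1 (i ⁻¹ᵁ Proj.basicOpen (grading k n) f)
      (restrictedCoord hf i (MvPolynomial.X l)) = 0) : E = 0 := by
  have hEU : ∀ z, E.1 (i ⁻¹ᵁ Proj.basicOpen (grading k n) f) z = 0 := by
    intro z
    obtain ⟨G, rfl⟩ := restrictedCoord_surjective hf z
    rw [tangentSections_restrictedCoord hf]
    exact Finset.sum_eq_zero fun l _ => by rw [hE, mul_zero]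
  obtain ⟨E, hE₁, hE₂, hE₃⟩ := E
  refine Subtype.ext (funext fun V => AddMonoidHom.ext fun z => germ_ext fun y hy => ?_)
  have hU : IsAffineOpen (i ⁻¹ᵁ Proj.basicOpen (grading k n) f) :=
    (Proj.isAffineOpen_basicOpen (grading k n) f hf one_pos).preimage i
  obtain ⟨r, hrV, hr⟩ := hU.exists_basicOpen_le (V := V) ⟨g y, hy.2⟩ (hW hy.1)
  have hloc := hU.isLocalization_basicOpen r
  have hBU := X.basicOpen_le r
  let res : Γ(X, i ⁻¹ᵁ Proj.basicOpen (grading k n) f) →+* Γ(X, X.basicOpen r) :=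
    (X.presheaf.map (homOfLE hBU).op).hom
  have hEB : ∀ a, E (X.basicOpen r) (res a) = 0 := fun a => by
    refine (hE₃ _ _ hBU a).trans ?_
    have := hEU a
    simp only at this
    rw [this, map_zero]
  let z' : Γ(X, X.basicOpen r) := X.presheaf.map (homOfLE hrV).op z
  obtain ⟨m, a, ha⟩ := IsLocalization.Away.surj r z'
  have ha' : z' * res (r ^ m) = res a := by rw [map_pow]; exact ha
  have hu : IsUnit (res r) := IsLocalization.Away.algebraMap_isUnit (S := Γ(X, X.basicOpen r)) r
  -- The Leibniz rule for z' · r ^ m = a, with the derivatives of a and of r ^ m already zero,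
  -- leaves an invertible multiple of the derivative of z'.
  have h1 := hE₁ (X.basicOpen r) z' (res (r ^ m))
  rw [ha', hEB, hEB, mul_zero, zero_add] at h1
  have hu' : IsUnit (g.appLE (X.basicOpen r) (W ⊓ g ⁻¹ᵁ X.basicOpen r) inf_le_right (res (r ^ m))) := by
    rw [map_pow]
    exact (hu.pow m).map (g.appLE (X.basicOpen r) (W ⊓ g ⁻¹ᵁ X.basicOpen r) inf_le_right).hom
  have h2 := (hu'.mul_right_eq_zero).1 h1.symm
  have h3 := (hE₃ _ _ hrV z).symm.trans h2
  have hyB : y ∈ W ⊓ g ⁻¹ᵁ X.basicOpen r := ⟨hy.1, hr⟩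
  rw [← TopCat.Presheaf.germ_res_apply Y.presheaf
    (homOfLE (inf_le_inf_left W (g.preimage_mono hrV))) y hyB]
  refine (congrArg _ h3).trans ?_
  rw [map_zero]
  exact (map_zero _).symm

end Determined

end CubicSRC

end

/-! ### Vanishing of H¹ from spanning deformations of degree two. -/

noncomputable section

namespace CubicSRC

attribute [local instance] MvPolynomial.gradedAlgebra

open HomogeneousLocalization TrivSqZeroExt

/-! ### Vanishing of the first cohomology -/

/-- This eliminates the Euler multiple e • H. Applying the linear form α to b = ∑ c_m S_m + e H
gives e w = -∑ c_m α(S_m), because α(b) = 0 and α(H) = w. -/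
lemma mul_eq_sum_of_sum_eq_zero {R ι J : Type*} [CommRing R] [Fintype ι] [Fintype J] (c : ι → R)
    (e : R) (S : ι → J → R) (H α b : J → R) (hb : ∀ l, b l = ∑ m, c m * S m l + e * H l)
    (hα : ∑ l, α l * b l = 0) (w : R) (hw : w = ∑ l, α l * H l) (l : J) :
    w * b l = ∑ m, c m * (S m l * w - H l * ∑ j, S m j * α j) := by
  have h1 : ∑ m, c m * ∑ j, S m j * α j + e * w = 0 := by
    rw [← hα, hw]
    simp only [hb, mul_add, Finset.sum_add_distrib, Finset.mul_sum]
    congr 1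
    · rw [Finset.sum_comm]
      exact Finset.sum_congr rfl fun _ _ => Finset.sum_congr rfl fun _ _ => by ring
    · exact Finset.sum_congr rfl fun _ _ => by ring
  have h2 : ∑ m, c m * (S m l * w - H l * ∑ j, S m j * α j) =
      w * ∑ m, c m * S m l - H l * ∑ m, c m * ∑ j, S m j * α j := by
    rw [Finset.mul_sum, Finset.mul_sum, ← Finset.sum_sub_distrib]
    exact Finset.sum_congr rfl fun _ _ => by ring
  rw [h2, hb]
  linear_combination H l * h1

section GermVal

variable {X Y S : Scheme.{u}} (s : X ⟶ S) (g : Y ⟶ X) {W : Y.Opens} (U : X.Opens) (z : Γ(X, U))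
  (y : Y) (hyW : y ∈ W) (hyU : y ∈ g ⁻¹ᵁ U)

/-- The germ at `y` of the value of a tangent section on a function. -/
def germVal : tangentSections s g W →+ Y.presheaf.stalk y where
  toFun E := Y.presheaf.germ (W ⊓ g ⁻¹ᵁ U) y ⟨hyW, hyU⟩ (E.1 U z)
  map_zero' := map_zero _
  map_add' E E' := map_add (Y.presheaf.germ (W ⊓ g ⁻¹ᵁ U) y ⟨hyW, hyU⟩).hom (E.1 U z) (E'.1 U z)

lemma germVal_tangentRestrict {W' : Y.Opens} (hW : W' ≤ W) (hyW' : y ∈ W')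
    (E : tangentSections s g W) :
    germVal s g U z y hyW' hyU (tangentRestrict s g hW E) = germVal s g U z y hyW hyU E :=
  TopCat.Presheaf.germ_res_apply Y.presheaf _ y _ _

lemma germVal_tangentMul (a : Γ(Y, W)) (E : tangentSections s g W) :
    germVal s g U z y hyW hyU (tangentMul s g a E) =
      Y.presheaf.germ W y hyW a * germVal s g U z y hyW hyU E := by
  refine (map_mul (Y.presheaf.germ (W ⊓ g ⁻¹ᵁ U) y ⟨hyW, hyU⟩).hom _ (E.1 U z)).trans ?_
  exact congrArg (· * _) (TopCat.Presheaf.germ_res_apply Y.presheaf _ y _ _)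

lemma germVal_cechDifferential {k : Type u} [Field k] {X : Scheme.{u}} (s : X ⟶ Spec (.of k))
    (g : PP k 1 ⟶ X) (m : ℕ) (U : X.Opens) (z : Γ(X, U)) (y : PP k 1)
    (hy : y ∈ (chart 0 ⊓ chart 1 : (PP k 1).Opens)) (hyU : y ∈ g ⁻¹ᵁ U)
    (e₀ : tangentSections s g (chart 0)) (e₁ : tangentSections s g (chart 1)) :
    germVal s g U z y hy hyU (cechDifferential s g m (e₀, e₁)) =
      (PP k 1).presheaf.germ (chart 1) y hy.2 (coordUV ^ m) * germVal s g U z y hy.2 hyU e₁ -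
        germVal s g U z y hy.1 hyU e₀ := by
  have h1 := germVal_tangentRestrict s g U z y hy.2 hyU (W' := chart 0 ⊓ chart 1) inf_le_right hy
    (tangentMul s g (coordUV ^ m) e₁)
  have h0 := germVal_tangentRestrict s g U z y hy.1 hyU (W' := chart 0 ⊓ chart 1) inf_le_left hy e₀
  rw [← germVal_tangentMul, ← h1, ← h0]
  exact map_sub (germVal s g U z y hy hyU) _ _

end GermVal

section Cohomology

variable {k : Type u} [Field k] {n : ℕ} {X : Scheme.{u}} {i : X ⟶ PP k n} {d : ℕ}
  {F : MvPolynomial (Fin (n + 1)) k} {g : PP k 1 ⟶ X} {h : Fin (n + 1) → Bin k}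

/-- The algebraic data behind a very free curve of degree three: a tuple `h` of binary cubic forms
that satisfies the equation `F`, together with first order deformations, given by binary quadratic
forms, that generate all first order deformations where `u v` is invertible. -/
structure IsVeryFreeTuple (F : MvPolynomial (Fin (n + 1)) k) (h : Fin (n + 1) → Bin k) : Prop where
  isHomogeneous : ∀ j, h j ∈ grading k 1 3
  aeval_eq_zero : MvPolynomial.aeval h F = 0
  pow_mem_span : ∀ c : Fin (1 + 1), ∃ N : ℕ, MvPolynomial.X c ^ N ∈ Ideal.span (Set.range h)
  -- Such a linear form f pulls back to u²v, so the overlap of the two charts of the line lands in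
  -- the single affine chart D₊(f) of X.
  exists_linear : ∃ a : Fin (n + 1) → k,
    ∑ j, MvPolynomial.C (a j) * h j = MvPolynomial.X 0 ^ 2 * MvPolynomial.X 1
  exists_deformations : ∃ (ι : Type) (_ : Fintype ι) (s : ι → Fin (n + 1) → Bin k),
    (∀ m j, s m j ∈ grading k 1 2) ∧
    (∀ m, ∑ j, s m j * MvPolynomial.aeval h (MvPolynomial.pderiv j F) = 0) ∧
    -- The vectors b killed by the gradient of F along h represent tangent vectors of X; the term
    -- with e is the Euler direction, which becomes zero in the tangent bundle.
    ∀ (R : Type u) [CommRing R] (φ : Bin k →+* R), IsUnit (φ (MvPolynomial.X 0)) →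
      IsUnit (φ (MvPolynomial.X 1)) → ∀ b : Fin (n + 1) → R,
      ∑ j, b j * φ (MvPolynomial.aeval h (MvPolynomial.pderiv j F)) = 0 →
      ∃ (c : ι → R) (e : R), ∀ l, b l = ∑ m, c m * φ (s m l) + e * φ (h l)

lemma stalkCoord_eq {m : ℕ} {f f' : MvPolynomial (Fin (m + 1)) k} (hf : f ∈ grading k m 1)
    (hf' : f' ∈ grading k m 1) (y : PP k m) (hy : y ∈ Proj.basicOpen (grading k m) f)
    (hy' : y ∈ Proj.basicOpen (grading k m) f') {e : ℕ} {G : MvPolynomial (Fin (m + 1)) k}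
    (hG : G ∈ grading k m e) :
    stalkCoord hf y hy G = stalkCoord hf y hy f' ^ e * stalkCoord hf' y hy' G := by
  let V := Proj.basicOpen (grading k m) f ⊓ Proj.basicOpen (grading k m) f'
  have hyV : y ∈ V := ⟨hy, hy'⟩
  have h1 := congrArg ((PP k m).presheaf.germ V y hyV)
    (map_coordHom_eq hf hf' V inf_le_left inf_le_right hG)
  rw [map_mul, map_pow, TopCat.Presheaf.germ_res_apply, TopCat.Presheaf.germ_res_apply,
    TopCat.Presheaf.germ_res_apply] at h1
  exact h1

/-- A section over the overlap of the two charts of `ℙ¹` is the sum of a function regular on the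
first chart and of `u / v` times a function regular on the second. -/
lemma exists_split (a : Γ(PP k 1, chart 0 ⊓ chart 1)) :
    ∃ (p : Γ(PP k 1, chart 0)) (q : Γ(PP k 1, chart 1)), ∀ (y : PP k 1)
      (hy : y ∈ (chart 0 ⊓ chart 1 : (PP k 1).Opens)),
      (PP k 1).presheaf.germ _ y hy a = (PP k 1).presheaf.germ _ y hy.1 p +
        stalkCoord (X_mem k 1) y hy.2 (MvPolynomial.X 0) * (PP k 1).presheaf.germ _ y hy.2 q := by
  have hdeg : (MvPolynomial.X 0 * MvPolynomial.X 1 : Bin k) ∈ grading k 1 2 :=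
    (MvPolynomial.isHomogeneous_X k 0).mul (MvPolynomial.isHomogeneous_X k 1)
  have hop : Proj.basicOpen (grading k 1) (MvPolynomial.X 0 * MvPolynomial.X 1 : Bin k) =
      chart 0 ⊓ chart 1 := Proj.basicOpen_mul _ _ _
  have hinv : ∀ (y : PP k 1) (hy : y ∈ (chart 0 ⊓ chart 1 : (PP k 1).Opens)),
      stalkCoord (X_mem k 0) y hy.1 (MvPolynomial.X 1) *
        stalkCoord (X_mem k 1) y hy.2 (MvPolynomial.X 0) = 1 := fun y hy => by
    have := stalkCoord_eq (X_mem k 0) (X_mem k 1) y hy.1 hy.2 (X_mem k 0)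
    rw [stalkCoord_self, pow_one] at this
    exact this.symm
  -- This is H¹(O(-1)) = 0. In the coordinate v / u the fraction G / (uv) ^ N is a combination of
  -- powers of v / u: exponents at least 0 are regular on the first chart, and negative ones are u /
  -- v times a function regular on the second.
  have hsplit : ∀ (N : ℕ) (G : Bin k), ∃ (p : Γ(PP k 1, chart 0)) (q : Γ(PP k 1, chart 1)),
      ∀ (y : PP k 1) (hy : y ∈ (chart 0 ⊓ chart 1 : (PP k 1).Opens)),
      stalkCoord (X_mem k 0) y hy.1 G = stalkCoord (X_mem k 0) y hy.1 (MvPolynomial.X 1) ^ N *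
        ((PP k 1).presheaf.germ _ y hy.1 p + stalkCoord (X_mem k 1) y hy.2 (MvPolynomial.X 0) *
          (PP k 1).presheaf.germ _ y hy.2 q) := by
    intro N G
    induction G using MvPolynomial.induction_on' with
    | monomial s c =>
      have hmon : ∀ (y : PP k 1) (hy : y ∈ (chart 0 : (PP k 1).Opens)),
          stalkCoord (X_mem k 0) y hy (MvPolynomial.monomial s c) =
          stalkCoord (X_mem k 0) y hy (MvPolynomial.C c) *
            stalkCoord (X_mem k 0) y hy (MvPolynomial.X 1) ^ (s 1) := fun y hy => by
        rw [MvPolynomial.monomial_eq, Finsupp.prod_fintype _ _ (fun _ => pow_zero _),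
          Fin.prod_univ_two, map_mul, map_mul, map_pow, map_pow, stalkCoord_self, one_pow, one_mul]
      rcases le_total N (s 1) with hle | hle
      · refine ⟨coordHom (X_mem k 0) (MvPolynomial.C c * MvPolynomial.X 1 ^ (s 1 - N)), 0,
          fun y hy => ?_⟩
        rw [hmon, map_zero, mul_zero, add_zero]
        change _ = _ * stalkCoord (X_mem k 0) y hy.1 _
        rw [map_mul, map_pow, mul_left_comm, ← pow_add, Nat.add_sub_cancel' hle]
      · rcases hle.eq_or_lt with heq | hlt
        · refine ⟨coordHom (X_mem k 0) (MvPolynomial.C c), 0, fun y hy => ?_⟩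
          rw [hmon, map_zero, mul_zero, add_zero, heq]
          exact mul_comm _ _
        · refine ⟨0, coordHom (X_mem k 1) (MvPolynomial.C c * MvPolynomial.X 0 ^ (N - s 1 - 1)),
            fun y hy => ?_⟩
          rw [hmon, map_zero, zero_add]
          change _ = _ * (_ * stalkCoord (X_mem k 1) y hy.2 _)
          have hC : stalkCoord (X_mem k 0) y hy.1 (MvPolynomial.C c) =
              stalkCoord (X_mem k 1) y hy.2 (MvPolynomial.C c) := by
            have := stalkCoord_eq (X_mem k 0) (X_mem k 1) y hy.1 hy.2
              (MvPolynomial.isHomogeneous_C (Fin (1 + 1)) c)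
            rwa [pow_zero, one_mul] at this
          have hN : N = s 1 + (N - s 1 - 1 + 1) := by lia
          rw [map_mul, map_pow, hC]
          conv_rhs => rw [hN]
          rw [pow_add, show s 1 + (N - s 1 - 1 + 1) - s 1 - 1 = N - s 1 - 1 by lia]
          have := congrArg (· ^ (N - s 1 - 1 + 1)) (hinv y hy)
          simp only [mul_pow, one_pow] at this
          rw [pow_succ (stalkCoord (X_mem k 1) y hy.2 (MvPolynomial.X 0))] at this
          linear_combination (- stalkCoord (X_mem k 1) y hy.2 (MvPolynomial.C c) *
            stalkCoord (X_mem k 0) y hy.1 (MvPolynomial.X 1) ^ s 1) * this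
    | add G H hG hH =>
      obtain ⟨p, q, hpq⟩ := hG
      obtain ⟨p', q', hpq'⟩ := hH
      refine ⟨p + p', q + q', fun y hy => ?_⟩
      rw [map_add, hpq y hy, hpq' y hy, map_add, map_add]
      ring
  have := isIso_awayToSection (grading k 1) hdeg two_pos
  let a' : Γ(PP k 1, Proj.basicOpen (grading k 1) (MvPolynomial.X 0 * MvPolynomial.X 1 : Bin k)) :=
    (PP k 1).presheaf.map (homOfLE hop.le).op a
  obtain ⟨x, hx⟩ := (ConcreteCategory.bijective_of_isIso (Proj.awayToSection (grading k 1)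
    (MvPolynomial.X 0 * MvPolynomial.X 1))).2 a'
  obtain ⟨N, G, hG, rfl⟩ := Away.mk_surjective (grading k 1) hdeg x
  obtain ⟨p, q, hpq⟩ := hsplit N G
  refine ⟨p, q, fun y hy => ?_⟩
  have hyop : y ∈ Proj.basicOpen (grading k 1) (MvPolynomial.X 0 * MvPolynomial.X 1 : Bin k) := by
    rw [hop]; exact hy
  have hu1 : IsUnit (stalkCoord (X_mem k 0) y hy.1 (MvPolynomial.X 1)) :=
    IsUnit.of_mul_eq_one _ (hinv y hy)
  have hu : IsUnit (stalkCoord (X_mem k 0) y hy.1 (MvPolynomial.X 0 * MvPolynomial.X 1)) := by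
    rw [map_mul, stalkCoord_self, one_mul]; exact hu1
  have hst : (PP k 1).fromSpecStalk y = pt (T := (PP k 1).presheaf.stalk y) (grading k 1)
      (stalkCoord (X_mem k 0) y hy.1) hu hdeg two_pos :=
    (pt_stalkCoord (X_mem k 0) y hy.1 (isUnit_stalkCoord _ _ _)).symm.trans
      (pt_eq (grading k 1) _ _ _ _ _ _ _)
  have htop : ⊤ ≤ pt (T := (PP k 1).presheaf.stalk y) (grading k 1)
      (stalkCoord (X_mem k 0) y hy.1) hu hdeg two_pos ⁻¹ᵁ
        Proj.basicOpen (grading k 1) (MvPolynomial.X 0 * MvPolynomial.X 1) :=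
    (range_pt_subset _ _ _ _ _).ge
  have htop' : ⊤ ≤ (PP k 1).fromSpecStalk y ⁻¹ᵁ
      Proj.basicOpen (grading k 1) (MvPolynomial.X 0 * MvPolynomial.X 1) := by
    rw [hst]; exact htop
  have e1 : (PP k 1).presheaf.germ _ y hy a = (PP k 1).presheaf.germ _ y hyop a' :=
    (TopCat.Presheaf.germ_res_apply (PP k 1).presheaf (homOfLE hop.le) y hyop a).symm
  have e2 : (PP k 1).presheaf.germ _ y hyop a' *
      stalkCoord (X_mem k 0) y hy.1 (MvPolynomial.X 0 * MvPolynomial.X 1) ^ N =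
      stalkCoord (X_mem k 0) y hy.1 G := by
    have e3 : (PP k 1).presheaf.germ _ y hyop a' = evalPt (pt (T := (PP k 1).presheaf.stalk y)
        (grading k 1) (stalkCoord (X_mem k 0) y hy.1) hu hdeg two_pos) _ htop a' :=
      (evalPt_fromSpecStalk hyop htop' a').symm.trans (congrArg (fun φ => φ a')
        (evalPt_congr (T := (PP k 1).presheaf.stalk y) hst htop' htop))
    rw [e3, evalPt, pt_appLE,
      ← evalAway_mk (grading k 1) (stalkCoord (X_mem k 0) y hy.1) hu hdeg N G hG, ← hx]
    exact congrArg (· * _) (congrArg (fun φ => φ.hom (Away.mk (grading k 1) hdeg N G hG))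
      (awayToSection_evalSection (grading k 1) (stalkCoord (X_mem k 0) y hy.1) hu hdeg two_pos))
  rw [e1]
  refine (hu.pow N).mul_right_cancel (e2.trans ((hpq y hy).trans ?_))
  rw [map_mul, stalkCoord_self, one_mul, mul_comm]

/-- The values of coordinates along a curve given by forms. -/
lemma IsGivenBy.germ_appLE (hg : IsGivenBy i g h)
    (hN : ∀ c : Fin (1 + 1), ∃ N : ℕ, MvPolynomial.X c ^ N ∈ Ideal.span (Set.range h))
    {f : MvPolynomial (Fin (n + 1)) k} (hf : f ∈ grading k n 1) {c : Fin (1 + 1)} (y : PP k 1)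
    (hy : y ∈ (chart c : (PP k 1).Opens))
    (hu : IsUnit (stalkCoord (X_mem k c) y hy (MvPolynomial.aeval h f))) {V : (PP k 1).Opens}
    (hyV : y ∈ V) (hV : V ≤ g ⁻¹ᵁ i ⁻¹ᵁ Proj.basicOpen (grading k n) f) {e : ℕ}
    {G : MvPolynomial (Fin (n + 1)) k} (hG : G ∈ grading k n e) :
    (PP k 1).presheaf.germ V y hyV (g.appLE _ V hV (restrictedCoord hf i G)) *
      stalkCoord (X_mem k c) y hy (MvPolynomial.aeval h f) ^ e =
      stalkCoord (X_mem k c) y hy (MvPolynomial.aeval h G) := by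
  have hst := hg.fromSpecStalk_comp hN y hy hf hu
  have htop : ⊤ ≤ (PP k 1).fromSpecStalk y ⁻¹ᵁ V :=
    (Scheme.preimage_eq_top_of_closedPoint_mem ((PP k 1).fromSpecStalk y) (by
        rw [Scheme.fromSpecStalk_closedPoint]; exact hyV)).ge
  have htop2 : ⊤ ≤ pt (T := (PP k 1).presheaf.stalk y) (grading k n)
      ((stalkCoord (X_mem k c) y hy).comp (formHom h)) hu hf one_pos ⁻¹ᵁ
      Proj.basicOpen (grading k n) f := (range_pt_subset _ _ _ _ _).ge
  have htop1 : ⊤ ≤ ((PP k 1).fromSpecStalk y ≫ g ≫ i) ⁻¹ᵁ Proj.basicOpen (grading k n) f := by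
    rw [hst]; exact htop2
  have e0 : g.appLE _ V hV (restrictedCoord hf i G) = 
      (g ≫ i).appLE (Proj.basicOpen (grading k n) f) V hV (coordHom hf G) := by
    rw [← Scheme.Hom.appLE_comp_appLE g i _ (i ⁻¹ᵁ Proj.basicOpen (grading k n) f) V le_rfl hV,
      CommRingCat.comp_apply, ← Scheme.Hom.app_eq_appLE]
    rfl
  have e1 := (evalPt_comp (T := (PP k 1).presheaf.stalk y) ((PP k 1).fromSpecStalk y) (g ≫ i) _
    htop1 V htop hV (coordHom hf G)).trans (evalPt_fromSpecStalk hyV htop _)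
  have e2 := congrArg (fun φ => φ (coordHom hf G))
    (evalPt_congr (T := (PP k 1).presheaf.stalk y) hst htop1 htop2)
  have e3 := evalPt_pt_coordHom hf ((stalkCoord (X_mem k c) y hy).comp (formHom h)) hu htop2 hG
  rw [e0, ← e1]
  exact (congrArg (· * _) e2).trans e3

lemma IsGivenBy.le_preimage (hg : IsGivenBy i g h)
    (hN : ∀ c : Fin (1 + 1), ∃ N : ℕ, MvPolynomial.X c ^ N ∈ Ideal.span (Set.range h))
    {f : MvPolynomial (Fin (n + 1)) k} (hf : f ∈ grading k n 1) {c : Fin (1 + 1)} (y : PP k 1)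
    (hy : y ∈ (chart c : (PP k 1).Opens))
    (hu : IsUnit (stalkCoord (X_mem k c) y hy (MvPolynomial.aeval h f))) :
    y ∈ g ⁻¹ᵁ i ⁻¹ᵁ Proj.basicOpen (grading k n) f := by
  have hst := hg.fromSpecStalk_comp hN y hy hf hu
  let p : Spec ((PP k 1).presheaf.stalk y) := IsLocalRing.closedPoint ((PP k 1).presheaf.stalk y)
  have h1 : pt (T := (PP k 1).presheaf.stalk y) (grading k n)
      ((stalkCoord (X_mem k c) y hy).comp (formHom h)) hu hf one_pos p ∈
      Proj.basicOpen (grading k n) f := by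
    have : p ∈ (⊤ : (Spec ((PP k 1).presheaf.stalk y)).Opens) := trivial
    exact (range_pt_subset (T := (PP k 1).presheaf.stalk y) (grading k n)
      ((stalkCoord (X_mem k c) y hy).comp (formHom h)) hu hf one_pos).ge this
  rw [← hst] at h1
  have h2 : ((PP k 1).fromSpecStalk y ≫ g ≫ i) p = i (g y) := by
    rw [Scheme.Hom.comp_apply, Scheme.fromSpecStalk_closedPoint, Scheme.Hom.comp_apply]
  rw [h2] at h1
  exact h1

-- The forms s_m define global sections of (h^*T_X)(-1) that span over the overlap. A Čech 1-cocycle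
-- is just a section over the overlap, hence a combination of them, and splitting its coefficients
-- by `exists_split` exhibits it as a coboundary. Spanning at u = 0 and at v = 0 is not needed.
set_option maxHeartbeats 800000 in
theorem IsVeryFreeTuple.subsingleton_H1 [IsClosedImmersion i] (hF : F.IsHomogeneous 3)
    (hker : ∀ j, RingHom.ker (i.app (chart j)).hom = Ideal.span {dehomogenize F hF j})
    (hg : IsGivenBy i g h) (hv : IsVeryFreeTuple F h) :
    Subsingleton (H1 (i ≫ PP.toSpec k n) g 2) := by
  have hN := hv.pow_mem_span
  obtain ⟨a, ha⟩ := hv.exists_linear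
  obtain ⟨ι, _, s, hs2, hsF, hspan⟩ := hv.exists_deformations
  let f : MvPolynomial (Fin (n + 1)) k := ∑ j, MvPolynomial.C (a j) * MvPolynomial.X j
  have hf : f ∈ grading k n 1 := Submodule.sum_mem _ fun j _ => by
    rw [← MvPolynomial.smul_eq_C_mul]
    exact Submodule.smul_mem _ _ (X_mem k j)
  have hfh : MvPolynomial.aeval h f = MvPolynomial.X 0 ^ 2 * MvPolynomial.X 1 := by
    rw [← ha, map_sum]
    simp [MvPolynomial.algebraMap_eq]
  have hpd : ∀ l, MvPolynomial.pderiv l f = MvPolynomial.C (a l) := fun l => by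
    simp [f, MvPolynomial.pderiv_X, Pi.single_apply, Derivation.leibniz]
  clear_value f
  let W : (PP k 1).Opens := chart 0 ⊓ chart 1
  have hinv : ∀ (y : PP k 1) (hy : y ∈ W), stalkCoord (X_mem k 0) y hy.1 (MvPolynomial.X 1) *
      stalkCoord (X_mem k 1) y hy.2 (MvPolynomial.X 0) = 1 := fun y hy => by
    have := stalkCoord_eq (X_mem k 0) (X_mem k 1) y hy.1 hy.2 (X_mem k 0)
    rw [stalkCoord_self, pow_one] at this
    exact this.symm
  have hu0 : ∀ (y : PP k 1) (hy : y ∈ W),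
      IsUnit (stalkCoord (X_mem k 0) y hy.1 (MvPolynomial.aeval h f)) := fun y hy => by
    rw [hfh, map_mul, map_pow, stalkCoord_self, one_pow, one_mul]
    exact IsUnit.of_mul_eq_one _ (hinv y hy)
  have hu1 : ∀ (y : PP k 1) (hy : y ∈ W),
      IsUnit (stalkCoord (X_mem k 1) y hy.2 (MvPolynomial.aeval h f)) := fun y hy => by
    rw [hfh, map_mul, map_pow, stalkCoord_self, mul_one]
    exact (IsUnit.of_mul_eq_one_right _ (hinv y hy)).pow 2
  let U : X.Opens := i ⁻¹ᵁ Proj.basicOpen (grading k n) f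
  have hW : W ≤ g ⁻¹ᵁ U := fun y hy => hg.le_preimage hN hf y hy.1 (hu0 y hy)
  let V : (PP k 1).Opens := W ⊓ g ⁻¹ᵁ U
  let χ : Bin k →+* Γ(PP k 1, V) := ((PP k 1).presheaf.map
    (homOfLE (inf_le_left.trans inf_le_left : V ≤ chart 0)).op).hom.comp (coordHom (X_mem k 0))
  have hχ : ∀ (y : PP k 1) (hy : y ∈ V) (G : Bin k), (PP k 1).presheaf.germ V y hy (χ G) =
      stalkCoord (X_mem k 0) y hy.1.1 G := fun y hy G =>
    TopCat.Presheaf.germ_res_apply (PP k 1).presheaf _ y hy _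
  have hχu0 : χ (MvPolynomial.X 0) = 1 := by
    rw [RingHom.comp_apply, coordHom_self, map_one]
  have hχu1 : IsUnit (χ (MvPolynomial.X 1)) := by
    refine IsUnit.of_mul_eq_one ((PP k 1).presheaf.map
      (homOfLE (inf_le_left.trans inf_le_right : V ≤ chart 1)).op
        (coordHom (X_mem k 1) (MvPolynomial.X 0))) ?_
    have := map_coordHom_eq (X_mem k 0) (X_mem k 1) V (inf_le_left.trans inf_le_left)
      (inf_le_left.trans inf_le_right) (X_mem k 0)
    rw [coordHom_self, map_one, pow_one] at this
    exact this.symm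
  clear_value χ
  choose σ₀ hσ₀ using fun m => hg.exists_tangentSection hF hker hv.aeval_eq_zero hN (s m) (hsF m) 0
  choose σ₁ hσ₁ using fun m => hg.exists_tangentSection hF hker hv.aeval_eq_zero hN (s m) (hsF m) 1
  suffices hsurj : ∀ D : tangentSections (i ≫ PP.toSpec k n) g (chart 0 ⊓ chart 1),
      ∃ e, cechDifferential (i ≫ PP.toSpec k n) g 2 e = D by
    refine ⟨fun x y => ?_⟩
    have hz : ∀ z : H1 (i ≫ PP.toSpec k n) g 2, z = 0 := fun z => by
      obtain ⟨D, rfl⟩ := QuotientAddGroup.mk_surjective z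
      exact (QuotientAddGroup.eq_zero_iff D).2 (hsurj D)
    rw [hz x, hz y]
  intro D
  let b : Fin (n + 1) → Γ(PP k 1, V) := fun l => D.1 U (restrictedCoord hf i (MvPolynomial.X l))
  have hDF : ∑ l, b l * χ (MvPolynomial.aeval h (MvPolynomial.pderiv l F)) = 0 := by
    have h1 := tangentSections_restrictedCoord hf D F
    rw [restrictedCoord_eq_zero hf hF hker, map_zero] at h1
    refine germ_ext fun y hy => ?_
    have h2 := congrArg ((PP k 1).presheaf.germ V y hy) h1.symm
    rw [map_sum, map_zero] at h2
    rw [map_sum, map_zero, ← zero_mul (stalkCoord (X_mem k 0) y hy.1.1 (MvPolynomial.aeval h f) ^ 2),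
      ← h2, Finset.sum_mul]
    refine Finset.sum_congr rfl fun l _ => ?_
    rw [map_mul, map_mul, hχ, ← hg.germ_appLE hN hf y hy.1.1 (hu0 y hy.1) hy inf_le_right
      (hF.pderiv : MvPolynomial.pderiv l F ∈ grading k n 2)]
    ring
  -- The derivative of f / f = 1 is zero.
  have hDf : ∑ l, χ (MvPolynomial.C (a l)) * b l = 0 := by
    have h1 := tangentSections_restrictedCoord hf D f
    have h0 : restrictedCoord hf i f = 1 := by
      rw [restrictedCoord, RingHom.comp_apply, coordHom_self, map_one]
    have h01 : D.1 U 1 = 0 := by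
      have := D.2.1 U 1 1
      have h11 : g.appLE U (chart 0 ⊓ chart 1 ⊓ g ⁻¹ᵁ U) inf_le_right 1 = 1 := map_one _
      rw [mul_one, h11, one_mul] at this
      exact left_eq_add.1 this
    rw [h0] at h1
    have h1' := h01.symm.trans h1
    refine germ_ext fun y hy => ?_
    have h2 := congrArg ((PP k 1).presheaf.germ V y hy) h1'.symm
    rw [map_sum, map_zero] at h2
    rw [map_sum, map_zero, ← h2]
    refine Finset.sum_congr rfl fun l _ => ?_
    rw [map_mul, map_mul, hχ]
    have h3 := hg.germ_appLE hN hf y hy.1.1 (hu0 y hy.1) hy inf_le_right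
      (MvPolynomial.isHomogeneous_C (Fin (n + 1)) (a l) :
        MvPolynomial.C (a l) ∈ grading k n 0)
    rw [pow_zero, mul_one, ← hpd] at h3
    rw [h3, hpd, MvPolynomial.aeval_C, MvPolynomial.algebraMap_eq]
  obtain ⟨c, e, hce⟩ := hspan _ χ (hχu0 ▸ isUnit_one) hχu1 b hDF
  -- With w = f(h), the cocycle turns out to be D = ∑ (w c_m) σ₀ m, so the coefficients w c_m are
  -- the ones to split.
  choose p q hpq using fun m => exists_split ((PP k 1).presheaf.map
    (homOfLE (le_inf le_rfl hW : W ≤ V)).op (χ (MvPolynomial.aeval h f) * c m))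
  refine ⟨(-∑ m, tangentMul _ g (p m) (σ₀ m), ∑ m, tangentMul _ g (q m) (σ₁ m)), ?_⟩
  rw [← sub_eq_zero]
  refine tangentSections_eq_zero hf _ hW fun l => germ_ext fun y hy => ?_
  have hy1 : y ∈ (chart 0 : (PP k 1).Opens) := hy.1.1
  have hy2 : y ∈ (chart 1 : (PP k 1).Opens) := hy.1.2
  let z := restrictedCoord hf i (MvPolynomial.X l)
  rw [map_zero]
  change germVal (i ≫ PP.toSpec k n) g U z y hy.1 hy.2 _ = 0
  rw [map_sub, sub_eq_zero, germVal_cechDifferential, map_neg, map_sum, map_sum, sub_neg_eq_add]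
  simp only [germVal_tangentMul]
  set τ := stalkCoord (X_mem k 1) y hy2 (MvPolynomial.X 0) with hτ
  have hcoord : (PP k 1).presheaf.germ (chart 1) y hy2 (coordUV ^ 2) = τ ^ 2 := by
    rw [map_pow, coordUV, dehomogenize_eq_coordHom]
    rfl
  rw [hcoord]
  set w := stalkCoord (X_mem k 0) y hy1 (MvPolynomial.aeval h f) with hw
  let P : ι → Bin k := fun m => s m l * MvPolynomial.aeval h f -
    h l * ∑ a, s m a * MvPolynomial.aeval h (MvPolynomial.pderiv a f)
  have h3 : MvPolynomial.aeval h f ∈ grading k 1 3 := by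
    rw [hfh]
    exact (MvPolynomial.isHomogeneous_X_pow (R := k) 0 2).mul (MvPolynomial.isHomogeneous_X k 1)
  have hP : ∀ m, P m ∈ grading k 1 5 := fun m => by
    have h2 : ∑ a, s m a * MvPolynomial.aeval h (MvPolynomial.pderiv a f) ∈ grading k 1 2 := by
      refine Submodule.sum_mem _ fun a' _ => ?_
      rw [hpd, MvPolynomial.aeval_C, mul_comm, MvPolynomial.algebraMap_eq,
        ← MvPolynomial.smul_eq_C_mul]
      exact Submodule.smul_mem _ _ (hs2 m a')
    exact Submodule.sub_mem _ (SetLike.mul_mem_graded (hs2 m l) h3)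
      (SetLike.mul_mem_graded (hv.isHomogeneous l) h2)
  have hS₀ : ∀ m, germVal (i ≫ PP.toSpec k n) g U z y hy1 hy.2 (σ₀ m) * w ^ 2 =
      stalkCoord (X_mem k 0) y hy1 (P m) := fun m => hσ₀ m f hf l y hy1 hy.2 (hu0 y hy.1)
  have hS₁ : ∀ m, germVal (i ≫ PP.toSpec k n) g U z y hy2 hy.2 (σ₁ m) *
      stalkCoord (X_mem k 1) y hy2 (MvPolynomial.aeval h f) ^ 2 =
      stalkCoord (X_mem k 1) y hy2 (P m) := fun m => hσ₁ m f hf l y hy2 hy.2 (hu1 y hy.1)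
  have hτu : IsUnit τ := IsUnit.of_mul_eq_one_right _ (hinv y hy.1)
  have hwu : IsUnit w := hu0 y hy.1
  -- The expression P m / f(h)² has degree 5 - 2 · 3 = -1; normalizing by u = 1 or by v = 1
  -- therefore changes it by the factor τ = u / v.
  have hS : ∀ m, τ * germVal (i ≫ PP.toSpec k n) g U z y hy2 hy.2 (σ₁ m) =
      germVal (i ≫ PP.toSpec k n) g U z y hy1 hy.2 (σ₀ m) := fun m => by
    have e1 := hS₁ m
    rw [stalkCoord_eq (X_mem k 1) (X_mem k 0) y hy2 hy1 (hP m),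
      stalkCoord_eq (X_mem k 1) (X_mem k 0) y hy2 hy1 h3, ← hS₀ m, ← hτ, ← hw] at e1
    refine ((hτu.pow 5).mul (hwu.pow 2)).mul_right_cancel ?_
    linear_combination e1
  have hA : ∀ m, w * (PP k 1).presheaf.germ V y hy (c m) =
      (PP k 1).presheaf.germ (chart 0) y hy1 (p m) +
        τ * (PP k 1).presheaf.germ (chart 1) y hy2 (q m) := fun m => by
    rw [← hpq m y hy.1]
    rw [TopCat.Presheaf.germ_res_apply, map_mul, hχ]
  have hbl : χ (MvPolynomial.aeval h f) * b l = ∑ m, c m * χ (P m) := by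
    rw [mul_eq_sum_of_sum_eq_zero c e (fun m j => χ (s m j)) (fun j => χ (h j))
      (fun j => χ (MvPolynomial.C (a j))) b hce hDf _ (by
        rw [hfh, ← ha, map_sum]
        exact Finset.sum_congr rfl fun j _ => map_mul _ _ _)]
    refine Finset.sum_congr rfl fun m _ => congrArg (c m * ·) ?_
    rw [map_sub, map_mul, map_mul, map_sum]
    have hsum : ∑ j, χ (s m j) * χ (MvPolynomial.C (a j)) =
        ∑ j, χ (s m j * MvPolynomial.aeval h (MvPolynomial.pderiv j f)) :=
      Finset.sum_congr rfl fun j _ => by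
        rw [map_mul, hpd, MvPolynomial.aeval_C, MvPolynomial.algebraMap_eq]
    rw [hsum]
  have hbg : (PP k 1).presheaf.germ V y hy (χ (MvPolynomial.aeval h f)) *
      (PP k 1).presheaf.germ V y hy (b l) = ∑ m, (PP k 1).presheaf.germ V y hy (c m * χ (P m)) := by
    exact (map_mul ((PP k 1).presheaf.germ V y hy).hom _ _).symm.trans
      ((congrArg ((PP k 1).presheaf.germ V y hy) hbl).trans
        (map_sum ((PP k 1).presheaf.germ V y hy).hom _ _))
  rw [hχ] at hbg
  have hD : germVal (i ≫ PP.toSpec k n) g U z y hy.1 hy.2 D =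
      (PP k 1).presheaf.germ V y hy (b l) := rfl
  rw [hD]
  refine hwu.mul_left_cancel (Eq.trans ?_ hbg.symm)
  rw [Finset.mul_sum, ← Finset.sum_add_distrib, Finset.mul_sum]
  refine Finset.sum_congr rfl fun m _ => ?_
  rw [map_mul, hχ, ← hS₀ m, ← hS m]
  linear_combination (-(w * τ * germVal (i ≫ PP.toSpec k n) g U z y hy2 hy.2 (σ₁ m))) * hA m

theorem IsVeryFreeTuple.exists_isVeryFree [IsClosedImmersion i] (hF : F.IsHomogeneous 3)
    (hker : ∀ j, RingHom.ker (i.app (chart j)).hom = Ideal.span {dehomogenize F hF j})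
    (hv : IsVeryFreeTuple F h) :
    ∃ g : PP k 1 ⟶ X, IsVeryFree (i ≫ PP.toSpec k n) g ∧
      ∀ L : Submodule k (Fin (n + 1) → k), (∀ c : Fin (n + 1) → k, (∀ v ∈ L, ∑ j, c j * v j = 0) →
        ∑ j, MvPolynomial.C (c j) * h j = 0) → Set.range (g ≫ i) ⊆ linearSubspace L := by
  obtain ⟨g, hg1, hg2⟩ := exists_morphism_of_forms h hv.isHomogeneous hF hker three_pos
    (exists_notMem_of_pow_mem_span h hv.pow_mem_span) hv.aeval_eq_zero
  have hg : IsGivenBy i g h := hg2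
  refine ⟨g, ⟨hg1, hv.subsingleton_H1 hF hker hg⟩, fun L hL => ?_⟩
  rintro _ ⟨y, rfl⟩ c hc
  obtain ⟨b, hy⟩ := exists_mem_chart y
  obtain ⟨N, hN⟩ := hv.pow_mem_span b
  obtain ⟨j, hj⟩ := exists_isUnit_of_pow_mem_span (stalkCoord (X_mem k b) y hy) h
    (stalkCoord_self _ _ _) hN
  have hj' : IsUnit (((stalkCoord (X_mem k b) y hy).comp (formHom h)) (MvPolynomial.X j)) := by
    simpa using hj
  have hst := hg.fromSpecStalk_comp hv.pow_mem_span y hy (X_mem k j) hj'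
  let p : Spec ((PP k 1).presheaf.stalk y) := IsLocalRing.closedPoint ((PP k 1).presheaf.stalk y)
  let f : MvPolynomial (Fin (n + 1)) k := ∑ j, MvPolynomial.C (c j) * MvPolynomial.X j
  have hf : f ∈ grading k n 1 := Submodule.sum_mem _ fun j _ => by
    rw [← MvPolynomial.smul_eq_C_mul]
    exact Submodule.smul_mem _ _ (X_mem k j)
  have h1 := mem_preimage_pt_basicOpen (T := (PP k 1).presheaf.stalk y) (X_mem k j)
    ((stalkCoord (X_mem k b) y hy).comp (formHom h)) hj' one_pos hf p
  rw [← hst] at h1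
  have h2 : ((PP k 1).fromSpecStalk y ≫ g ≫ i) p = (g ≫ i) y := by
    rw [Scheme.Hom.comp_apply, Scheme.fromSpecStalk_closedPoint]
  rw [h2] at h1
  have h3 : formHom h f = 0 := by
    rw [← hL c hc]
    simp [f, formHom, MvPolynomial.algebraMap_eq]
  rw [RingHom.comp_apply, h3, map_zero] at h1
  by_contra hcon
  exact h1.1 hcon (Ideal.zero_mem _)

end Cohomology

end CubicSRC

end

/-! ### Smoothness in terms of partial derivatives. -/

noncomputable section

namespace CubicSRC

attribute [local instance] MvPolynomial.gradedAlgebra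

open HomogeneousLocalization

/-! ### The Jacobian criterion -/

section Jacobian

/-- The identity of A lifts along the square zero extension B / I² ⟶ A with I = ker π. The lift of π
b differs from b by an element of I. -/
lemma exists_section_of_formallySmooth {R B A : Type u} [CommRing R] [CommRing B] [CommRing A]
    (β : R →+* B) (π : B →+* A) (hπ : Function.Surjective π) (hs : (π.comp β).FormallySmooth) :
    ∃ σ : A →+* B ⧸ RingHom.ker π ^ 2, (∀ b, ∃ x ∈ RingHom.ker π,
      σ (π b) = Ideal.Quotient.mk _ (b + x)) ∧
      ∀ r, σ (π (β r)) = Ideal.Quotient.mk _ (β r) := by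
  algebraize [β, π.comp β]
  let g : B ⧸ RingHom.ker π ^ 2 →ₐ[R] A := Ideal.Quotient.liftₐ (RingHom.ker π ^ 2)
    { π with commutes' := fun r => rfl } (fun a ha => Ideal.pow_le_self two_ne_zero ha)
  have hg : ∀ b, g (Ideal.Quotient.mk _ b) = π b := fun b => rfl
  have hgs : Function.Surjective g := fun a => by
    obtain ⟨b, rfl⟩ := hπ a
    exact ⟨_, hg b⟩
  have hker : RingHom.ker (g : B ⧸ RingHom.ker π ^ 2 →+* A) =
      (RingHom.ker π).map (Ideal.Quotient.mk (RingHom.ker π ^ 2)) := by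
    ext z
    obtain ⟨b, rfl⟩ := Ideal.Quotient.mk_surjective z
    rw [Ideal.mem_map_iff_of_surjective _ Ideal.Quotient.mk_surjective]
    constructor
    · intro h
      exact ⟨b, h, rfl⟩
    · rintro ⟨x, hx, hxb⟩
      rw [← hxb]
      exact hx
  have hnil : IsNilpotent (RingHom.ker (g : B ⧸ RingHom.ker π ^ 2 →+* A)) :=
    ⟨2, by rw [hker, ← Ideal.map_pow, Ideal.map_quotient_self]; rfl⟩
  let σ := Algebra.FormallySmooth.liftOfSurjective (AlgHom.id R A) g hgs hnil
  have hσ : ∀ a, g (σ a) = a := fun a =>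
    Algebra.FormallySmooth.liftOfSurjective_apply (AlgHom.id R A) g hgs hnil a
  refine ⟨σ.toRingHom, fun b => ?_, fun r => σ.commutes r⟩
  obtain ⟨c, hc⟩ := Ideal.Quotient.mk_surjective (σ (π b))
  refine ⟨c - b, ?_, ?_⟩
  · rw [RingHom.mem_ker, map_sub, sub_eq_zero, ← hg, hc, hσ]
  · rw [add_sub_cancel]
    exact hc.symm

lemma map_eq_taylor {k : Type*} [Field k] {m : ℕ} {C : Type*} [CommRing C]
    (θ ρ : MvPolynomial (Fin m) k →+* C) (t : C) (ht : t * t = 0) (a : Fin m → C)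
    (hC : ∀ c, ρ (MvPolynomial.C c) = θ (MvPolynomial.C c))
    (hX : ∀ l, ρ (MvPolynomial.X l) = θ (MvPolynomial.X l) + t * a l)
    (G : MvPolynomial (Fin m) k) :
    ρ G = θ G + t * ∑ l, a l * θ (MvPolynomial.pderiv l G) := by
  induction G using MvPolynomial.induction_on with
  | C c => simp [hC]
  | add p q hp hq => simp only [map_add, hp, hq, mul_add, Finset.sum_add_distrib]; ring
  | mul_X p i hp =>
    have h1 : ∑ l, a l * θ (MvPolynomial.pderiv l (p * MvPolynomial.X i)) =
        a i * θ p + θ (MvPolynomial.X i) * ∑ l, a l * θ (MvPolynomial.pderiv l p) := by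
      simp only [Derivation.leibniz, smul_eq_mul, map_add, map_mul, MvPolynomial.pderiv_X,
        mul_add, Finset.sum_add_distrib]
      congr 1
      · rw [Finset.sum_eq_single i]
        · simp
        · intro b _ hb
          simp [hb.symm]
        · simp
      · rw [Finset.mul_sum]
        exact Finset.sum_congr rfl fun j _ => by ring
    rw [map_mul, map_mul, hp, hX, h1]
    linear_combination (a i * ∑ l, a l * θ (MvPolynomial.pderiv l p)) * ht

variable {k : Type u} [Field k] {n : ℕ} {X : Scheme.{u}} {i : X ⟶ PP k n} {d : ℕ}
  {F : MvPolynomial (Fin (n + 1)) k}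

/-- Smoothness splits B / f² ⟶ B / f, where f is the dehomogenized equation. The splitting moves the
coordinates by multiples of f, so a first order expansion of F gives 1 + ∑ a_l ∂_lF ∈ (f). At a zero
of F where all partial derivatives vanish this would read 1 = 0. -/
theorem exists_pderiv_ne_zero [IsClosedImmersion i] (hF : F.IsHomogeneous d) (hF0 : F ≠ 0)
    (hker : ∀ j, RingHom.ker (i.app (chart j)).hom = Ideal.span {dehomogenize F hF j})
    (hsm : Smooth (i ≫ PP.toSpec k n)) (p : Fin (n + 1) → k) (hp : p ≠ 0)
    (hFp : MvPolynomial.eval p F = 0) : ∃ l, MvPolynomial.eval p (MvPolynomial.pderiv l F) ≠ 0 := by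
  by_contra! hcon
  obtain ⟨j, hj⟩ := Function.ne_iff.1 hp
  have hU := Proj.isAffineOpen_basicOpen (grading k n) (MvPolynomial.X j) (X_mem k j) one_pos
  have hV : IsAffineOpen (i ⁻¹ᵁ chart j) := hU.preimage i
  have hsurj : Function.Surjective (i.app (chart j)).hom := i.app_surjective (chart j) hU
  have h1 := (Scheme.Hom.smooth_appLE (i ≫ PP.toSpec k n) (isAffineOpen_top (Spec (.of k))) hV
    le_top).formallySmooth
  rw [← Scheme.Hom.appLE_comp_appLE i (PP.toSpec k n) ⊤ (chart j) _ le_top le_rfl,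
    ← Scheme.Hom.app_eq_appLE, CommRingCat.hom_comp] at h1
  obtain ⟨σ, hσ1, hσ2⟩ := exists_section_of_formallySmooth _ _ hsurj h1
  let B := Γ(PP k n, chart j)
  let f : B := coordHom (X_mem k j) F
  have hkf : RingHom.ker (i.app (chart j)).hom = Ideal.span {f} := by
    rw [hker, dehomogenize_eq_coordHom]
  have hf0 : f ≠ 0 := fun h =>
    hF0 (eq_zero_of_coordHom_eq_zero (X_mem k j) (MvPolynomial.X_ne_zero j) hF h)
  have : IsDomain B := by
    have : Nonempty (chart j : (PP k n).Opens) := ⟨⟨_, genericPoint_mem_chart j⟩⟩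
    infer_instance
  let q := Ideal.Quotient.mk (RingHom.ker (i.app (chart j)).hom ^ 2)
  have hx : ∀ l, ∃ a : B, σ ((i.app (chart j)).hom (coordHom (X_mem k j) (MvPolynomial.X l))) =
      q (coordHom (X_mem k j) (MvPolynomial.X l)) + q f * q a := fun l => by
    obtain ⟨x, hx, hx2⟩ := hσ1 (coordHom (X_mem k j) (MvPolynomial.X l))
    rw [hkf] at hx
    obtain ⟨a, rfl⟩ := Ideal.mem_span_singleton'.1 hx
    refine ⟨a, hx2.trans ?_⟩
    rw [← map_mul, ← map_add, mul_comm a]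
  choose a ha using hx
  have hff : q f * q f = 0 := by
    rw [← map_mul, Ideal.Quotient.eq_zero_iff_mem, hkf, pow_two]
    exact Ideal.mul_mem_mul (Ideal.mem_span_singleton_self f) (Ideal.mem_span_singleton_self f)
  have htay := map_eq_taylor (q.comp (coordHom (X_mem k j)))
    ((σ.comp (i.app (chart j)).hom).comp (coordHom (X_mem k j))) (q f) hff (fun l => q (a l))
    (fun c => by
      simp only [RingHom.comp_apply]
      rw [coordHom_C]
      exact hσ2 _) ha F
  have hzero : (i.app (chart j)).hom f = 0 := by
    have : f ∈ RingHom.ker (i.app (chart j)).hom := by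
      rw [hkf]; exact Ideal.mem_span_singleton_self f
    exact this
  simp only [RingHom.comp_apply] at htay
  change σ ((i.app (chart j)).hom f) = q f + _ at htay
  rw [hzero, map_zero] at htay
  -- The splitting sends the class of f, which is zero, to zero, while the expansion evaluates it as
  -- f (1 + ∑ a_l ∂_lF) modulo f².
  have h2 : f * (1 + ∑ l, a l * coordHom (X_mem k j) (MvPolynomial.pderiv l F)) ∈
      Ideal.span {f ^ 2} := by
    rw [← Ideal.span_singleton_pow, ← hkf, ← Ideal.Quotient.eq_zero_iff_mem, htay]
    simp only [mul_add, mul_one, map_add, map_mul, map_sum]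
    rfl
  obtain ⟨b, hb⟩ := Ideal.mem_span_singleton'.1 h2
  have h3 : 1 + ∑ l, a l * coordHom (X_mem k j) (MvPolynomial.pderiv l F) = b * f := by
    refine mul_left_cancel₀ hf0 ?_
    rw [← hb]; ring
  have hu : IsUnit (MvPolynomial.eval p (MvPolynomial.X j)) := by
    rw [MvPolynomial.eval_X]; exact isUnit_iff_ne_zero.2 hj
  let ev : B →+* k := (evalSection (grading k n) (MvPolynomial.eval p) hu (X_mem k j) one_pos).hom
  have hev : ∀ (e : ℕ) (G : MvPolynomial (Fin (n + 1)) k), G ∈ grading k n e →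
      MvPolynomial.eval p G = 0 → ev (coordHom (X_mem k j) G) = 0 := fun e G hG h0 => by
    have h5 := evalSection_dehomogenize (MvPolynomial.eval p) hu G hG
    rw [h0] at h5
    exact (congrArg ev (dehomogenize_eq_coordHom G hG j)).symm.trans
      (((hu.pow e).mul_left_eq_zero).1 h5)
  have h6 := congrArg ev h3
  rw [map_add, map_one, map_mul, map_sum, hev d F hF hFp, mul_zero] at h6
  rw [Finset.sum_eq_zero, add_zero] at h6
  · exact one_ne_zero h6
  · intro l _
    rw [map_mul, hev _ _ (hF.pderiv : MvPolynomial.pderiv l F ∈ grading k n (d - 1)) (hcon l),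
      mul_zero]

end Jacobian

end CubicSRC

end

/-! ### Algebra of cubic forms and their polarizations. -/

noncomputable section

namespace CubicSRC

/-! ### Cubic forms and their polarizations -/

section Cubic

variable {k V : Type*} [Field k] [AddCommGroup V] [Module k V]

/-- Trilinear forms on `V`; the cubic form attached to `τ` is `x ↦ τ x x x`. -/
abbrev Trilin (k V : Type*) [Field k] [AddCommGroup V] [Module k V] : Type _ :=
  V →ₗ[k] V →ₗ[k] V →ₗ[k] k

/-- The cubic form of a trilinear form. -/
def cub (τ : Trilin k V) (x : V) : k := τ x x x

/-- The derivative of the cubic form of `τ` at `x` in the direction `y`. -/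
def dcub (τ : Trilin k V) (x y : V) : k := τ y x x + τ x y x + τ x x y

/-- The full polarization of the cubic form of `τ`. -/
def tri (τ : Trilin k V) (x y z : V) : k :=
  τ x y z + τ x z y + τ y x z + τ y z x + τ z x y + τ z y x

variable (τ : Trilin k V) (x x' y y' z : V) (t : k)

theorem cub_add : cub τ (x + y) = cub τ x + dcub τ x y + dcub τ y x + cub τ y := by
  simp only [cub, dcub, map_add, LinearMap.add_apply]; ring

theorem cub_smul : cub τ (t • x) = t ^ 3 * cub τ x := by
  simp only [cub, map_smul, LinearMap.smul_apply, smul_eq_mul]; ring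

theorem cub_zero : cub τ 0 = 0 := by simp [cub]

theorem dcub_add_right : dcub τ x (y + y') = dcub τ x y + dcub τ x y' := by
  simp only [dcub, map_add, LinearMap.add_apply]; ring

theorem dcub_smul_right : dcub τ x (t • y) = t * dcub τ x y := by
  simp only [dcub, map_smul, LinearMap.smul_apply, smul_eq_mul]; ring

theorem dcub_sub_right : dcub τ x (y - y') = dcub τ x y - dcub τ x y' := by
  simp only [dcub, map_sub, LinearMap.sub_apply]; ring

theorem dcub_zero_right : dcub τ x 0 = 0 := by simp [dcub]

theorem dcub_zero_left : dcub τ 0 x = 0 := by simp [dcub]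

theorem dcub_add_left :
    dcub τ (x + x') y = dcub τ x y + tri τ x x' y + dcub τ x' y := by
  simp only [dcub, tri, map_add, LinearMap.add_apply]; ring

theorem dcub_smul_left : dcub τ (t • x) y = t ^ 2 * dcub τ x y := by
  simp only [dcub, map_smul, LinearMap.smul_apply, smul_eq_mul]; ring

theorem dcub_self : dcub τ x x = 3 * cub τ x := by simp only [dcub, cub]; ring

theorem tri_swap_left : tri τ x y z = tri τ y x z := by simp only [tri]; ring

theorem tri_swap_right : tri τ x y z = tri τ x z y := by simp only [tri]; ring

theorem tri_self_left : tri τ x x y = 2 * dcub τ x y := by simp only [tri, dcub]; ring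

theorem tri_self_right : tri τ x y y = 2 * dcub τ y x := by simp only [tri, dcub]; ring

theorem tri_self_mid : tri τ x y x = 2 * dcub τ x y := by simp only [tri, dcub]; ring

theorem tri_add_left : tri τ (x + x') y z = tri τ x y z + tri τ x' y z := by
  simp only [tri, map_add, LinearMap.add_apply]; ring

theorem tri_add_mid : tri τ x (y + y') z = tri τ x y z + tri τ x y' z := by
  simp only [tri, map_add, LinearMap.add_apply]; ring

theorem tri_add_right : tri τ x z (y + y') = tri τ x z y + tri τ x z y' := by
  simp only [tri, map_add, LinearMap.add_apply]; ring

theorem tri_smul_left : tri τ (t • x) y z = t * tri τ x y z := by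
  simp only [tri, map_smul, LinearMap.smul_apply, smul_eq_mul]; ring

theorem tri_smul_mid : tri τ x (t • y) z = t * tri τ x y z := by
  simp only [tri, map_smul, LinearMap.smul_apply, smul_eq_mul]; ring

theorem tri_smul_right : tri τ x y (t • z) = t * tri τ x y z := by
  simp only [tri, map_smul, LinearMap.smul_apply, smul_eq_mul]; ring

/-- The derivative `dcub τ x` as a linear form. -/
def dcubLin : V →ₗ[k] k where
  toFun := dcub τ x
  map_add' := dcub_add_right τ x
  map_smul' t y := dcub_smul_right τ x y t

@[simp] theorem dcubLin_apply : dcubLin τ x y = dcub τ x y := rfl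

/-- The polarization `tri τ x` as a bilinear form. -/
def triLin : V →ₗ[k] V →ₗ[k] k :=
  LinearMap.mk₂ k (tri τ x) (fun _ _ _ => tri_add_mid τ _ _ _ _)
    (fun _ _ _ => tri_smul_mid τ _ _ _ _) (fun _ _ _ => tri_add_right τ _ _ _ _)
    (fun _ _ _ => tri_smul_right τ _ _ _ _)

@[simp] theorem triLin_apply : triLin τ x y z = tri τ x y z := rfl

/-- Pulling a trilinear form back along a linear map. -/
def Trilin.pull {W : Type*} [AddCommGroup W] [Module k W] (f : W →ₗ[k] V) : Trilin k W :=
  (τ.compl₁₂ f f).compr₂ (LinearMap.lcomp k k f)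

section pull

variable {W : Type*} [AddCommGroup W] [Module k W] (f : W →ₗ[k] V) (a b c : W)

@[simp] theorem Trilin.pull_apply : τ.pull f a b c = τ (f a) (f b) (f c) := rfl

@[simp] theorem cub_pull : cub (τ.pull f) a = cub τ (f a) := rfl

@[simp] theorem dcub_pull : dcub (τ.pull f) a b = dcub τ (f a) (f b) := rfl

end pull

/-- The projective hypersurface defined by the cubic form of `τ` is nonsingular. -/
def IsNonsingular : Prop := ∀ p : V, p ≠ 0 → cub τ p = 0 → ∃ y, dcub τ p y ≠ 0

end Cubic

section Polynomial

variable {k : Type*} [Field k] {m : ℕ}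

open MvPolynomial

/-- The product of three linear forms as a trilinear form. -/
theorem exists_trilin_of_isHomogeneous {F : MvPolynomial (Fin m) k} (hF : F.IsHomogeneous 3) :
    ∃ τ : Trilin k (Fin m → k), (∀ x, eval x F = cub τ x) ∧
      ∀ x y, ∑ a, y a * eval x (pderiv a F) = dcub τ x y := by
  classical
  -- A monomial of degree 3 is a product of three coordinates, read as a trilinear form in a chosen
  -- order. A symmetric choice would require dividing by 2 and 3.
  have key : ∀ s : Finset (Fin m →₀ ℕ), (∀ d ∈ s, d.degree = 3) → ∀ c : (Fin m →₀ ℕ) → k,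
      ∃ τ : Trilin k (Fin m → k), (∀ x, eval x (∑ d ∈ s, monomial d (c d)) = cub τ x) ∧
      ∀ x y, ∑ a, y a * eval x (pderiv a (∑ d ∈ s, monomial d (c d))) = dcub τ x y := by
    intro s hs c
    induction s using Finset.induction_on with
    | empty => exact ⟨0, by simp [cub], by simp [dcub]⟩
    | insert d s hd ih =>
      obtain ⟨τ, h1, h2⟩ := ih fun e he => hs e (Finset.mem_insert_of_mem he)
      have h3 := hs d (Finset.mem_insert_self d s)
      replace h3 : Multiset.card (Finsupp.toMultiset d) = 3 := by
        rw [Finsupp.card_toMultiset, ← h3]; rfl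
      rw [Multiset.card_eq_three] at h3
      obtain ⟨i, j, l, h3⟩ := h3
      have h4 : monomial d (c d) = C (c d) * (X i * X j * X l) := by
        have : d = Finsupp.single i 1 + Finsupp.single j 1 + Finsupp.single l 1 := by
          rw [Finsupp.toMultiset_eq_iff] at h3
          rw [h3, ← Multiset.toFinsupp_singleton, ← Multiset.toFinsupp_singleton,
            ← Multiset.toFinsupp_singleton, ← Multiset.toFinsupp_add, ← Multiset.toFinsupp_add]
          rfl
        rw [this]
        simp [X, C_mul_monomial, monomial_mul]
      let σ : Trilin k (Fin m → k) :=
        (LinearMap.proj i).smulRight ((LinearMap.proj j).smulRight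
          (c d • LinearMap.proj l : (Fin m → k) →ₗ[k] k))
      have hσ : ∀ x y z, σ x y z = c d * (x i * y j * z l) := by
        intro x y z; simp [σ]; ring
      refine ⟨σ + τ, fun x => ?_, fun x y => ?_⟩
      · rw [Finset.sum_insert hd, map_add, h1, h4]
        simp [cub, hσ]
      · rw [Finset.sum_insert hd]
        simp only [map_add, mul_add, Finset.sum_add_distrib, h2, h4]
        have : dcub (σ + τ) x y = dcub σ x y + dcub τ x y := by simp [dcub]; ring
        rw [this]
        congr 1
        have hp : ∀ a i : Fin m, eval x (pderiv a (X i : MvPolynomial (Fin m) k)) =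
            if a = i then 1 else 0 := by
          intro a i
          rw [pderiv_X, Pi.single_apply]
          split_ifs <;> simp_all
        simp only [dcub, hσ, Derivation.leibniz, map_add, map_mul, pderiv_C, eval_C, eval_X, hp,
          smul_eq_mul, mul_add, Finset.sum_add_distrib, mul_ite, mul_zero, mul_one, add_zero,
          Finset.sum_ite_eq', Finset.mem_univ, if_true]
        ring
  have := key F.support (fun d hd => by
    have := hF (mem_support_iff.mp hd)
    rwa [Finsupp.degree_eq_weight_one]) (fun d => coeff d F)
  rwa [support_sum_monomial_coeff] at this

/-- A function on `k ^ m` that is given by a polynomial. -/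
def IsPolyFun (f : (Fin m → k) → k) : Prop := ∃ P : MvPolynomial (Fin m) k, ∀ x, eval x P = f x

namespace IsPolyFun

variable {f g : (Fin m → k) → k}

theorem const (c : k) : IsPolyFun (fun _ : Fin m → k => c) := ⟨C c, by simp⟩

theorem add (hf : IsPolyFun f) (hg : IsPolyFun g) : IsPolyFun (fun x => f x + g x) := by
  obtain ⟨P, hP⟩ := hf
  obtain ⟨Q, hQ⟩ := hg
  exact ⟨P + Q, by simp [hP, hQ]⟩

theorem mul (hf : IsPolyFun f) (hg : IsPolyFun g) : IsPolyFun (fun x => f x * g x) := by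
  obtain ⟨P, hP⟩ := hf
  obtain ⟨Q, hQ⟩ := hg
  exact ⟨P * Q, by simp [hP, hQ]⟩

theorem sum {ι : Type*} (s : Finset ι) {f : ι → (Fin m → k) → k} (hf : ∀ i, IsPolyFun (f i)) :
    IsPolyFun (fun x => ∑ i ∈ s, f i x) := by
  choose P hP using hf
  exact ⟨∑ i ∈ s, P i, by simp [hP]⟩

theorem linear (f : (Fin m → k) →ₗ[k] k) : IsPolyFun f := by
  refine ⟨∑ i, C (f (Pi.single i 1)) * X i, fun x => ?_⟩
  conv_rhs => rw [pi_eq_sum_univ' x, map_sum]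
  simp [mul_comm]

theorem _root_.CubicSRC.map_eq_sum_single {W : Type*} [AddCommMonoid W] [Module k W]
    (f : (Fin m → k) →ₗ[k] W) (x : Fin m → k) : f x = ∑ i, x i • f (Pi.single i 1) := by
  conv_lhs => rw [pi_eq_sum_univ' x]
  simp only [map_sum, map_smul]

theorem trilin (τ : Trilin k (Fin m → k)) (f g h : (Fin m → k) →ₗ[k] (Fin m → k)) (a b c : Fin m → k) :
    IsPolyFun (fun x => τ (a + f x) (b + g x) (c + h x)) := by
  have e : ∀ x y z : Fin m → k, τ x y z = ∑ i, ∑ j, ∑ l,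
      x i * (y j * (z l * τ (Pi.single i 1) (Pi.single j 1) (Pi.single l 1))) := by
    intro x y z
    rw [map_eq_sum_single τ x, LinearMap.sum_apply, LinearMap.sum_apply]
    refine Finset.sum_congr rfl fun i _ => ?_
    rw [LinearMap.smul_apply, LinearMap.smul_apply, map_eq_sum_single (τ _) y, LinearMap.sum_apply,
      Finset.smul_sum]
    refine Finset.sum_congr rfl fun j _ => ?_
    rw [LinearMap.smul_apply, map_eq_sum_single (τ _ _) z, Finset.smul_sum, Finset.smul_sum]
    rfl
  have hc : ∀ (a : Fin m → k) (f : (Fin m → k) →ₗ[k] (Fin m → k)) (i : Fin m),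
      IsPolyFun (fun x => (a + f x) i) := fun a f i =>
    (const (a i)).add (linear ((LinearMap.proj i) ∘ₗ f))
  refine (funext fun x => e _ _ _ : _ = _) ▸ ?_
  exact sum _ fun i => sum _ fun j => sum _ fun l =>
    (hc a f i).mul ((hc b g j).mul ((hc c h l).mul (const _)))

theorem cub (τ : Trilin k (Fin m → k)) : IsPolyFun (CubicSRC.cub τ) := by
  simpa using! trilin τ LinearMap.id LinearMap.id LinearMap.id 0 0 0

theorem dcub (τ : Trilin k (Fin m → k)) (y : Fin m → k) :
    IsPolyFun (fun x => CubicSRC.dcub τ x y) := by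
  simpa [CubicSRC.dcub] using! ((trilin τ 0 LinearMap.id LinearMap.id y 0 0).add
    (trilin τ LinearMap.id 0 LinearMap.id 0 y 0)).add (trilin τ LinearMap.id LinearMap.id 0 0 0 y)

end IsPolyFun

end Polynomial

end CubicSRC

end

/-! ### The two explicit very free cubics. -/

noncomputable section

namespace CubicSRC

/-! ### Very free cubic curves from special linear sections -/

section Tuples

open MvPolynomial

variable {k : Type u} [Field k] {n r t : ℕ}

/-- The curve lies in the span of the vectors e_i, and G_i is the derivative of F along the curve in
direction e_i. Each coordinate direction, multiplied by uv, is corrected by a vector α_j of that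
span so as to become tangent to X. These deformations account for the normal directions to the
linear span, and σ for those inside it, so only a calculation in r variables is left to the explicit
curves. -/
theorem isVeryFreeTuple_of_span {F : MvPolynomial (Fin (n + 1)) k} {h : Fin (n + 1) → Bin k}
    (q : Fin r → Bin k) (e : Fin r → Fin (n + 1) → k) (hh : ∀ j, h j = ∑ i, C (e i j) * q i)
    (hq : ∀ i, q i ∈ grading k 1 3) (hF : aeval h F = 0)
    (hpow : ∀ c : Fin (1 + 1), ∃ N, X c ^ N ∈ Ideal.span (Set.range h))
    (hlin : ∃ a : Fin (n + 1) → k, ∑ j, C (a j) * h j = X 0 ^ 2 * X 1)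
    (G : Fin r → Bin k) (hG : ∀ i, ∑ l, C (e i l) * aeval h (pderiv l F) = G i)
    (α : Fin (n + 1) → Fin r → Bin k) (hα : ∀ j i, α j i ∈ grading k 1 2)
    (hαG : ∀ j, X 0 * X 1 * aeval h (pderiv j F) + ∑ i, α j i * G i = 0)
    (σ : Fin t → Fin r → Bin k) (hσ : ∀ j i, σ j i ∈ grading k 1 2)
    (hσG : ∀ m, ∑ i, σ m i * G i = 0)
    (hspan : ∀ (R : Type u) [CommRing R] (φ : Bin k →+* R), IsUnit (φ (X 0)) → IsUnit (φ (X 1)) →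
      ∀ x : Fin r → R, ∑ i, x i * φ (G i) = 0 →
        ∃ (c : Fin t → R) (b : R), ∀ i, x i = ∑ m, c m * φ (σ m i) + b * φ (q i)) :
    IsVeryFreeTuple F h where
  isHomogeneous j := by
    rw [hh]
    exact Submodule.sum_mem _ fun i _ => by
      rw [← smul_eq_C_mul]; exact Submodule.smul_mem _ _ (hq i)
  aeval_eq_zero := hF
  pow_mem_span := hpow
  exists_linear := hlin
  exists_deformations := by
    classical
    have key : ∀ y : Fin r → Bin k, ∑ l, (∑ i, C (e i l) * y i) * aeval h (pderiv l F) =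
        ∑ i, y i * G i := fun y => by
      simp only [← hG, Finset.mul_sum, Finset.sum_mul]
      rw [Finset.sum_comm]
      exact Finset.sum_congr rfl fun i _ => Finset.sum_congr rfl fun l _ => by ring
    refine ⟨Fin (n + 1) ⊕ Fin t, inferInstance, Sum.elim
      (fun j l => (if j = l then X 0 * X 1 else 0) + ∑ i, C (e i l) * α j i)
      (fun m l => ∑ i, C (e i l) * σ m i), ?_, ?_, ?_⟩
    · have h2 : ∀ (y : Fin r → Bin k), (∀ i, y i ∈ grading k 1 2) → ∀ l,
          ∑ i, C (e i l) * y i ∈ grading k 1 2 := fun y hy l =>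
        Submodule.sum_mem _ fun i _ => by
          rw [← smul_eq_C_mul]; exact Submodule.smul_mem _ _ (hy i)
      rintro (j | m) l
      · refine Submodule.add_mem _ ?_ (h2 _ (hα j) l)
        split_ifs
        · exact (isHomogeneous_X k 0).mul (isHomogeneous_X k 1)
        · exact Submodule.zero_mem _
      · exact h2 _ (hσ m) l
    · rintro (j | m)
      · simp only [Sum.elim_inl, add_mul, Finset.sum_add_distrib, key, ite_mul, zero_mul,
          Finset.sum_ite_eq, Finset.mem_univ, if_true, hαG]
      · simp only [Sum.elim_inr, key, hσG]
    · intro R _ φ hu hv b hb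
      obtain ⟨w, hw⟩ := (hu.mul hv).exists_left_inv
      -- Subtracting b_j / (uv) times the j-th corrected coordinate deformation, for all j, leaves a
      -- vector of the span of the e_i; x is its coordinate vector.
      set x : Fin r → R := fun i => -∑ j, b j * w * φ (α j i) with hx
      have hb' : ∀ l, b l = ∑ j, b j * w * φ ((if j = l then X 0 * X 1 else 0) +
          ∑ i, C (e i l) * α j i) + ∑ i, φ (C (e i l)) * x i := by
        intro l
        simp only [map_add, mul_add, Finset.sum_add_distrib, hx, apply_ite φ, map_zero, mul_ite,
          mul_zero, Finset.sum_ite_eq', Finset.mem_univ, if_true, map_sum, map_mul,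
          Finset.mul_sum, mul_neg, Finset.sum_neg_distrib]
        have h1 : b l * w * (φ (X 0) * φ (X 1)) = b l := by linear_combination b l * hw
        have h2 : ∑ j, ∑ i, b j * w * (φ (C (e i l)) * φ (α j i)) =
            ∑ i, ∑ j, φ (C (e i l)) * (b j * w * φ (α j i)) := by
          rw [Finset.sum_comm]
          exact Finset.sum_congr rfl fun i _ => Finset.sum_congr rfl fun l _ => by ring
        rw [h1, h2]
        ring
      have hx0 : ∑ i, x i * φ (G i) = 0 := by
        have h1 : ∀ j, ∑ i, φ (α j i) * φ (G i) =
            - (φ (X 0) * φ (X 1) * φ (aeval h (pderiv j F))) := fun j => by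
          have := congrArg φ (hαG j)
          simp only [map_add, map_mul, map_sum, map_zero] at this
          linear_combination this
        have h2 : ∑ i, x i * φ (G i) = - ∑ j, b j * w * ∑ i, φ (α j i) * φ (G i) := by
          simp only [hx, neg_mul, Finset.sum_neg_distrib, Finset.sum_mul, Finset.mul_sum]
          rw [Finset.sum_comm]
          exact congrArg _ (Finset.sum_congr rfl fun i _ =>
            Finset.sum_congr rfl fun l _ => by ring)
        rw [h2, ← hb, ← Finset.sum_neg_distrib]
        refine Finset.sum_congr rfl fun j _ => ?_
        rw [h1]
        linear_combination b j * φ (aeval h (pderiv j F)) * hw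
      obtain ⟨c, d, hcd⟩ := hspan R φ hu hv x hx0
      refine ⟨Sum.elim (fun j => b j * w) c, d, fun l => ?_⟩
      rw [hb' l, Fintype.sum_sum_type, hh]
      simp only [Sum.elim_inl, Sum.elim_inr, add_assoc]
      congr 1
      simp only [hcd, mul_add, Finset.sum_add_distrib, map_sum, map_mul, Finset.mul_sum]
      rw [Finset.sum_comm]
      refine congrArg₂ _ (Finset.sum_congr rfl fun i _ => Finset.sum_congr rfl fun l _ => by ring)
        (Finset.sum_congr rfl fun i _ => by ring)

variable {F : MvPolynomial (Fin (n + 1)) k} {τ : Trilin k (Fin (n + 1) → k)}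

theorem eval_sum_C_mul (q : Fin r → Bin k) (e : Fin r → Fin (n + 1) → k) (p : Fin (1 + 1) → k) :
    (fun j => eval p (∑ i, C (e i j) * q i)) = ∑ i, eval p (q i) • e i := by
  ext j
  simp [mul_comm]

theorem eval_aeval_sum (hτ : ∀ x, eval x F = cub τ x) (q : Fin r → Bin k)
    (e : Fin r → Fin (n + 1) → k) (p : Fin (1 + 1) → k) :
    eval p (aeval (fun j => ∑ i, C (e i j) * q i) F) = cub τ (∑ i, eval p (q i) • e i) := by
  rw [← hτ, ← eval_sum_C_mul, aeval_def, eval_eval₂]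
  have : (eval p).comp (algebraMap k (Bin k)) = RingHom.id k := by
    ext x; simp [algebraMap_eq]
  rw [this]
  rfl

theorem eval_sum_aeval_pderiv (hτ : ∀ x y, ∑ a, y a * eval x (pderiv a F) = dcub τ x y)
    (q : Fin r → Bin k) (e : Fin r → Fin (n + 1) → k) (y : Fin (n + 1) → k) (p : Fin (1 + 1) → k) :
    eval p (∑ l, C (y l) * aeval (fun j => ∑ i, C (e i j) * q i) (pderiv l F)) =
      dcub τ (∑ i, eval p (q i) • e i) y := by
  rw [← hτ, ← eval_sum_C_mul, map_sum]
  refine Finset.sum_congr rfl fun l _ => ?_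
  rw [map_mul, eval_C, aeval_def, eval_eval₂]
  have : (eval p).comp (algebraMap k (Bin k)) = RingHom.id k := by
    ext x; simp [algebraMap_eq]
  rw [this]
  rfl

theorem sum_linear_mul (q : Fin r → Bin k) (e : Fin r → Fin (n + 1) → k)
    (f : (Fin (n + 1) → k) →ₗ[k] k) :
    ∑ j, C (f (Pi.single j 1)) * ∑ i, C (e i j) * q i = ∑ i, C (f (e i)) * q i := by
  simp only [map_eq_sum_single f (e _), map_sum, Finset.sum_mul, Finset.mul_sum, smul_eq_mul,
    map_mul]
  rw [Finset.sum_comm]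
  exact Finset.sum_congr rfl fun i _ => Finset.sum_congr rfl fun l _ => by ring

end Tuples

end CubicSRC

end

noncomputable section

namespace CubicSRC

section Expansion

variable {k V : Type*} [Field k] [AddCommGroup V] [Module k V] (τ : Trilin k V)

theorem dcub_comb_two (a b w : V) (x y : k) :
    dcub τ (x • a + y • b) w = x ^ 2 * dcub τ a w + x * y * tri τ a b w + y ^ 2 * dcub τ b w := by
  simp only [dcub_add_left, dcub_smul_left, tri_smul_left, tri_smul_mid]; ring

theorem cub_comb_three (a b c : V) (x y z : k) :
    cub τ (x • a + y • b + z • c) = x ^ 3 * cub τ a + y ^ 3 * cub τ b + z ^ 3 * cub τ c +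
      x ^ 2 * y * dcub τ a b + x ^ 2 * z * dcub τ a c + y ^ 2 * x * dcub τ b a +
      y ^ 2 * z * dcub τ b c + z ^ 2 * x * dcub τ c a + z ^ 2 * y * dcub τ c b +
      x * y * z * tri τ a b c := by
  simp only [cub_add, cub_smul, dcub_smul_left, dcub_smul_right, dcub_add_left, dcub_add_right,
    tri_smul_left, tri_smul_mid]; ring

theorem dcub_comb_three (a b c w : V) (x y z : k) :
    dcub τ (x • a + y • b + z • c) w = x ^ 2 * dcub τ a w + y ^ 2 * dcub τ b w +
      z ^ 2 * dcub τ c w + x * y * tri τ a b w + x * z * tri τ a c w + y * z * tri τ b c w := by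
  simp only [dcub_add_left, dcub_smul_left, tri_smul_left, tri_smul_mid, tri_add_left]; ring

theorem cub_comb_four (a b c d : V) (x y z t : k) :
    cub τ (x • a + y • b + z • c + t • d) =
      x ^ 3 * cub τ a + y ^ 3 * cub τ b + z ^ 3 * cub τ c + t ^ 3 * cub τ d +
      x ^ 2 * y * dcub τ a b + x ^ 2 * z * dcub τ a c + x ^ 2 * t * dcub τ a d +
      y ^ 2 * x * dcub τ b a + y ^ 2 * z * dcub τ b c + y ^ 2 * t * dcub τ b d +
      z ^ 2 * x * dcub τ c a + z ^ 2 * y * dcub τ c b + z ^ 2 * t * dcub τ c d +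
      t ^ 2 * x * dcub τ d a + t ^ 2 * y * dcub τ d b + t ^ 2 * z * dcub τ d c +
      x * y * z * tri τ a b c + x * y * t * tri τ a b d + x * z * t * tri τ a c d +
      y * z * t * tri τ b c d := by
  rw [cub_add, cub_comb_three, cub_smul, dcub_smul_right, dcub_comb_three, dcub_smul_left]
  simp only [dcub_add_right, dcub_smul_right]; ring

theorem dcub_comb_four (a b c d w : V) (x y z t : k) :
    dcub τ (x • a + y • b + z • c + t • d) w = x ^ 2 * dcub τ a w + y ^ 2 * dcub τ b w +
      z ^ 2 * dcub τ c w + t ^ 2 * dcub τ d w + x * y * tri τ a b w + x * z * tri τ a c w +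
      x * t * tri τ a d w + y * z * tri τ b c w + y * t * tri τ b d w + z * t * tri τ c d w := by
  rw [dcub_add_left, dcub_comb_three, dcub_smul_left]
  simp only [tri_add_left, tri_smul_left, tri_smul_mid]; ring

/-- On the span of `a, b, c` the cubic form is `x y z - y ^ 3 - z ^ 3`. -/
structure IsNodalTriple (a b c : V) : Prop where
  cub_a : cub τ a = 0
  cub_b : cub τ b = -1
  cub_c : cub τ c = -1
  ab : dcub τ a b = 0
  ac : dcub τ a c = 0
  ba : dcub τ b a = 0
  bc : dcub τ b c = 0
  ca : dcub τ c a = 0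
  cb : dcub τ c b = 0
  abc : tri τ a b c = 1

/-- On the span of `a, b, c, d` the cubic form is `x ^ 2 t + x t ^ 2 + y ^ 3 + z ^ 3`. -/
structure IsHermitianQuadruple (a b c d : V) : Prop where
  cub_a : cub τ a = 0
  cub_b : cub τ b = 1
  cub_c : cub τ c = 1
  cub_d : cub τ d = 0
  ab : dcub τ a b = 0
  ac : dcub τ a c = 0
  ad : dcub τ a d = 1
  ba : dcub τ b a = 0
  bc : dcub τ b c = 0
  bd : dcub τ b d = 0
  ca : dcub τ c a = 0
  cb : dcub τ c b = 0
  cd : dcub τ c d = 0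
  da : dcub τ d a = 1
  db : dcub τ d b = 0
  dc : dcub τ d c = 0
  abc : tri τ a b c = 0
  abd : tri τ a b d = 0
  acd : tri τ a c d = 0
  bcd : tri τ b c d = 0

end Expansion

section Curves

open MvPolynomial

variable {k : Type u} [Field k] {n r : ℕ} {F : MvPolynomial (Fin (n + 1)) k}
  {τ : Trilin k (Fin (n + 1) → k)}

theorem binary_isHomogeneous {i j d : ℕ} (c : k) (h : i + j = d) :
    C c * (X 0 ^ i * X 1 ^ j) ∈ grading k 1 d := by
  rw [← smul_eq_C_mul]
  refine Submodule.smul_mem _ _ ?_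
  rw [← h]
  simpa using! ((isHomogeneous_X k (0 : Fin (1 + 1))).pow i).mul
    ((isHomogeneous_X k (1 : Fin (1 + 1))).pow j)

theorem quadric_mem (x y z : k) :
    C x * X 0 ^ 2 + C y * (X 0 * X 1) + C z * X 1 ^ 2 ∈ grading k 1 2 := by
  refine Submodule.add_mem _ (Submodule.add_mem _ ?_ ?_) ?_
  · simpa using! binary_isHomogeneous (i := 2) (j := 0) x rfl
  · simpa using! binary_isHomogeneous (i := 1) (j := 1) y rfl
  · simpa using! binary_isHomogeneous (i := 0) (j := 2) z rfl

theorem cubic_mem (x y z w : k) :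
    C x * X 0 ^ 3 + C y * (X 0 ^ 2 * X 1) + C z * (X 0 * X 1 ^ 2) + C w * X 1 ^ 3 ∈
      grading k 1 3 := by
  refine Submodule.add_mem _ (Submodule.add_mem _ (Submodule.add_mem _ ?_ ?_) ?_) ?_
  · simpa using! binary_isHomogeneous (i := 3) (j := 0) x rfl
  · simpa using! binary_isHomogeneous (i := 2) (j := 1) y rfl
  · simpa using! binary_isHomogeneous (i := 1) (j := 2) z rfl
  · simpa using! binary_isHomogeneous (i := 0) (j := 3) w rfl

theorem aeval_pderiv_eq (h : Fin (n + 1) → Bin k) (j : Fin (n + 1)) :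
    aeval h (pderiv j F) =
      ∑ l, C ((Pi.single j 1 : Fin (n + 1) → k) l) * aeval h (pderiv l F) := by
  simp [Pi.single_apply, apply_ite]

theorem linear_mem_span (q : Fin r → Bin k) (e : Fin r → Fin (n + 1) → k)
    (f : (Fin (n + 1) → k) →ₗ[k] k) :
    ∑ i, C (f (e i)) * q i ∈
      Ideal.span (Set.range fun j => ∑ i, C (e i j) * q i) := by
  rw [← sum_linear_mul]
  exact Ideal.sum_mem _ fun j _ => Ideal.mul_mem_left _ _ (Ideal.subset_span ⟨j, rfl⟩)

/-- The rational nodal cubic through a nodal triple is very free. -/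
theorem IsNodalTriple.isVeryFreeTuple [Infinite k] (hF : ∀ x, eval x F = cub τ x)
    (hD : ∀ x y, ∑ a, y a * eval x (pderiv a F) = dcub τ x y) {a b c : Fin (n + 1) → k}
    (h : IsNodalTriple τ a b c) :
    IsVeryFreeTuple F fun j => ∑ i, C ((![a, b, c] : Fin 3 → Fin (n + 1) → k) i j) *
      (![X 0 ^ 3 + X 1 ^ 3, X 0 ^ 2 * X 1, X 0 * X 1 ^ 2] : Fin 3 → Bin k) i := by
  obtain ⟨ha, hb, hc, hab, hac, hba, hbc, hca, hcb, habc⟩ := h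
  have hacb : tri τ a c b = 1 := by rw [tri_swap_right, habc]
  have hbca : tri τ b c a = 1 := by rw [tri_swap_right, tri_swap_left, habc]
  have hbac : tri τ b a c = 1 := by rw [tri_swap_left, habc]
  have haa : dcub τ a a = 0 := by rw [dcub_self, ha, mul_zero]
  have hbb : dcub τ b b = -3 := by rw [dcub_self, hb]; ring
  have hcc : dcub τ c c = -3 := by rw [dcub_self, hc]; ring
  set q : Fin 3 → Bin k := ![X 0 ^ 3 + X 1 ^ 3, X 0 ^ 2 * X 1, X 0 * X 1 ^ 2] with hq
  set e : Fin 3 → Fin (n + 1) → k := ![a, b, c] with he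
  -- On the span of a, b, c the form xyz - y³ - z³ has full polarization with value 1 on (a, b, c);
  -- inserting two of these vectors reads off the coordinate along the third.
  have hmem1 : X 0 ^ 3 + X 1 ^ 3 ∈ Ideal.span (Set.range fun j => ∑ i, C (e i j) * q i) := by
    have := linear_mem_span q e ((triLin τ b).flip c)
    simpa [he, hq, Fin.sum_univ_three, tri_self_right, tri_self_left, hbac, hbc, hcb] using this
  have hmem2 : X 0 ^ 2 * X 1 ∈ Ideal.span (Set.range fun j => ∑ i, C (e i j) * q i) := by
    have := linear_mem_span q e ((triLin τ a).flip c)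
    simpa [he, hq, Fin.sum_univ_three, tri_self_right, tri_self_left, hac, hca, habc] using this
  have hmem3 : X 0 * X 1 ^ 2 ∈ Ideal.span (Set.range fun j => ∑ i, C (e i j) * q i) := by
    have := linear_mem_span q e ((triLin τ a).flip b)
    simpa [he, hq, Fin.sum_univ_three, tri_self_right, tri_self_left, hab, hba, hacb] using this
  -- The entries of G are the partial derivatives of xyz - y³ - z³ on the curve. After division by
  -- uv they are u²v², v⁴ - 2u³v and u⁴ - 2uv³, and with quadratic coefficients these generate all
  -- binary sextics in every characteristic; this is why the correction α exists. The deformation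
  -- inside the plane is ∂q / ∂u = (3u², 2uv, v²).
  refine isVeryFreeTuple_of_span (r := 3) (t := 1) q e (fun _ => rfl) ?_ ?_ ?_ ?_
    ![X 0 ^ 3 * X 1 ^ 3, X 0 * X 1 ^ 5 - 2 * X 0 ^ 4 * X 1 ^ 2,
      X 0 ^ 5 * X 1 - 2 * X 0 ^ 2 * X 1 ^ 4] ?_
    (fun j => ![
      C (-(3 * tri τ a c (Pi.single j 1) + dcub τ b (Pi.single j 1))) * X 0 ^ 2 +
      C (-(6 * dcub τ a (Pi.single j 1) + tri τ b c (Pi.single j 1))) * (X 0 * X 1) +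
      C (-(3 * tri τ a b (Pi.single j 1) + dcub τ c (Pi.single j 1))) * X 1 ^ 2,
      C 0 * X 0 ^ 2 + C (- tri τ a c (Pi.single j 1)) * (X 0 * X 1) +
        C (- dcub τ a (Pi.single j 1)) * X 1 ^ 2,
      C (- dcub τ a (Pi.single j 1)) * X 0 ^ 2 + C (- tri τ a b (Pi.single j 1)) * (X 0 * X 1) +
        C 0 * X 1 ^ 2]) ?_ ?_
    (fun _ => ![C 3 * X 0 ^ 2 + C 0 * (X 0 * X 1) + C 0 * X 1 ^ 2,
      C 0 * X 0 ^ 2 + C 2 * (X 0 * X 1) + C 0 * X 1 ^ 2,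
      C 0 * X 0 ^ 2 + C 0 * (X 0 * X 1) + C 1 * X 1 ^ 2]) ?_ ?_ ?_
  · intro i
    fin_cases i
    · simpa [hq] using! cubic_mem (k := k) 1 0 0 1
    · simpa [hq] using! cubic_mem (k := k) 0 1 0 0
    · simpa [hq] using! cubic_mem (k := k) 0 0 1 0
  · refine MvPolynomial.funext fun p => ?_
    rw [eval_aeval_sum hF]
    simp only [he, hq, Fin.sum_univ_three, Matrix.cons_val_zero, Matrix.cons_val_one,
      Matrix.cons_val, cub_comb_three, ha, hb, hc, hab, hac, hba, hbc, hca, hcb, habc, map_add,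
      map_mul, map_pow, eval_X, map_zero]
    ring
  · intro i
    refine ⟨4, ?_⟩
    have h1 : (X 0 : Bin k) ^ 4 = X 0 * (X 0 ^ 3 + X 1 ^ 3) - X 1 * (X 0 * X 1 ^ 2) := by ring
    have h2 : (X 1 : Bin k) ^ 4 = X 1 * (X 0 ^ 3 + X 1 ^ 3) - X 0 * (X 0 ^ 2 * X 1) := by ring
    fin_cases i
    · exact h1 ▸ Ideal.sub_mem _ (Ideal.mul_mem_left _ _ hmem1) (Ideal.mul_mem_left _ _ hmem3)
    · exact h2 ▸ Ideal.sub_mem _ (Ideal.mul_mem_left _ _ hmem1) (Ideal.mul_mem_left _ _ hmem2)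
  · refine ⟨_, (sum_linear_mul q e ((triLin τ a).flip c)).trans ?_⟩
    simp [he, hq, Fin.sum_univ_three, tri_self_right, tri_self_left, hac, hca, habc]
  · intro i
    refine MvPolynomial.funext fun p => ?_
    rw [eval_sum_aeval_pderiv hD]
    fin_cases i <;>
    simp only [he, hq, Fin.sum_univ_three, Matrix.cons_val_zero, Matrix.cons_val_one,
      Matrix.cons_val, dcub_comb_three, hab, hac, hba, hbc, hca, hcb, haa, hbb, hcc,
      habc, map_add, map_mul, map_pow, eval_X, map_sub, Fin.zero_eta, Fin.mk_one, Fin.reduceFinMk,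
      tri_self_mid, tri_self_right, hacb, hbca, map_ofNat]
    · ring
    · ring
    · ring
  · intro j i
    fin_cases i <;> exact quadric_mem _ _ _
  · intro j
    refine MvPolynomial.funext fun p => ?_
    rw [aeval_pderiv_eq, map_add, map_mul, eval_sum_aeval_pderiv hD]
    simp only [he, hq, Fin.sum_univ_three, Matrix.cons_val_zero, Matrix.cons_val_one,
      Matrix.cons_val, dcub_comb_three, map_add, map_mul, map_pow, eval_X, map_sub, map_ofNat,
      map_zero, eval_C]
    ring
  · intro j i
    fin_cases i <;> exact quadric_mem _ _ _
  · intro j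
    simp only [Fin.sum_univ_three, Matrix.cons_val_zero, Matrix.cons_val_one,
      Matrix.cons_val, map_zero, map_ofNat, map_one]
    ring
  · intro R _ φ hu hv x hx
    simp only [Fin.sum_univ_three, Matrix.cons_val_zero, Matrix.cons_val_one,
      Matrix.cons_val, map_ofNat, map_sub, map_mul, map_pow] at hx
    obtain ⟨U, hU⟩ := hu.exists_left_inv
    obtain ⟨V, hV⟩ := hv.exists_left_inv
    have hs : IsUnit (φ (X 0) ^ 3 * φ (X 1) ^ 3) := (hu.pow 3).mul (hv.pow 3)
    -- The kernel of G is spanned by q and ∂q / ∂u. Their coefficients d and b are solved from the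
    -- last two coordinates; the first coordinate then follows from `hx`, in which it has the unit
    -- coefficient u³v³.
    obtain ⟨d, hd⟩ : ∃ d, φ (X 0) ^ 2 * φ (X 1) ^ 2 * d = 2 * φ (X 0) * x 2 - φ (X 1) * x 1 :=
      ⟨U ^ 2 * V ^ 2 * (2 * φ (X 0) * x 2 - φ (X 1) * x 1), by
        linear_combination (2 * φ (X 0) * x 2 - φ (X 1) * x 1) *
          ((U * φ (X 0) + 1) * (V * φ (X 1)) ^ 2 * hU + (V * φ (X 1) + 1) * hV)⟩
    obtain ⟨b, hb⟩ : ∃ b, φ (X 1) ^ 2 * b = x 2 - φ (X 0) * φ (X 1) ^ 2 * d :=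
      ⟨V ^ 2 * (x 2 - φ (X 0) * φ (X 1) ^ 2 * d), by
        linear_combination (x 2 - φ (X 0) * φ (X 1) ^ 2 * d) * (V * φ (X 1) + 1) * hV⟩
    refine ⟨fun _ => b, d, fun i => ?_⟩
    fin_cases i <;>
    simp only [hq, Matrix.cons_val_zero, Matrix.cons_val_one, Matrix.cons_val, map_zero, map_ofNat,
      map_one, map_add, map_mul, map_pow, Fin.zero_eta, Fin.mk_one, Fin.reduceFinMk,
      Finset.univ_unique, Finset.sum_const, Finset.card_singleton, one_smul]
    · refine hs.mul_left_cancel ?_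
      linear_combination hx - 3 * φ (X 0) ^ 5 * φ (X 1) * hb -
        (φ (X 0) ^ 4 * φ (X 1) + φ (X 0) * φ (X 1) ^ 4 - 3 * φ (X 0) ^ 4 * φ (X 1)) * hd
    · refine hv.mul_left_cancel ?_
      linear_combination -2 * φ (X 0) * hb + hd
    · linear_combination -hb

/-- The twisted cubic through a Hermitian quadruple is very free in characteristic two. -/
theorem IsHermitianQuadruple.isVeryFreeTuple [Infinite k] (h2 : (2 : k) = 0)
    (hF : ∀ x, eval x F = cub τ x)
    (hD : ∀ x y, ∑ a, y a * eval x (pderiv a F) = dcub τ x y) {a b c d : Fin (n + 1) → k}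
    (h : IsHermitianQuadruple τ a b c d) :
    IsVeryFreeTuple F fun j => ∑ i, C ((![a, b, c, d] : Fin 4 → Fin (n + 1) → k) i j) *
      (![X 0 ^ 3, X 0 ^ 2 * X 1, X 0 * X 1 ^ 2, X 1 ^ 3] : Fin 4 → Bin k) i := by
  obtain ⟨ha, hb, hc, hd, hab, hac, had, hba, hbc, hbd, hca, hcb, hcd, hda, hdb, hdc, habc, habd,
    hacd, hbcd⟩ := h
  have haa : dcub τ a a = 0 := by rw [dcub_self, ha, mul_zero]
  have hbb : dcub τ b b = 1 := by rw [dcub_self, hb]; linear_combination h2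
  have hcc : dcub τ c c = 1 := by rw [dcub_self, hc]; linear_combination h2
  have hdd : dcub τ d d = 0 := by rw [dcub_self, hd, mul_zero]
  have hm : ∀ x y, tri τ x y x = 0 := fun x y => by rw [tri_self_mid, h2, zero_mul]
  have hr : ∀ x y, tri τ x y y = 0 := fun x y => by rw [tri_self_right, h2, zero_mul]
  have hacb : tri τ a c b = 0 := by rw [tri_swap_right, habc]
  have hadb : tri τ a d b = 0 := by rw [tri_swap_right, habd]
  have hadc : tri τ a d c = 0 := by rw [tri_swap_right, hacd]
  have hbca : tri τ b c a = 0 := by rw [tri_swap_right, tri_swap_left, habc]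
  have hbda : tri τ b d a = 0 := by rw [tri_swap_right, tri_swap_left, habd]
  have hcda : tri τ c d a = 0 := by rw [tri_swap_right, tri_swap_left, hacd]
  have hbdc : tri τ b d c = 0 := by rw [tri_swap_right, hbcd]
  have hcdb : tri τ c d b = 0 := by rw [tri_swap_right, tri_swap_left, hbcd]
  set q : Fin 4 → Bin k := ![X 0 ^ 3, X 0 ^ 2 * X 1, X 0 * X 1 ^ 2, X 1 ^ 3] with hq
  set e : Fin 4 → Fin (n + 1) → k := ![a, b, c, d] with he
  have h2' : (2 : Bin k) = 0 := by
    have := congrArg (C : k →+* Bin k) h2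
    simpa only [map_ofNat, map_zero] using this
  -- In characteristic 2 the gradient of x²t + xt² + y³ + z³ on the curve is (v⁶, u⁴v², u²v⁴, u⁶).
  -- The three rows of σ are relations between entries whose ratio is u² / v²: each gives twice a
  -- monomial. They already span the rank three kernel where uv is invertible, so the Euler
  -- coefficient is taken to be 0 below.
  refine isVeryFreeTuple_of_span (r := 4) (t := 3) q e (fun _ => rfl) ?_ ?_ ?_ ?_
    ![X 1 ^ 6, X 0 ^ 4 * X 1 ^ 2, X 0 ^ 2 * X 1 ^ 4, X 0 ^ 6] ?_
    (fun j => ![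
      C (- tri τ c d (Pi.single j 1)) * X 0 ^ 2 +
        C (- dcub τ d (Pi.single j 1)) * (X 0 * X 1) + C 0 * X 1 ^ 2,
      C (- tri τ a b (Pi.single j 1)) * X 0 ^ 2 +
        C (- dcub τ b (Pi.single j 1) - tri τ a c (Pi.single j 1)) * (X 0 * X 1) +
        C (- tri τ a d (Pi.single j 1) - tri τ b c (Pi.single j 1)) * X 1 ^ 2,
      C 0 * X 0 ^ 2 + C (- dcub τ c (Pi.single j 1) - tri τ b d (Pi.single j 1)) * (X 0 * X 1) +
        C 0 * X 1 ^ 2,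
      C 0 * X 0 ^ 2 + C (- dcub τ a (Pi.single j 1)) * (X 0 * X 1) + C 0 * X 1 ^ 2]) ?_ ?_
    (fun m i => C ((![![0, 1, 0, 0], ![0, 0, 1, 0], ![1, 0, 0, 0]] : Fin 3 → Fin 4 → k) m i) *
        X 0 ^ 2 + C 0 * (X 0 * X 1) +
      C ((![![0, 0, 0, 1], ![0, 1, 0, 0], ![0, 0, 1, 0]] : Fin 3 → Fin 4 → k) m i) * X 1 ^ 2)
    (fun _ _ => quadric_mem _ _ _) ?_ ?_
  · intro i
    fin_cases i
    · simpa [hq] using! cubic_mem (k := k) 1 0 0 0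
    · simpa [hq] using! cubic_mem (k := k) 0 1 0 0
    · simpa [hq] using! cubic_mem (k := k) 0 0 1 0
    · simpa [hq] using! cubic_mem (k := k) 0 0 0 1
  · refine MvPolynomial.funext fun p => ?_
    rw [eval_aeval_sum hF]
    simp only [he, hq, Fin.sum_univ_four, Matrix.cons_val_zero, Matrix.cons_val_one,
      Matrix.cons_val, cub_comb_four, ha, hb, hc, hd, hab, hac, had, hba, hbc, hbd, hca, hcb, hcd,
      hda, hdb, hdc, habc, habd, hacd, hbcd, map_mul, map_pow, eval_X, map_zero]
    linear_combination (p 0 ^ 6 * p 1 ^ 3 + p 0 ^ 3 * p 1 ^ 6) * h2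
  · intro i
    refine ⟨3, ?_⟩
    fin_cases i
    · have := linear_mem_span q e (dcubLin τ d)
      simpa [he, hq, Fin.sum_univ_four, hda, hdb, hdc, hdd] using this
    · have := linear_mem_span q e (dcubLin τ a)
      simpa [he, hq, Fin.sum_univ_four, haa, hab, hac, had] using this
  · refine ⟨_, (sum_linear_mul q e (dcubLin τ b)).trans ?_⟩
    simp [he, hq, Fin.sum_univ_four, hba, hbb, hbc, hbd]
  · intro i
    refine MvPolynomial.funext fun p => ?_
    rw [eval_sum_aeval_pderiv hD]
    fin_cases i <;>
    simp only [he, hq, Fin.sum_univ_four, Matrix.cons_val_zero, Matrix.cons_val_one,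
      Matrix.cons_val, dcub_comb_four, hab, hac, had, hba, hbc, hbd, hca, hcb, hcd,
      hda, hdb, hdc, habc, habd, hacd, hbcd, hacb, hadb, hadc, hbca, hbda, hcda, hbdc, hcdb,
      haa, hbb, hcc, hdd, hm, hr, map_mul, map_pow, eval_X, Fin.zero_eta, Fin.mk_one,
      Fin.reduceFinMk]
    · ring
    · ring
    · ring
    · ring
  · intro j i
    fin_cases i <;> exact quadric_mem _ _ _
  · intro j
    refine MvPolynomial.funext fun p => ?_
    rw [aeval_pderiv_eq, map_add, map_mul, eval_sum_aeval_pderiv hD]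
    simp only [he, hq, Fin.sum_univ_four, Matrix.cons_val_zero, Matrix.cons_val_one,
      Matrix.cons_val, dcub_comb_four, map_add, map_mul, map_pow, eval_X, map_zero, eval_C]
    ring
  · intro j
    fin_cases j <;>
    simp only [Fin.sum_univ_four, Matrix.cons_val_zero, Matrix.cons_val_one,
      Matrix.cons_val, map_zero, map_one, Fin.zero_eta, Fin.mk_one, Fin.reduceFinMk]
    · linear_combination X 0 ^ 6 * X 1 ^ 2 * h2'
    · linear_combination X 0 ^ 4 * X 1 ^ 4 * h2'
    · linear_combination X 0 ^ 2 * X 1 ^ 6 * h2'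
  · intro R _ φ hu hv x hx
    have h2R : (2 : R) = 0 := by
      have := congrArg φ h2'
      simpa only [map_ofNat, map_zero] using this
    simp only [Fin.sum_univ_four, Matrix.cons_val_zero, Matrix.cons_val_one,
      Matrix.cons_val, map_mul, map_pow] at hx
    obtain ⟨y, hy⟩ : ∃ y, φ (X 0) ^ 2 * y = x 0 := (hu.pow 2).dvd.imp fun _ h => h.symm
    obtain ⟨z, hz⟩ : ∃ z, φ (X 1) ^ 2 * z = x 3 := (hv.pow 2).dvd.imp fun _ h => h.symm
    obtain ⟨w, hw⟩ : ∃ w, φ (X 0) ^ 2 * w = x 2 - φ (X 1) ^ 2 * y :=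
      (hu.pow 2).dvd.imp fun _ h => h.symm
    refine ⟨![z, w, y], 0, fun i => ?_⟩
    fin_cases i <;>
    simp only [Fin.sum_univ_three, Matrix.cons_val_zero, Matrix.cons_val_one, Matrix.cons_val,
      map_zero, map_one, map_add, map_mul, map_pow, Fin.zero_eta, Fin.mk_one, Fin.reduceFinMk]
    · linear_combination -hy
    · refine ((hu.pow 4).mul (hv.pow 2)).mul_left_cancel ?_
      linear_combination hx + φ (X 1) ^ 6 * hy + φ (X 0) ^ 6 * hz +
        φ (X 0) ^ 2 * φ (X 1) ^ 4 * hw - (φ (X 0) ^ 6 * φ (X 1) ^ 2 * z +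
          φ (X 0) ^ 4 * φ (X 1) ^ 4 * w + φ (X 0) ^ 2 * φ (X 1) ^ 6 * y) * h2R
    · linear_combination -hw
    · linear_combination -hz

end Curves

end CubicSRC

end

/-! ### Irreducibility of nonsingular cubics and reduction to a cubic surface. -/

noncomputable section

namespace CubicSRC

/-! ### Common zeros of polynomials and irreducibility of nonsingular cubic forms -/

section Zeros

open MvPolynomial

variable {k : Type*} [Field k] {m r : ℕ}

/-- The kernels of the substitutions x_0 = ... = x_(i-1) = 0, for i = 0, ..., m, form a strictly
increasing chain of primes ending at the maximal ideal of the origin. -/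
theorem natCast_le_height_vanishingIdeal_zero :
    (m : ℕ∞) ≤ (vanishingIdeal k {(0 : Fin m → k)}).height := by
  let ψ : ℕ → MvPolynomial (Fin m) k →ₐ[k] MvPolynomial (Fin m) k := fun i =>
    aeval fun j => if (j : ℕ) < i then 0 else X j
  have hψ : ∀ i j, ψ i (X j) = if (j : ℕ) < i then 0 else X j := fun i j => aeval_X _ _
  have key : ∀ i, i ≤ m → (i : ℕ∞) ≤ (RingHom.ker (ψ i)).height := by
    intro i
    induction i with
    | zero => simp
    | succ i ih =>
      intro hi
      have hp : ∀ i, (RingHom.ker (ψ i)).IsPrime := fun i => RingHom.ker_isPrime _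
      have hlt : RingHom.ker (ψ i) < RingHom.ker (ψ (i + 1)) := by
        refine lt_of_le_of_ne (fun f hf => ?_) fun h => ?_
        · have hc : ψ (i + 1) = (ψ (i + 1)).comp (ψ i) := by
            refine MvPolynomial.algHom_ext fun j => ?_
            rw [AlgHom.comp_apply, hψ i j, hψ (i + 1) j]
            split_ifs with h1 h2 h2
            · rw [map_zero]
            · rw [hψ, if_pos h1]
            · omega
            · rw [hψ, if_neg h1]
          rw [RingHom.mem_ker] at hf ⊢
          rw [hc, AlgHom.comp_apply, hf, map_zero]
        · have h1 : X ⟨i, hi⟩ ∈ RingHom.ker (ψ i) := by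
            rw [h, RingHom.mem_ker, hψ, if_pos (Nat.lt_succ_self i)]
          rw [RingHom.mem_ker, hψ, if_neg (lt_irrefl i)] at h1
          exact X_ne_zero _ h1
      have := Ideal.height_add_one_le_of_lt_of_isPrime hlt
      push_cast
      exact (add_le_add_left (ih (by omega)) 1).trans this
  have hm : RingHom.ker (ψ m) = vanishingIdeal k {(0 : Fin m → k)} := by
    ext f
    have h1 : ψ m f = C (eval 0 f) := by
      have : ψ m = (Algebra.ofId k (MvPolynomial (Fin m) k)).comp (aeval (0 : Fin m → k)) :=
        MvPolynomial.algHom_ext fun j => by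
          rw [hψ, if_pos j.2, AlgHom.comp_apply, aeval_X, Pi.zero_apply, map_zero]
      rw [this]
      rfl
    rw [RingHom.mem_ker, h1, mem_vanishingIdeal_singleton_iff, aeval_eq_eval, ← C_0,
      C_inj]
  exact (key m le_rfl).trans_eq (congrArg Ideal.height hm)

/-- Fewer than `m` polynomials in `m` variables that vanish at the origin have a common zero
elsewhere. -/
theorem exists_ne_zero_common_zero [IsAlgClosed k] (hr : r < m) {f : Fin r → (Fin m → k) → k}
    (hf : ∀ i, IsPolyFun (f i)) (h0 : ∀ i, f i 0 = 0) : ∃ x, x ≠ 0 ∧ ∀ i, f i x = 0 := by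
  choose P hP using hf
  by_contra! hcon
  set I := Ideal.span (Set.range P) with hI
  have hz : zeroLocus k I = {(0 : Fin m → k)} := by
    ext x
    rw [hI, zeroLocus_span, Set.mem_ofPred_eq, Set.mem_singleton_iff]
    constructor
    · intro h
      by_contra hx
      obtain ⟨i, hi⟩ := hcon x hx
      exact hi ((hP i x).symm.trans (h _ ⟨i, rfl⟩))
    · rintro rfl _ ⟨i, rfl⟩
      exact (hP i 0).trans (h0 i)
  have hrad : I.radical = vanishingIdeal k {(0 : Fin m → k)} := by
    rw [← hz, vanishingIdeal_zeroLocus_eq_radical]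
  have hmax : (vanishingIdeal k {(0 : Fin m → k)}).IsMaximal := inferInstance
  -- If the origin were the only common zero, its maximal ideal would be minimal over an ideal with
  -- r generators, and Krull's height theorem would give m ≤ r.
  have hmin : vanishingIdeal k {(0 : Fin m → k)} ∈ I.minimalPrimes := by
    rw [← Ideal.radical_minimalPrimes, hrad, Ideal.minimalPrimes_eq_subsingleton_self]
    rfl
  have h1 := Ideal.height_le_card_of_mem_minimalPrimes_span (Set.finite_range P) hmin
  have h2 : (Set.range P).ncard ≤ r := by
    have := Set.ncard_image_le (f := P) (s := Set.univ) Set.finite_univ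
    rwa [Set.image_univ, Set.ncard_univ, Nat.card_fin] at this
  have h3 := (natCast_le_height_vanishingIdeal_zero (k := k) (m := m)).trans h1
  have h4 := Nat.cast_le.mp h3
  omega

/-- Restriction of a polynomial function to a parametrized line. -/
theorem IsPolyFun.exists_polynomial {f : (Fin m → k) → k} (hf : IsPolyFun f) (a x : Fin m → k) :
    ∃ p : Polynomial k, ∀ t, p.eval t = f (a + t • x) := by
  obtain ⟨P, hP⟩ := hf
  refine ⟨aeval (fun i => Polynomial.C (a i) + Polynomial.X * Polynomial.C (x i)) P, fun t => ?_⟩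
  rw [← hP, ← Polynomial.coe_evalRingHom, map_aeval]
  have h1 : (Polynomial.evalRingHom t).comp (algebraMap k (Polynomial k)) = RingHom.id k := by
    ext; simp
  rw [h1]
  refine congrArg (fun y => eval y P) ?_
  ext i
  simp
  ring

theorem eq_zero_of_forall_eval_ne_zero [Infinite k] {p : Polynomial k}
    (h : ∀ t ≠ 0, p.eval t = 0) : p = 0 := by
  have : Polynomial.X * p = 0 := Polynomial.funext fun t => by
    by_cases ht : t = 0
    · simp [ht]
    · simp [h t ht]
  exact (mul_eq_zero.mp this).resolve_left Polynomial.X_ne_zero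

end Zeros

section Irreducible

open MvPolynomial

/-- If the cubic vanished everywhere, comparing its values at p + y and at p + t y for some t other
than 0 and 1 would make its derivative at p vanish. -/
theorem IsNonsingular.exists_cub_ne_zero {k V : Type*} [Field k] [AddCommGroup V] [Module k V]
    [Infinite k] [Nontrivial V] {τ : Trilin k V} (hτ : IsNonsingular τ) :
    ∃ x, cub τ x ≠ 0 := by
  classical
  by_contra! h
  obtain ⟨p, hp⟩ := exists_ne (0 : V)
  obtain ⟨y, hy⟩ := hτ p hp (h p)
  obtain ⟨t, ht⟩ := Infinite.exists_notMem_finset ({0, 1} : Finset k)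
  simp only [Finset.mem_insert, Finset.mem_singleton, not_or] at ht
  have h1 := h (p + y)
  have h2 := h (p + t • y)
  rw [cub_add, h, h] at h1
  rw [cub_add, h, h, dcub_smul_left, dcub_smul_right] at h2
  have h3 : t * (1 - t) * dcub τ p y = 0 := by linear_combination h2 - t ^ 2 * h1
  rcases mul_eq_zero.mp h3 with h3 | h3
  · rcases mul_eq_zero.mp h3 with h3 | h3
    · exact ht.1 h3
    · exact ht.2 (sub_eq_zero.mp h3).symm
  · exact hy h3

variable {k : Type*} [Field k] [IsAlgClosed k] {m : ℕ} {τ : Trilin k (Fin m → k)}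
  {P : MvPolynomial (Fin m) k}

theorem ne_zero_of_isNonsingular (hm : 2 < m) (hτ : IsNonsingular τ)
    (hP : ∀ x, eval x P = cub τ x) : P ≠ 0 := by
  have : Infinite k := IsAlgClosed.instInfinite
  have : Nonempty (Fin m) := ⟨⟨0, by omega⟩⟩
  obtain ⟨x, hx⟩ := hτ.exists_cub_ne_zero
  rintro rfl
  exact hx (by rw [← hP, map_zero])

/-- On a line t ↦ t x with P(x) ≠ 0 the product G H is P(x) t³, so a factor that is nonzero at t = 0
divides t³ and is constant. Thus G is constant away from P = 0, hence constant. -/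
theorem isUnit_of_mul_eq_cub (hP : ∀ x, eval x P = cub τ x) (hP0 : P ≠ 0)
    {G H : MvPolynomial (Fin m) k} (h : P = G * H) (hG : eval 0 G ≠ 0) : IsUnit G := by
  have : Infinite k := IsAlgClosed.instInfinite
  have key : G = C (eval 0 G) := by
    rw [← sub_eq_zero]
    refine (mul_eq_zero.mp (?_ : P * (G - C (eval 0 G)) = 0)).resolve_left hP0
    refine MvPolynomial.funext fun x => ?_
    rw [map_mul, map_sub, eval_C, map_zero, mul_eq_zero, or_iff_not_imp_left]
    intro hx
    obtain ⟨g, hg⟩ := IsPolyFun.exists_polynomial ⟨G, fun _ => rfl⟩ 0 x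
    obtain ⟨h', hh'⟩ := IsPolyFun.exists_polynomial ⟨H, fun _ => rfl⟩ 0 x
    have h1 : g * h' = Polynomial.C (eval x P) * Polynomial.X ^ 3 := Polynomial.funext fun t => by
      rw [Polynomial.eval_mul, hg, hh', ← map_mul, ← h, hP, zero_add, cub_smul]
      rw [Polynomial.eval_mul, Polynomial.eval_C, Polynomial.eval_pow, Polynomial.eval_X, hP,
        mul_comm]
    have h2 : g ∣ Polynomial.X ^ 3 :=
      ⟨h' * Polynomial.C (eval x P)⁻¹, by
        rw [← mul_assoc, h1, mul_right_comm, ← Polynomial.C_mul, mul_inv_cancel₀ hx,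
          Polynomial.C_1, one_mul]⟩
    obtain ⟨i, -, hi⟩ := (dvd_prime_pow Polynomial.prime_X 3).mp h2
    have h0 : g.eval 0 = eval 0 G := by rw [hg]; simp
    obtain ⟨u, hu⟩ := hi
    have hi0 : i = 0 := by
      by_contra hi0
      have := congrArg (Polynomial.eval 0) hu
      rw [Polynomial.eval_mul, h0, Polynomial.eval_pow, Polynomial.eval_X, zero_pow hi0] at this
      have hu0 : Polynomial.eval 0 (u : Polynomial k) ≠ 0 :=
        ((Polynomial.evalRingHom (0 : k)).isUnit_map u.isUnit).ne_zero
      exact mul_ne_zero hG hu0 this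
    rw [hi0, pow_zero] at hu
    obtain ⟨c, -, hc⟩ := Polynomial.isUnit_iff.mp (IsUnit.of_mul_eq_one _ hu)
    have e1 := hg 1
    rw [one_smul, zero_add, ← hc, Polynomial.eval_C] at e1
    rw [← hc, Polynomial.eval_C] at h0
    rw [← e1, ← h0, sub_self]
  rw [key]
  exact (isUnit_iff_ne_zero.mpr hG).map C

/-- A nonsingular cubic form in at least three variables is irreducible. -/
theorem prime_of_isNonsingular (hm : 2 < m) (hτ : IsNonsingular τ)
    (hP : ∀ x, eval x P = cub τ x) : Prime P := by
  have : Infinite k := IsAlgClosed.instInfinite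
  have hP0 := ne_zero_of_isNonsingular hm hτ hP
  refine Irreducible.prime ⟨fun hu => ?_, fun G H h => ?_⟩
  · have := (eval (0 : Fin m → k)).isUnit_map hu
    rw [hP, cub_zero] at this
    exact not_isUnit_zero this
  · by_contra! hcon
    have hG : eval 0 G = 0 := by
      by_contra hG
      exact hcon.1 (isUnit_of_mul_eq_cub hP hP0 h hG)
    have hH : eval 0 H = 0 := by
      by_contra hH
      exact hcon.2 (isUnit_of_mul_eq_cub hP hP0 (h.trans (mul_comm _ _)) hH)
    -- Two non-unit factors vanish at the origin and so have a further common zero p. The product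
    -- vanishes to second order at p along every line, contradicting nonsingularity.
    obtain ⟨p, hp, hGH⟩ := exists_ne_zero_common_zero hm
      (f := ![fun x => eval x G, fun x => eval x H])
      (by intro i; fin_cases i; exacts [⟨G, fun _ => rfl⟩, ⟨H, fun _ => rfl⟩])
      (by intro i; fin_cases i; exacts [hG, hH])
    have hpG : eval p G = 0 := hGH 0
    have hpH : eval p H = 0 := hGH 1
    have hp0 : cub τ p = 0 := by rw [← hP, h, map_mul, hpG, zero_mul]
    obtain ⟨y, hy⟩ := hτ p hp hp0
    obtain ⟨g, hg⟩ := IsPolyFun.exists_polynomial ⟨G, fun _ => rfl⟩ p y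
    obtain ⟨h', hh'⟩ := IsPolyFun.exists_polynomial ⟨H, fun _ => rfl⟩ p y
    have h1 : g * h' = Polynomial.C (dcub τ p y) * Polynomial.X +
        Polynomial.C (dcub τ y p) * Polynomial.X ^ 2 + Polynomial.C (cub τ y) * Polynomial.X ^ 3 :=
      Polynomial.funext fun t => by
        rw [Polynomial.eval_mul, hg, hh', ← map_mul, ← h, hP, cub_add, hp0, dcub_smul_left,
          dcub_smul_right, cub_smul]
        simp; ring
    have hg0 : Polynomial.X ∣ g := by
      rw [Polynomial.X_dvd_iff, Polynomial.coeff_zero_eq_eval_zero, hg]; simpa using hpG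
    have hh0 : Polynomial.X ∣ h' := by
      rw [Polynomial.X_dvd_iff, Polynomial.coeff_zero_eq_eval_zero, hh']; simpa using hpH
    have h2 := mul_dvd_mul hg0 hh0
    rw [h1, ← pow_two, Polynomial.X_pow_dvd_iff] at h2
    have := h2 1 (by norm_num)
    simp [Polynomial.coeff_X_pow] at this
    exact hy this

/-- A polynomial function that vanishes where a nonsingular cubic form vanishes is a multiple of
that form. -/
theorem IsNonsingular.exists_eq_mul (hm : 2 < m) (hτ : IsNonsingular τ) {g : (Fin m → k) → k}
    (hg : IsPolyFun g) (h : ∀ x, cub τ x = 0 → g x = 0) :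
    ∃ l : (Fin m → k) → k, IsPolyFun l ∧ ∀ x, g x = cub τ x * l x := by
  obtain ⟨P, hP⟩ := IsPolyFun.cub τ
  obtain ⟨G, hG⟩ := hg
  have hprime : (Ideal.span {P}).IsPrime :=
    (Ideal.span_singleton_prime (ne_zero_of_isNonsingular hm hτ hP)).mpr
      (prime_of_isNonsingular hm hτ hP)
  have h1 : G ∈ vanishingIdeal k (zeroLocus k (Ideal.span {P})) := by
    intro x hx
    rw [mem_zeroLocus_iff] at hx
    have := hx P (Ideal.mem_span_singleton_self P)
    rw [aeval_eq_eval] at this ⊢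
    exact (hG x).trans (h x ((hP x).symm.trans this))
  rw [IsPrime.vanishingIdeal_zeroLocus, Ideal.mem_span_singleton] at h1
  obtain ⟨L, rfl⟩ := h1
  exact ⟨fun x => eval x L, ⟨L, fun _ => rfl⟩, fun x => by rw [← hG, map_mul, hP]⟩

end Irreducible

end CubicSRC

end

noncomputable section

namespace CubicSRC

/-! ### Nonsingular hyperplane sections -/

section Bertini

open MvPolynomial

variable {k : Type*} [Field k] [IsAlgClosed k] {m : ℕ}

/-- The dual of a cubic hypersurface is contained in a hypersurface. -/
theorem exists_ne_zero_eval_dcub_eq_zero {τ : Trilin k (Fin m → k)} (hm : 2 < m)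
    (hτ : IsNonsingular τ) :
    ∃ g : MvPolynomial (Fin m) k, g ≠ 0 ∧
      ∀ p, cub τ p = 0 → eval (fun i => dcub τ p (Pi.single i 1)) g = 0 := by
  obtain ⟨P, hP⟩ := IsPolyFun.cub τ
  choose Q hQ using fun i => IsPolyFun.dcub τ (Pi.single i 1)
  have hP0 := ne_zero_of_isNonsingular hm hτ hP
  set w : Option (Fin m) → MvPolynomial (Fin m) k := fun o => o.elim P Q with hw
  -- The cubic and its m partial derivatives are m + 1 polynomials in m variables.
  have hdep : ¬ AlgebraicIndependent k w := by
    intro h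
    have h1 := h.lift_cardinalMk_le_trdeg
    rw [MvPolynomial.trdeg_of_isDomain] at h1
    simp only [Cardinal.mk_fintype, Fintype.card_option, Fintype.card_fin, Cardinal.lift_natCast,
      Nat.cast_le] at h1
    omega
  rw [algebraicIndependent_iff] at hdep
  push Not at hdep
  obtain ⟨G, hG, hG0⟩ := hdep
  -- The relation is divided by the highest power of the variable standing for the cubic. What
  -- remains is still a relation, and setting that variable to 0 gives a nonzero polynomial
  -- satisfied by the gradients at points of the hypersurface.
  obtain ⟨q, hq, hq0⟩ := Polynomial.exists_eq_pow_rootMultiplicity_mul_and_not_dvd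
    (optionEquivLeft k (Fin m) G) (by simpa using hG0) 0
  rw [map_zero, sub_zero, Polynomial.X_dvd_iff] at hq0
  rw [map_zero, sub_zero] at hq
  refine ⟨q.coeff 0, hq0, fun p hp => ?_⟩
  have h1 : G = X none ^ Polynomial.rootMultiplicity 0 (optionEquivLeft k (Fin m) G) *
      (optionEquivLeft k (Fin m)).symm q := by
    apply (optionEquivLeft k (Fin m)).injective
    rw [map_mul, map_pow, optionEquivLeft_X_none, AlgEquiv.apply_symm_apply]
    exact hq
  have h2 : aeval w ((optionEquivLeft k (Fin m)).symm q) = 0 := by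
    rw [h1, map_mul, map_pow, aeval_X] at hG
    exact (mul_eq_zero.mp hG).resolve_left (pow_ne_zero _ hP0)
  have h3 := congrArg (eval p) h2
  rw [map_zero, ← coe_aeval_eq_eval, RingHom.coe_coe, ← AlgHom.comp_apply,
    MvPolynomial.comp_aeval, aeval_eq_eval] at h3
  have h4 : (fun i => aeval p (w i)) = fun o : Option (Fin m) =>
      o.elim (0 : k) (fun i => dcub τ p (Pi.single i 1)) := by
    ext o
    cases o with
    | none => exact (hP p).trans hp
    | some i => exact hQ i p
  have h5 := (optionEquivLeft_elim_eval k (Fin m) (fun i => dcub τ p (Pi.single i 1)) 0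
    ((optionEquivLeft k (Fin m)).symm q)).symm
  rw [AlgEquiv.apply_symm_apply, ← h4] at h5
  rw [← Polynomial.coeff_zero_eq_eval_zero, Polynomial.coeff_map] at h5
  exact h5.trans h3

/-- A nonsingular cubic form has a nonsingular hyperplane section. -/
theorem IsNonsingular.exists_hyperplane {τ : Trilin k (Fin (m + 1) → k)} (hm : 2 ≤ m)
    (hτ : IsNonsingular τ) :
    ∃ f : (Fin m → k) →ₗ[k] (Fin (m + 1) → k), Function.Injective f ∧
      IsNonsingular (τ.pull f) := by
  have : Infinite k := IsAlgClosed.instInfinite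
  obtain ⟨g, hg0, hg⟩ := exists_ne_zero_eval_dcub_eq_zero (by omega) hτ
  -- The factor X 0 ensures c 0 ≠ 0, so the linear form with coefficients c is not zero.
  obtain ⟨c, hc⟩ : ∃ c, eval c (g * X 0) ≠ 0 := by
    by_contra! h
    exact mul_ne_zero hg0 (X_ne_zero 0) (MvPolynomial.funext fun x => by rw [h, map_zero])
  rw [map_mul, eval_X, mul_ne_zero_iff] at hc
  obtain ⟨hgc, hc0⟩ := hc
  let l : (Fin (m + 1) → k) →ₗ[k] k := ∑ i, c i • LinearMap.proj i
  have hl : ∀ x, l x = ∑ i, c i * x i := fun x => by simp [l]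
  have hls : ∀ i, l (Pi.single i 1) = c i := fun i => by simp [hl, Pi.single_apply]
  have hl0 : l ≠ 0 := fun h => hc0 (by rw [← hls 0, h, LinearMap.zero_apply])
  have hfr : Module.finrank k (LinearMap.ker l) = m := by
    have h1 := LinearMap.finrank_range_add_finrank_ker l
    rw [LinearMap.range_eq_top.mpr (LinearMap.surjective hl0), finrank_top, Module.finrank_self,
      Module.finrank_fin_fun] at h1
    omega
  let b := Module.finBasisOfFinrankEq k (LinearMap.ker l) hfr
  refine ⟨(LinearMap.ker l).subtype ∘ₗ b.equivFun.symm.toLinearMap,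
    Subtype.val_injective.comp b.equivFun.symm.injective, fun p hp hp0 => ?_⟩
  by_contra! hsing
  set x : Fin (m + 1) → k := ((b.equivFun.symm p : LinearMap.ker l) : Fin (m + 1) → k) with hx
  have hx0 : x ≠ 0 := by
    rw [hx, Ne, Submodule.coe_eq_zero, LinearEquiv.map_eq_zero_iff]
    exact hp
  have hxs : ∀ y, l y = 0 → dcub τ x y = 0 := fun y hy => by
    have := hsing (b.equivFun ⟨y, hy⟩)
    rw [dcub_pull, LinearMap.comp_apply, LinearMap.comp_apply, LinearEquiv.coe_coe,
      LinearEquiv.symm_apply_apply] at this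
    exact this
  have hcx : cub τ x = 0 := hp0
  obtain ⟨y, hy⟩ := hτ x hx0 hcx
  have hly : l y ≠ 0 := fun h => hy (hxs y h)
  have hmu : ∀ z, dcub τ x z = l z * (dcub τ x y / l y) := fun z => by
    have := hxs (z - (l z / l y) • y) (by
      rw [map_sub, map_smul, smul_eq_mul, div_mul_cancel₀ _ hly, sub_self])
    rw [dcub_sub_right, dcub_smul_right, sub_eq_zero] at this
    rw [this]; ring
  -- At a singular point x of the section the gradient is proportional to c. It is quadratic in x,
  -- so rescaling x by a square root makes it equal to c; this matters because g need not be
  -- homogeneous.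
  obtain ⟨s, hs⟩ := IsAlgClosed.exists_pow_nat_eq (l y / dcub τ x y) (n := 2) (by norm_num)
  have h1 := hg (s • x) (by rw [cub_smul, hcx, mul_zero])
  have h2 : (fun i => dcub τ (s • x) (Pi.single i 1)) = c := by
    ext i
    rw [dcub_smul_left, hmu, hls, hs]
    field_simp
  rw [h2] at h1
  exact hgc h1

/-- A nonsingular cubic form in at least four variables is nonsingular on some four-dimensional
subspace. -/
theorem IsNonsingular.exists_four {j : ℕ} {τ : Trilin k (Fin (j + 4) → k)}
    (hτ : IsNonsingular τ) :
    ∃ f : (Fin 4 → k) →ₗ[k] (Fin (j + 4) → k), Function.Injective f ∧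
      IsNonsingular (τ.pull f) := by
  induction j with
  | zero =>
    let e : (Fin 4 → k) ≃ₗ[k] (Fin (0 + 4) → k) :=
      LinearEquiv.funCongrLeft k k (Equiv.cast (by simp))
    refine ⟨e, e.injective, fun p hp hp0 => ?_⟩
    obtain ⟨y, hy⟩ := hτ (e p) (by simpa using hp) hp0
    exact ⟨e.symm y, by simpa using hy⟩
  | succ j ih =>
    have h : j + 1 + 4 = (j + 4) + 1 := by omega
    let e : (Fin (j + 4 + 1) → k) ≃ₗ[k] (Fin (j + 1 + 4) → k) :=
      LinearEquiv.funCongrLeft k k (finCongr h)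
    have he : IsNonsingular (τ.pull e.toLinearMap) := fun p hp hp0 => by
      obtain ⟨y, hy⟩ := hτ (e p) (by simpa using hp) hp0
      exact ⟨e.symm y, by simpa using hy⟩
    obtain ⟨f, hf, hfs⟩ := he.exists_hyperplane (by omega)
    obtain ⟨g, hg, hgs⟩ := ih hfs
    exact ⟨e.toLinearMap ∘ₗ f ∘ₗ g, e.injective.comp (hf.comp hg), hgs⟩

end Bertini

end CubicSRC

end

/-! ### From a nondegenerate second fundamental form to a nodal triple. -/

noncomputable section

namespace CubicSRC

/-! ### Nodal plane sections near a point with a nondegenerate second fundamental form -/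

section Hensel

variable {k : Type*} [Field k]

open PowerSeries

theorem powerSeries_isUnit_of_constantCoeff_ne_zero {f : PowerSeries k}
    (h : constantCoeff f ≠ 0) : IsUnit f :=
  isUnit_iff_constantCoeff.mpr (isUnit_iff_ne_zero.mpr h)

/-- A cubic equation over `k⟦ε⟧` with small constant coefficient and invertible linear coefficient
has a small root. -/
theorem exists_root_cubic {a₀ a₁ a₂ a₃ : PowerSeries k} (h₀ : X ∣ a₀)
    (h₁ : constantCoeff a₁ ≠ 0) :
    ∃ y, a₀ ∣ y ∧ a₀ + a₁ * y + a₂ * y ^ 2 + a₃ * y ^ 3 = 0 := by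
  have hc₀ : constantCoeff a₀ = 0 := X_dvd_iff.mp h₀
  -- Substituting y = a₀ / T and multiplying by T³ / a₀ gives a monic equation for T, with simple
  -- approximate root -a₁ modulo the variable. Hensel's lemma applies to it.
  let f : Polynomial (PowerSeries k) := Polynomial.X ^ 3 + Polynomial.C a₁ * Polynomial.X ^ 2 +
    Polynomial.C (a₂ * a₀) * Polynomial.X + Polynomial.C (a₃ * a₀ ^ 2)
  have hf : f.Monic := by
    simp only [f]
    monicity!
  obtain ⟨T, hT, hTa⟩ := HenselianRing.is_henselian (I := Ideal.span {(X : PowerSeries k)})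
    f hf (-a₁) (by
      rw [Ideal.mem_span_singleton, X_dvd_iff]
      simp [f, hc₀]; ring) (by
      refine IsUnit.map _ (powerSeries_isUnit_of_constantCoeff_ne_zero ?_)
      simp [f, hc₀, Polynomial.derivative_pow]
      intro h
      refine h₁ (pow_eq_zero_iff (n := 2) (by norm_num) |>.mp ?_)
      rw [map_ofNat, map_ofNat] at h
      linear_combination h)
  rw [Ideal.mem_span_singleton, X_dvd_iff, map_sub, map_neg, sub_neg_eq_add] at hTa
  obtain ⟨U, hU⟩ := (powerSeries_isUnit_of_constantCoeff_ne_zero (f := T) (by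
    intro h; rw [h, zero_add] at hTa; exact h₁ hTa)).exists_left_inv
  refine ⟨a₀ * U, dvd_mul_right _ _, ?_⟩
  have h : T ^ 3 + a₁ * T ^ 2 + a₂ * a₀ * T + a₃ * a₀ ^ 2 = 0 := by
    simpa [f, Polynomial.IsRoot] using hT
  linear_combination a₀ * U ^ 3 * h - (a₀ * ((U * T) ^ 2 + U * T + 1) +
    a₁ * a₀ * U * (U * T + 1) + a₂ * a₀ ^ 2 * U ^ 2) * hU

end Hensel

/-- The coefficients of a quaternary cubic form
`x₀ ^ 2 x₃ + x₀ x₁ x₂ + c x₀ x₃ ^ 2 + g(x₁, x₂, x₃)`. -/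
structure NormalForm (A : Type*) where
  (c g₁ g₂ g₃ p₁₂ p₁₃ p₂₁ p₂₃ p₃₁ p₃₂ q : A)

namespace NormalForm

variable {A B : Type*} [CommRing A] [CommRing B]

/-- The cubic form in normal form. -/
def form (γ : NormalForm A) (x₀ x₁ x₂ x₃ : A) : A :=
  x₀ ^ 2 * x₃ + x₀ * x₁ * x₂ + γ.c * x₀ * x₃ ^ 2 + γ.g₁ * x₁ ^ 3 + γ.g₂ * x₂ ^ 3 + γ.g₃ * x₃ ^ 3 +
    γ.p₁₂ * x₁ ^ 2 * x₂ + γ.p₁₃ * x₁ ^ 2 * x₃ + γ.p₂₁ * x₂ ^ 2 * x₁ + γ.p₂₃ * x₂ ^ 2 * x₃ +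
    γ.p₃₁ * x₃ ^ 2 * x₁ + γ.p₃₂ * x₃ ^ 2 * x₂ + γ.q * x₁ * x₂ * x₃

/-- The derivative of the cubic form in normal form at `x` in direction `y`. -/
def deriv (γ : NormalForm A) (x₀ x₁ x₂ x₃ y₀ y₁ y₂ y₃ : A) : A :=
  y₀ * (2 * x₀ * x₃ + x₁ * x₂ + γ.c * x₃ ^ 2) +
  y₁ * (x₀ * x₂ + 3 * γ.g₁ * x₁ ^ 2 + 2 * γ.p₁₂ * x₁ * x₂ + 2 * γ.p₁₃ * x₁ * x₃ +
    γ.p₂₁ * x₂ ^ 2 + γ.p₃₁ * x₃ ^ 2 + γ.q * x₂ * x₃) +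
  y₂ * (x₀ * x₁ + 3 * γ.g₂ * x₂ ^ 2 + γ.p₁₂ * x₁ ^ 2 + 2 * γ.p₂₁ * x₁ * x₂ +
    2 * γ.p₂₃ * x₂ * x₃ + γ.p₃₂ * x₃ ^ 2 + γ.q * x₁ * x₃) +
  y₃ * (x₀ ^ 2 + 2 * γ.c * x₀ * x₃ + 3 * γ.g₃ * x₃ ^ 2 + γ.p₁₃ * x₁ ^ 2 + γ.p₂₃ * x₂ ^ 2 +
    2 * γ.p₃₁ * x₁ * x₃ + 2 * γ.p₃₂ * x₂ * x₃ + γ.q * x₁ * x₂)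

/-- Change of coefficient ring. -/
def map (f : A →+* B) (γ : NormalForm A) : NormalForm B :=
  ⟨f γ.c, f γ.g₁, f γ.g₂, f γ.g₃, f γ.p₁₂, f γ.p₁₃, f γ.p₂₁, f γ.p₂₃, f γ.p₃₁, f γ.p₃₂, f γ.q⟩

/-- Exchanging the variables `x₁` and `x₂`. -/
def swap (γ : NormalForm A) : NormalForm A :=
  ⟨γ.c, γ.g₂, γ.g₁, γ.g₃, γ.p₂₁, γ.p₂₃, γ.p₁₂, γ.p₁₃, γ.p₃₂, γ.p₃₁, γ.q⟩

theorem map_form (f : A →+* B) (γ : NormalForm A) (x₀ x₁ x₂ x₃ : A) :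
    f (γ.form x₀ x₁ x₂ x₃) = (γ.map f).form (f x₀) (f x₁) (f x₂) (f x₃) := by
  simp only [form, map, map_add, map_mul, map_pow]

theorem map_deriv (f : A →+* B) (γ : NormalForm A) (x₀ x₁ x₂ x₃ y₀ y₁ y₂ y₃ : A) :
    f (γ.deriv x₀ x₁ x₂ x₃ y₀ y₁ y₂ y₃) =
      (γ.map f).deriv (f x₀) (f x₁) (f x₂) (f x₃) (f y₀) (f y₁) (f y₂) (f y₃) := by
  simp only [deriv, map, map_add, map_mul, map_pow, map_ofNat]

theorem swap_form (γ : NormalForm A) (x₀ x₁ x₂ x₃ : A) :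
    γ.swap.form x₀ x₁ x₂ x₃ = γ.form x₀ x₂ x₁ x₃ := by
  simp only [form, swap]; ring

theorem swap_deriv (γ : NormalForm A) (x₀ x₁ x₂ x₃ y₀ y₁ y₂ y₃ : A) :
    γ.swap.deriv x₀ x₁ x₂ x₃ y₀ y₁ y₂ y₃ = γ.deriv x₀ x₂ x₁ x₃ y₀ y₂ y₁ y₃ := by
  simp only [deriv, swap]; ring

section PowerSeries

open PowerSeries

variable {k : Type*} [Field k]

/-- The point (1, ε, ε, y) runs along the section x₁ = x₂ of the surface, starting at (1, 0, 0, 0).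
The choice is symmetric in x₁ and x₂, so both branches can be treated alike. -/
theorem exists_point (γ : NormalForm k) :
    ∃ y : PowerSeries k, X ^ 2 ∣ y ∧ (γ.map (C (R := k))).form 1 X X y = 0 := by
  obtain ⟨y, hy, h⟩ := exists_root_cubic
    (a₀ := X ^ 2 * (1 + X * (C γ.g₁ + C γ.g₂ + C γ.p₁₂ + C γ.p₂₁)))
    (a₁ := 1 + X ^ 2 * (C γ.p₁₃ + C γ.p₂₃ + C γ.q))
    (a₂ := C γ.c + X * (C γ.p₃₁ + C γ.p₃₂)) (a₃ := C γ.g₃)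
    (Dvd.intro _ (by rw [pow_two, mul_assoc])) (by simp)
  refine ⟨y, (dvd_mul_right _ _).trans hy, ?_⟩
  simp only [form, map]
  linear_combination h

-- The direction (0, 1, x, z) is the asymptotic direction at (1, ε, ε, y) that specializes to e₁.
-- Tangency is linear in z and gives z = ε (a + b x); the asymptotic condition is then a quadratic
-- equation for x with invertible linear coefficient. The value of the cubic in this direction has
-- constant term g₁, and if g₁ = 0 its ε-coefficient is -(p₁₂² + p₁₃). Hence the branch is not a
-- flex over k⟦ε⟧.
set_option linter.unusedVariables false in
theorem exists_branch (γ : NormalForm k) (hγ : γ.g₁ = 0 → γ.p₁₂ ^ 2 + γ.p₁₃ ≠ 0)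
    {y : PowerSeries k} (hy : X ^ 2 ∣ y) :
    ∃ x z : PowerSeries k, constantCoeff x = 0 ∧ constantCoeff z = 0 ∧
      (γ.map (C (R := k))).deriv 1 X X y 0 1 x z = 0 ∧
      (γ.map (C (R := k))).deriv 0 1 x z 1 X X y = 0 ∧
      (γ.map (C (R := k))).form 0 1 x z ≠ 0 := by
  obtain ⟨y', rfl⟩ := hy
  obtain ⟨c, g₁, g₂, g₃, p₁₂, p₁₃, p₂₁, p₂₃, p₃₁, p₃₂, q⟩ := γ
  simp only [map, form, deriv] at hγ ⊢
  set ε : PowerSeries k := X with hε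
  have hε0 : constantCoeff ε = 0 := constantCoeff_X
  obtain ⟨U, hU⟩ := (powerSeries_isUnit_of_constantCoeff_ne_zero
    (f := 1 + 2 * C c * (ε ^ 2 * y') + 3 * C g₃ * (ε ^ 2 * y') ^ 2 + C p₁₃ * ε ^ 2 +
      C p₂₃ * ε ^ 2 + 2 * C p₃₁ * ε * (ε ^ 2 * y') + 2 * C p₃₂ * ε * (ε ^ 2 * y') +
      C q * ε * ε) (by simp [hε0])).exists_left_inv
  have hU1 : constantCoeff U = 1 := by
    have := congrArg constantCoeff hU
    simpa [hε0] using this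
  set a : PowerSeries k := -(1 + ε * (3 * C g₁ + 2 * C p₁₂ + C p₂₁) +
    (2 * C p₁₃ + C q) * (ε ^ 2 * y') + C p₃₁ * ε ^ 3 * y' ^ 2) * U with ha
  set b : PowerSeries k := -(1 + ε * (3 * C g₂ + C p₁₂ + 2 * C p₂₁) +
    (2 * C p₂₃ + C q) * (ε ^ 2 * y') + C p₃₂ * ε ^ 3 * y' ^ 2) * U with hb
  have ha1 : constantCoeff a = -1 := by simp [ha, hε0, hU1]
  set b₀ : PowerSeries k := (3 * C g₁ + C p₁₂) + ε * (C c * a ^ 2 + 2 * C p₁₃ * a +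
    ε * C p₃₁ * a ^ 2 + ε * C p₃₂ * a ^ 2 + C q * a + y' * (3 * C g₃ * (ε * a) ^ 2 + C p₁₃ +
    2 * C p₃₁ * (ε * a))) with hb0
  set b₁ : PowerSeries k := 1 + 2 * C c * (ε * a) * (ε * b) + ε * (2 * C p₁₂ +
    2 * C p₁₃ * (ε * b) + 2 * C p₃₁ * (ε * a) * (ε * b) + C q * (ε * a) + 2 * C p₂₁ +
    2 * C p₂₃ * (ε * a) + 2 * C p₃₂ * (ε * a) * (ε * b) + C q * (ε * b)) +
    (ε ^ 2 * y') * (6 * C g₃ * (ε * a) * (ε * b) + 2 * C p₃₁ * (ε * b) + 2 * C p₃₂ * (ε * a) +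
      C q) with hb1
  set b₂ : PowerSeries k := C c * (ε * b) ^ 2 + ε * (C p₂₁ + C p₃₁ * (ε * b) ^ 2 + C q * (ε * b) +
    3 * C g₂ + 2 * C p₂₃ * (ε * b) + C p₃₂ * (ε * b) ^ 2) +
    (ε ^ 2 * y') * (3 * C g₃ * (ε * b) ^ 2 + C p₂₃ + 2 * C p₃₂ * (ε * b)) with hb2
  obtain ⟨x, hx, h⟩ := exists_root_cubic (a₀ := ε * b₀) (a₁ := b₁) (a₂ := b₂) (a₃ := 0)
    (dvd_mul_right _ _) (by simp [hb1, hε0])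
  obtain ⟨x', rfl⟩ := (dvd_mul_right ε b₀).trans hx
  have hx1 : constantCoeff x' = - (3 * g₁ + p₁₂) := by
    have h1 : ε * (b₀ + b₁ * x' + b₂ * ε * x' ^ 2) = 0 := by linear_combination h
    have h2 := congrArg constantCoeff ((mul_eq_zero.mp h1).resolve_left X_ne_zero)
    simp only [hb0, hb1, map_add, map_mul, hε0, map_pow, map_zero, map_one, map_ofNat,
      constantCoeff_C] at h2
    linear_combination h2
  refine ⟨ε * x', ε * (a + b * (ε * x')), by simp [hε0], by simp [hε0], ?_, ?_, ?_⟩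
  · simp only [ha, hb]
    linear_combination -(ε * (1 + ε * (3 * C g₁ + 2 * C p₁₂ + C p₂₁) +
      (2 * C p₁₃ + C q) * (ε ^ 2 * y') + C p₃₁ * ε ^ 3 * y' ^ 2) +
      ε ^ 2 * x' * (1 + ε * (3 * C g₂ + C p₁₂ + 2 * C p₂₁) +
      (2 * C p₂₃ + C q) * (ε ^ 2 * y') + C p₃₂ * ε ^ 3 * y' ^ 2)) * hU
  · linear_combination h
  · by_cases hg : g₁ = 0
    · subst hg
      intro h0
      have h1 : ε * (C p₁₂ * x' + C p₁₃ * (a + b * (ε * x')) + ε * (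
        C g₂ * ε * x' ^ 3 + C g₃ * ε * (a + b * (ε * x')) ^ 3 + C p₂₁ * x' ^ 2 +
        C p₂₃ * x' ^ 2 * ε * (a + b * (ε * x')) + C p₃₁ * (a + b * (ε * x')) ^ 2 +
        C p₃₂ * (a + b * (ε * x')) ^ 2 * (ε * x') + C q * x' * (a + b * (ε * x')))) = 0 := by
        rw [← h0, map_zero]; ring
      have h2 := congrArg constantCoeff ((mul_eq_zero.mp h1).resolve_left X_ne_zero)
      simp only [map_add, map_mul, hε0, map_pow, map_zero, constantCoeff_C, hx1, ha1] at h2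
      exact hγ rfl (by linear_combination -h2)
    · intro h0
      have h2 := congrArg constantCoeff h0
      simp [hε0, hg] at h2

end PowerSeries

end NormalForm

end CubicSRC

end

noncomputable section

namespace CubicSRC

section Transfer

open MvPolynomial

/-- A system of polynomial equations and one inequation over an algebraically closed field that is
solvable in some domain over that field is solvable. -/
theorem exists_eval_of_aeval {k σ ι A : Type*} [Field k] [IsAlgClosed k] [Finite σ] [CommRing A]
    [IsDomain A] [Algebra k A] (E : ι → MvPolynomial σ k) (N : MvPolynomial σ k) (t : σ → A)
    (hE : ∀ i, aeval t (E i) = 0) (hN : aeval t N ≠ 0) :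
    ∃ s : σ → k, (∀ i, eval s (E i) = 0) ∧ eval s N ≠ 0 := by
  -- Otherwise the Nullstellensatz puts a power of N in the ideal of the equations, and evaluating
  -- at the solution in the domain A gives a contradiction.
  by_contra! h
  have h1 : N ∈ vanishingIdeal k (zeroLocus k (Ideal.span (Set.range E))) := by
    intro s hs
    rw [zeroLocus_span] at hs
    rw [aeval_eq_eval]
    exact h s fun i => by simpa [aeval_eq_eval] using! hs (E i) ⟨i, rfl⟩
  rw [vanishingIdeal_zeroLocus_eq_radical] at h1
  obtain ⟨n, hn⟩ := h1
  have h2 : Ideal.span (Set.range E) ≤ RingHom.ker (aeval t : MvPolynomial σ k →ₐ[k] A) := by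
    rw [Ideal.span_le]
    rintro _ ⟨i, rfl⟩
    exact hE i
  have h3 : aeval t (N ^ n) = 0 := h2 hn
  rw [map_pow] at h3
  exact pow_ne_zero n hN h3

end Transfer

namespace NormalForm

/-- The difference is the full polarization of p, v, w, written with derivatives only. When the
small quantities vanish the three vectors become e₀, e₁, e₂, on which it equals the coefficient 1 of
x₀x₁x₂. -/
theorem map_polar_eq_one {A B : Type*} [CommRing A] [CommRing B] (γ : NormalForm A) (f : A →+* B)
    {a y x z x' z' : A} (ha : f a = 0) (hy : f y = 0) (hx : f x = 0) (hz : f z = 0)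
    (hx' : f x' = 0) (hz' : f z' = 0) :
    f (γ.deriv 1 (a + 1) (a + x) (y + z) 0 x' 1 z' - γ.deriv 1 a a y 0 x' 1 z' -
        γ.deriv 0 1 x z 0 x' 1 z') = 1 := by
  rw [map_sub, map_sub, map_deriv, map_deriv, map_deriv]
  simp only [map_add, map_one, map_zero, ha, hy, hx, hz, hx', hz', deriv]
  ring

variable {k : Type*} [Field k] [IsAlgClosed k]

set_option maxHeartbeats 800000 in
/-- Near the origin of the chart there is a nodal plane section whose two branches are not
flexes. -/
theorem exists_nodal_section (γ : NormalForm k) (h₁ : γ.g₁ = 0 → γ.p₁₂ ^ 2 + γ.p₁₃ ≠ 0)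
    (h₂ : γ.g₂ = 0 → γ.p₂₁ ^ 2 + γ.p₂₃ ≠ 0) :
    ∃ a y x z x' z' : k, γ.form 1 a a y = 0 ∧
      γ.deriv 1 a a y 0 1 x z = 0 ∧ γ.deriv 0 1 x z 1 a a y = 0 ∧
      γ.deriv 1 a a y 0 x' 1 z' = 0 ∧ γ.deriv 0 x' 1 z' 1 a a y = 0 ∧
      γ.form 0 1 x z ≠ 0 ∧ γ.form 0 x' 1 z' ≠ 0 ∧
      γ.deriv 1 (a + 1) (a + x) (y + z) 0 x' 1 z' - γ.deriv 1 a a y 0 x' 1 z' -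
        γ.deriv 0 1 x z 0 x' 1 z' ≠ 0 := by
  obtain ⟨y, hy, hy0⟩ := γ.exists_point
  obtain ⟨x, z, hx, hz, e1, e2, e3⟩ := γ.exists_branch h₁ hy
  -- The second branch specializes to e₂; the exchange of x₁ and x₂ fixes the point (1, ε, ε, y).
  obtain ⟨x', z', hx', hz', e1', e2', e3'⟩ := γ.swap.exists_branch h₂ hy
  have hsw : γ.swap.map (PowerSeries.C (R := k)) = (γ.map PowerSeries.C).swap := rfl
  rw [hsw, swap_deriv] at e1' e2'
  rw [hsw, swap_form] at e3'
  let t : Fin 6 → PowerSeries k := ![PowerSeries.X, y, x, z, x', z']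
  let γ' := γ.map (MvPolynomial.C (R := k) (σ := Fin 6))
  let E : Fin 5 → MvPolynomial (Fin 6) k := ![γ'.form 1 (.X 0) (.X 0) (.X 1),
    γ'.deriv 1 (.X 0) (.X 0) (.X 1) 0 1 (.X 2) (.X 3),
    γ'.deriv 0 1 (.X 2) (.X 3) 1 (.X 0) (.X 0) (.X 1),
    γ'.deriv 1 (.X 0) (.X 0) (.X 1) 0 (.X 4) 1 (.X 5),
    γ'.deriv 0 (.X 4) 1 (.X 5) 1 (.X 0) (.X 0) (.X 1)]
  let N₁ := γ'.form 0 1 (.X 2) (.X 3)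
  let N₂ := γ'.form 0 (.X 4) 1 (.X 5)
  let N₃ := γ'.deriv 1 (.X 0 + 1) (.X 0 + .X 2) (.X 1 + .X 3) 0 (.X 4) 1 (.X 5) -
    γ'.deriv 1 (.X 0) (.X 0) (.X 1) 0 (.X 4) 1 (.X 5) - γ'.deriv 0 1 (.X 2) (.X 3) 0 (.X 4) 1 (.X 5)
  have hγ : γ'.map (MvPolynomial.aeval t : MvPolynomial (Fin 6) k →ₐ[k] _).toRingHom =
      γ.map PowerSeries.C := by
    simp only [γ', map, AlgHom.toRingHom_eq_coe, RingHom.coe_coe, MvPolynomial.aeval_C]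
    rfl
  have hform : ∀ a b c d : MvPolynomial (Fin 6) k, MvPolynomial.aeval t (γ'.form a b c d) =
      (γ.map PowerSeries.C).form (MvPolynomial.aeval t a) (MvPolynomial.aeval t b)
        (MvPolynomial.aeval t c) (MvPolynomial.aeval t d) := fun a b c d => by
    rw [← hγ]
    exact map_form (MvPolynomial.aeval t : MvPolynomial (Fin 6) k →ₐ[k] _).toRingHom γ' a b c d
  have hderiv : ∀ a b c d a' b' c' d' : MvPolynomial (Fin 6) k,
      MvPolynomial.aeval t (γ'.deriv a b c d a' b' c' d') =
      (γ.map PowerSeries.C).deriv (MvPolynomial.aeval t a) (MvPolynomial.aeval t b)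
        (MvPolynomial.aeval t c) (MvPolynomial.aeval t d) (MvPolynomial.aeval t a')
        (MvPolynomial.aeval t b') (MvPolynomial.aeval t c') (MvPolynomial.aeval t d') :=
    fun a b c d a' b' c' d' => by
    rw [← hγ]
    exact map_deriv (MvPolynomial.aeval t : MvPolynomial (Fin 6) k →ₐ[k] _).toRingHom γ' _ _ _ _
      _ _ _ _
  have ht0 : t 0 = PowerSeries.X := rfl
  have ht1 : t 1 = y := rfl
  have ht2 : t 2 = x := rfl
  have ht3 : t 3 = z := rfl
  have ht4 : t 4 = x' := rfl
  have ht5 : t 5 = z' := rfl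
  obtain ⟨s, hs, hN⟩ := exists_eval_of_aeval E (N₁ * N₂ * N₃) t (by
    intro i
    fin_cases i
    · simp only [E, Fin.zero_eta, Matrix.cons_val_zero, hform, map_one, MvPolynomial.aeval_X, ht0,
        ht1]
      exact hy0
    · simp only [E, Fin.mk_one, Matrix.cons_val_one, Matrix.cons_val, hderiv, map_one, map_zero,
        MvPolynomial.aeval_X, ht0, ht1, ht2, ht3]
      exact e1
    · simp only [E, Fin.reduceFinMk, Matrix.cons_val, hderiv, map_one, map_zero,
        MvPolynomial.aeval_X, ht0, ht1, ht2, ht3]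
      exact e2
    · simp only [E, Fin.reduceFinMk, Matrix.cons_val, hderiv, map_one, map_zero,
        MvPolynomial.aeval_X, ht0, ht1, ht4, ht5]
      exact e1'
    · simp only [E, Fin.reduceFinMk, Matrix.cons_val, hderiv, map_one, map_zero,
        MvPolynomial.aeval_X, ht0, ht1, ht4, ht5]
      exact e2') (by
    rw [map_mul, map_mul]
    refine mul_ne_zero (mul_ne_zero ?_ ?_) ?_
    · simp only [N₁, hform, map_one, map_zero, MvPolynomial.aeval_X, ht2, ht3]
      exact e3
    · simp only [N₂, hform, map_one, map_zero, MvPolynomial.aeval_X, ht4, ht5]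
      exact e3'
    · simp only [N₃, map_sub, hderiv, map_one, map_zero, map_add, MvPolynomial.aeval_X, ht0, ht1,
        ht2, ht3, ht4, ht5]
      intro h
      have hyc : PowerSeries.constantCoeff y = 0 := by
        obtain ⟨w, rfl⟩ := hy; simp
      have h' := map_polar_eq_one (γ.map PowerSeries.C) PowerSeries.constantCoeff
        PowerSeries.constantCoeff_X hyc hx hz hx' hz'
      rw [h, map_zero] at h'
      exact zero_ne_one h')
  have hev : γ'.map (MvPolynomial.eval s) = γ := by simp [γ', map]
  rw [map_mul, map_mul, mul_ne_zero_iff, mul_ne_zero_iff] at hN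
  have k0 := hs 0
  have k1 := hs 1
  have k2 := hs 2
  have k3 := hs 3
  have k4 := hs 4
  have k5 := hN.1.1
  have k6 := hN.1.2
  have k7 := hN.2
  simp only [E, N₁, N₂, N₃, Matrix.cons_val_zero, Matrix.cons_val_one, Matrix.cons_val, map_form,
    map_deriv, hev, map_one, map_zero, MvPolynomial.eval_X, map_sub, map_add]
    at k0 k1 k2 k3 k4 k5 k6 k7
  exact ⟨s 0, s 1, s 2, s 3, s 4, s 5, k0, k1, k2, k3, k4, k5, k6, k7⟩

end NormalForm

section GoodPoint

variable {k V : Type*} [Field k] [IsAlgClosed k] [AddCommGroup V] [Module k V] {τ : Trilin k V}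

/-- A nodal plane section whose branches are not flexes contains a nodal triple. -/
theorem exists_isNodalTriple_of_node {p v w : V} (hp : cub τ p = 0) (hpv : dcub τ p v = 0)
    (hvp : dcub τ v p = 0) (hpw : dcub τ p w = 0) (hwp : dcub τ w p = 0) (hv : cub τ v ≠ 0)
    (hw : cub τ w ≠ 0) (hpvw : tri τ p v w ≠ 0) : ∃ a b c, IsNodalTriple τ a b c := by
  obtain ⟨β, hβ⟩ := IsAlgClosed.exists_pow_nat_eq (-(cub τ v)⁻¹) (n := 3) (by norm_num)
  obtain ⟨δ, hδ⟩ := IsAlgClosed.exists_pow_nat_eq (-(cub τ w)⁻¹) (n := 3) (by norm_num)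
  have hβ0 : β ≠ 0 := by
    rintro rfl
    rw [zero_pow (by norm_num), eq_comm, neg_eq_zero, inv_eq_zero] at hβ
    exact hv hβ
  have hδ0 : δ ≠ 0 := by
    rintro rfl
    rw [zero_pow (by norm_num), eq_comm, neg_eq_zero, inv_eq_zero] at hδ
    exact hw hδ
  have hpp : dcub τ p p = 0 := by rw [dcub_self, hp, mul_zero]
  have hvpw : tri τ v p w = tri τ p v w := tri_swap_left _ _ _ _
  have hwpv : tri τ w p v = tri τ p v w := by rw [tri_swap_left, tri_swap_right]
  set φ := tri τ p v w with hφ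
  -- On x p + y v + z w the cubic is φ x y z plus a binary cubic in y, z. Translating v and w by
  -- multiples of p absorbs y²z and yz² into xyz, and the cube roots β and δ normalize the two cubes
  -- to -1.
  refine ⟨(φ * β * δ)⁻¹ • p, β • (v + (-(dcub τ v w / φ)) • p),
    δ • (w + (-(dcub τ w v / φ)) • p), ?_, ?_, ?_, ?_, ?_, ?_, ?_, ?_, ?_, ?_⟩ <;>
  simp only [cub_smul, cub_add, dcub_smul_left, dcub_smul_right, dcub_add_left, dcub_add_right,
    tri_smul_left, tri_smul_mid, tri_smul_right, tri_add_mid, tri_add_right, tri_self_left,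
    tri_self_mid, tri_self_right, hp, hpv, hvp, hpw, hwp, hpp, hvpw, hwpv, ← hφ, hβ, hδ] <;>
  field_simp <;> ring

/-- Coordinates with respect to four vectors in normal position. -/
theorem exists_isNodalTriple_of_normal_position {e₀ e₁ e₂ e₃ : V} (h0 : cub τ e₀ = 0)
    (h01 : dcub τ e₀ e₁ = 0) (h02 : dcub τ e₀ e₂ = 0) (h03 : dcub τ e₀ e₃ = 1)
    (h10 : dcub τ e₁ e₀ = 0) (h20 : dcub τ e₂ e₀ = 0) (h012 : tri τ e₀ e₁ e₂ = 1)
    (h013 : tri τ e₀ e₁ e₃ = 0) (h023 : tri τ e₀ e₂ e₃ = 0)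
    (h₁ : cub τ e₁ = 0 → dcub τ e₁ e₂ ^ 2 + dcub τ e₁ e₃ ≠ 0)
    (h₂ : cub τ e₂ = 0 → dcub τ e₂ e₁ ^ 2 + dcub τ e₂ e₃ ≠ 0) :
    ∃ a b c, IsNodalTriple τ a b c := by
  let γ : NormalForm k := ⟨dcub τ e₃ e₀, cub τ e₁, cub τ e₂, cub τ e₃, dcub τ e₁ e₂, dcub τ e₁ e₃,
    dcub τ e₂ e₁, dcub τ e₂ e₃, dcub τ e₃ e₁, dcub τ e₃ e₂, tri τ e₁ e₂ e₃⟩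
  have hform : ∀ x y z t : k, cub τ (x • e₀ + y • e₁ + z • e₂ + t • e₃) = γ.form x y z t := by
    intro x y z t
    rw [cub_comb_four, h0, h01, h02, h03, h10, h20, h012, h013, h023]
    simp only [γ, NormalForm.form]; ring
  have h120 : tri τ e₁ e₂ e₀ = 1 := by rw [tri_swap_right, tri_swap_left, h012]
  have h130 : tri τ e₁ e₃ e₀ = 0 := by rw [tri_swap_right, tri_swap_left, h013]
  have h230 : tri τ e₂ e₃ e₀ = 0 := by rw [tri_swap_right, tri_swap_left, h023]
  have h021 : tri τ e₀ e₂ e₁ = 1 := by rw [tri_swap_right, h012]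
  have h031 : tri τ e₀ e₃ e₁ = 0 := by rw [tri_swap_right, h013]
  have h032 : tri τ e₀ e₃ e₂ = 0 := by rw [tri_swap_right, h023]
  have h132 : tri τ e₁ e₃ e₂ = tri τ e₁ e₂ e₃ := tri_swap_right _ _ _ _
  have h231 : tri τ e₂ e₃ e₁ = tri τ e₁ e₂ e₃ := by rw [tri_swap_right, tri_swap_left]
  have hderiv : ∀ x y z t x' y' z' t' : k, dcub τ (x • e₀ + y • e₁ + z • e₂ + t • e₃)
      (x' • e₀ + y' • e₁ + z' • e₂ + t' • e₃) = γ.deriv x y z t x' y' z' t' := by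
    intro x y z t x' y' z' t'
    simp only [dcub_add_right, dcub_smul_right, dcub_comb_four, tri_self_mid, tri_self_right,
      dcub_self, h0, h01, h02, h03, h10, h20, h012, h013, h023, h120, h130, h230, h021, h031, h032,
      h132, h231]
    simp only [γ, NormalForm.deriv]; ring
  obtain ⟨a, y, x, z, x', z', k0, k1, k2, k3, k4, k5, k6, k7⟩ := γ.exists_nodal_section h₁ h₂
  rw [← hform] at k0 k5 k6
  rw [← hderiv] at k1 k2 k3 k4
  refine exists_isNodalTriple_of_node k0 k1 k2 k3 k4 k5 k6 fun h => k7 ?_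
  rw [← hderiv, ← hderiv, ← hderiv]
  have h' := dcub_add_left τ ((1 : k) • e₀ + a • e₁ + a • e₂ + y • e₃)
    ((0 : k) • e₀ + (1 : k) • e₁ + x • e₂ + z • e₃)
    ((0 : k) • e₀ + x' • e₁ + (1 : k) • e₂ + z' • e₃)
  rw [h, add_zero] at h'
  rw [sub_sub, ← h', sub_eq_zero]
  congr 1
  module

/-- A point of a nonsingular cubic surface at which the second fundamental form is nondegenerate
gives rise to a nodal triple. -/
theorem IsNonsingular.exists_isNodalTriple (hV : Module.finrank k V = 4) (hτ : IsNonsingular τ)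
    {p e₁ e₂ : V} (hp : cub τ p = 0) (h1 : dcub τ p e₁ = 0) (h2 : dcub τ p e₂ = 0)
    (h1' : dcub τ e₁ p = 0) (h2' : dcub τ e₂ p = 0) (h12 : tri τ p e₁ e₂ ≠ 0) :
    ∃ a b c, IsNodalTriple τ a b c := by
  wlog h12' : tri τ p e₁ e₂ = 1 generalizing e₁
  · refine this (e₁ := (tri τ p e₁ e₂)⁻¹ • e₁) ?_ ?_ ?_ ?_
    · rw [dcub_smul_right, h1, mul_zero]
    · rw [dcub_smul_left, h1', mul_zero]
    · rw [tri_smul_mid, inv_mul_cancel₀ h12]; exact one_ne_zero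
    · rw [tri_smul_mid, inv_mul_cancel₀ h12]
  have hp0 : p ≠ 0 := by
    rintro rfl
    apply h12
    simp [tri]
  obtain ⟨y, hy⟩ := hτ p hp0 hp
  have hpp : dcub τ p p = 0 := by rw [dcub_self, hp, mul_zero]
  have h21 : tri τ p e₂ e₁ = 1 := by rw [tri_swap_right, h12']
  set y' : V := (dcub τ p y)⁻¹ • y with hy'
  have hpy' : dcub τ p y' = 1 := by rw [hy', dcub_smul_right, inv_mul_cancel₀ hy]
  clear_value y'
  -- The correction of y' by e₁ and e₂ removes the monomials x₀x₁x₃ and x₀x₂x₃.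
  set e₃ : V := y' + (- tri τ p e₁ y') • e₂ + (- tri τ p e₂ y') • e₁ with he₃
  have h3 : dcub τ p e₃ = 1 := by
    rw [he₃, dcub_add_right, dcub_add_right, dcub_smul_right, dcub_smul_right, h1, h2, hpy']; ring
  have h13 : tri τ p e₁ e₃ = 0 := by
    rw [he₃, tri_add_right, tri_add_right, tri_smul_right, tri_smul_right, tri_self_right, h12',
      h1']; ring
  have h23 : tri τ p e₂ e₃ = 0 := by
    rw [he₃, tri_add_right, tri_add_right, tri_smul_right, tri_smul_right, tri_self_right, h21,
      h2']; ring
  clear_value e₃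
  have hli : LinearIndependent k ![p, e₁, e₂, e₃] := by
    rw [Fintype.linearIndependent_iff]
    intro g hg
    simp only [Fin.sum_univ_four, Matrix.cons_val_zero, Matrix.cons_val_one, Matrix.cons_val] at hg
    have a3 := congrArg (dcub τ p) hg
    have a2 := congrArg (tri τ p e₁) hg
    have a1 := congrArg (tri τ p e₂) hg
    have z : ∀ x y, tri τ x y 0 = 0 := fun x y => by simp [tri]
    simp only [dcub_add_right, dcub_smul_right, dcub_zero_right, hpp, h1, h2, h3, mul_zero, zero_add,
      mul_one] at a3
    simp only [tri_add_right, tri_smul_right, z, tri_self_mid, tri_self_right, h1, h1', h12', h13,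
      mul_zero, zero_add, add_zero, mul_one] at a2
    simp only [tri_add_right, tri_smul_right, z, tri_self_mid, tri_self_right, h2, h2', h21, h23,
      mul_zero, zero_add, add_zero, mul_one] at a1
    have a0 : g 0 = 0 := by
      rw [a1, a2, a3] at hg
      simpa [hp0] using hg
    intro i
    fin_cases i <;> assumption
  have hsp : ∀ x : V, dcub τ x p = 0 → dcub τ x e₁ = 0 → dcub τ x e₂ = 0 → dcub τ x e₃ = 0 →
      ∀ y, dcub τ x y = 0 := by
    intro x x0 x1 x2 x3 y
    have htop := hli.span_eq_top_of_card_eq_finrank (by rw [hV]; rfl)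
    have hle : Submodule.span k (Set.range ![p, e₁, e₂, e₃]) ≤ LinearMap.ker (dcubLin τ x) := by
      rw [Submodule.span_le]
      rintro _ ⟨i, rfl⟩
      fin_cases i <;> assumption
    exact hle (htop ▸ Submodule.mem_top)
  -- If the cubic vanishes at e, the line through p and e lies on the surface. Were the inequality
  -- to fail, the point e - (dcub τ e e') p of this line would be singular.
  have key : ∀ e e' : V, dcub τ p e = 0 → dcub τ e p = 0 → dcub τ p e' = 0 → tri τ p e e' = 1 →
      tri τ p e e₃ = 0 → e ≠ 0 →
      (∀ x : V, dcub τ x p = 0 → dcub τ x e = 0 → dcub τ x e' = 0 → dcub τ x e₃ = 0 →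
      ∀ y, dcub τ x y = 0) →
      cub τ e = 0 → dcub τ e e' ^ 2 + dcub τ e e₃ ≠ 0 := by
    intro e e' pe ep pe' pee' pee3 he hs ce hcon
    have ee : dcub τ e e = 0 := by rw [dcub_self, ce, mul_zero]
    have epe' : tri τ e p e' = 1 := by rw [tri_swap_left, pee']
    have epe3 : tri τ e p e₃ = 0 := by rw [tri_swap_left, pee3]
    obtain ⟨y, hy⟩ := hτ (e + (- dcub τ e e') • p) (by
      intro h
      have := congrArg (fun x => tri τ x p e') h
      simp only [tri_add_left, tri_smul_left, tri_self_left, pe', epe'] at this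
      simp [tri] at this) (by
      rw [cub_add, cub_smul, dcub_smul_left, dcub_smul_right, ce, hp, pe, ep]; ring)
    refine hy (hs _ ?_ ?_ ?_ ?_ y)
    · rw [dcub_add_left, dcub_smul_left, tri_smul_mid, tri_self_right, pe, ep, hpp]; ring
    · rw [dcub_add_left, dcub_smul_left, tri_smul_mid, tri_self_mid, pe, ep, ee]; ring
    · rw [dcub_add_left, dcub_smul_left, tri_smul_mid, epe', pe']; ring
    · rw [dcub_add_left, dcub_smul_left, tri_smul_mid, epe3, h3]; linear_combination hcon
  refine exists_isNodalTriple_of_normal_position hp h1 h2 h3 h1' h2' h12' h13 h23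
    (key e₁ e₂ h1 h1' h2 h12' h13 (hli.ne_zero 1) hsp)
    (key e₂ e₁ h2 h2' h1 h21 h23 (hli.ne_zero 2) fun x x0 x1 x2 => hsp x x0 x2 x1)

end GoodPoint

end CubicSRC

end

/-! ### Lang's theorem for semilinear maps. -/

noncomputable section

namespace CubicSRC

/-! ### Fixed vectors of semilinear maps -/

section Lang

open Polynomial

variable {k : Type*} [Field k] {σ : k →+* k} {q : ℕ}

/-- The recursion for the coordinates of a fixed vector in a cyclic space. -/
def cyclicPoly (q : ℕ) (c : ℕ → k) : ℕ → k[X]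
  | 0 => C (c 0) * X ^ q
  | i + 1 => cyclicPoly q c i ^ q + C (c (i + 1)) * X ^ q

theorem pow_dvd_cyclicPoly (hq : 1 < q) (c : ℕ → k) (i : ℕ) : X ^ q ∣ cyclicPoly q c i := by
  induction i with
  | zero => exact dvd_mul_left _ _
  | succ i ih => exact dvd_add (ih.trans (dvd_pow_self _ (by omega))) (dvd_mul_left _ _)

/-- The q-th power of the previous polynomial is divisible by X ^ (q + 1), so c (i + 1) is the
coefficient of X ^ q and must vanish; induction handles the rest. -/
theorem eq_zero_of_cyclicPoly_eq_zero (hq : 1 < q) (c : ℕ → k) {i : ℕ}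
    (h : cyclicPoly q c i = 0) : ∀ j ≤ i, c j = 0 := by
  induction i with
  | zero =>
    intro j hj
    obtain rfl : j = 0 := by omega
    simpa [cyclicPoly] using h
  | succ i ih =>
    rw [cyclicPoly] at h
    have h1 : X ^ (q + 1) ∣ C (c (i + 1)) * X ^ q := by
      have h2 : X ^ (q + 1) ∣ cyclicPoly q c i ^ q := by
        refine dvd_trans ?_ (pow_dvd_pow_of_dvd (pow_dvd_cyclicPoly hq c i) q)
        rw [← pow_mul]
        exact pow_dvd_pow _ (by nlinarith)
      exact (dvd_add_right h2).mp (h ▸ dvd_zero _)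
    rw [X_pow_dvd_iff] at h1
    have hc : c (i + 1) = 0 := by simpa using h1 q (by omega)
    rw [hc, C_0, zero_mul, add_zero] at h
    have h3 := ih (eq_zero_of_pow_eq_zero h)
    intro j hj
    rcases Nat.lt_or_ge i j with hij | hij
    · obtain rfl : j = i + 1 := by omega
      exact hc
    · exact h3 j hij

theorem exists_ne_zero_eval_cyclicPoly [IsAlgClosed k] (hq : 1 < q) (c : ℕ → k) {i : ℕ}
    (h : cyclicPoly q c i ≠ 0) : ∃ t, t ≠ 0 ∧ (cyclicPoly q c i).eval t = t := by
  obtain ⟨f, hf⟩ := pow_dvd_cyclicPoly hq c i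
  have hf0 : f ≠ 0 := by rintro rfl; exact h (by rw [hf, mul_zero])
  have hdeg : (X ^ (q - 1) * f - 1).degree ≠ 0 := by
    have h1 : 0 < (X ^ (q - 1) * f).degree := by
      rw [← natDegree_pos_iff_degree_pos, natDegree_mul (pow_ne_zero _ X_ne_zero) hf0,
        natDegree_X_pow]
      omega
    rw [degree_sub_eq_left_of_degree_lt (degree_one_le.trans_lt h1)]
    exact h1.ne'
  obtain ⟨t, ht⟩ := IsAlgClosed.exists_root _ hdeg
  rw [IsRoot, eval_sub, eval_mul, eval_pow, eval_X, eval_one, sub_eq_zero] at ht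
  refine ⟨t, ?_, ?_⟩
  · rintro rfl
    rw [zero_pow (by omega), zero_mul] at ht
    exact zero_ne_one ht
  · obtain ⟨q, rfl⟩ : ∃ r, q = r + 1 := ⟨q - 1, by omega⟩
    rw [hf, eval_mul, eval_pow, eval_X, pow_succ, mul_right_comm]
    rw [Nat.add_sub_cancel] at ht
    rw [ht, one_mul]

variable [IsAlgClosed k] {V : Type*} [AddCommGroup V] [Module k V] [FiniteDimensional k V]

/-- In the cyclic space spanned by v_i = ψ^i(v₀), with first relation v_(s+1) = ∑ c_i v_i, the
vector ∑ t_i v_i is fixed exactly when t_0 = c_0 t_s^q and t_(i+1) = t_i^q + c_(i+1) t_s^q. The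
recursion expresses every t_i through t = t_s, and one nonzero solution of the last equation is
needed. -/
theorem exists_ne_zero_fixed [Nontrivial V] (hq : 1 < q) (hσ : ∀ t, σ t = t ^ q) (ψ : V →ₛₗ[σ] V)
    (hψ : Function.Injective ψ) : ∃ v, v ≠ 0 ∧ ψ v = v := by
  classical
  obtain ⟨v₀, hv₀⟩ := exists_ne (0 : V)
  let v : ℕ → V := fun i => ψ^[i] v₀
  have hvs : ∀ i, ψ (v i) = v (i + 1) := fun i => (Function.iterate_succ_apply' ψ i v₀).symm
  have hv0 : ∀ i, v i ≠ 0 := by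
    intro i
    induction i with
    | zero => exact hv₀
    | succ i ih => rw [← hvs]; exact fun h => ih (hψ (h.trans (map_zero ψ).symm))
  have hex : ∃ r, ¬ LinearIndependent k fun i : Fin r => v i := by
    refine ⟨Module.finrank k V + 1, fun h => ?_⟩
    have := h.fintype_card_le_finrank
    rw [Fintype.card_fin] at this
    omega
  obtain ⟨r, hr⟩ : ∃ r, Nat.find hex = r + 1 := by
    refine Nat.exists_eq_succ_of_ne_zero fun h => ?_
    have := Nat.find_spec hex
    rw [h] at this
    exact this (linearIndependent_empty_type)
  have hli : LinearIndependent k fun i : Fin r => v i := by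
    have := Nat.find_min hex (m := r) (by omega)
    exact not_not.mp this
  have hmem : v r ∈ Submodule.span k (Set.range fun i : Fin r => v i) := by
    by_contra hcon
    have := Nat.find_spec hex
    rw [hr] at this
    apply this
    rw [linearIndependent_finSucc']
    exact ⟨hli, hcon⟩
  obtain ⟨c, hc⟩ := (Submodule.mem_span_range_iff_exists_fun k).mp hmem
  have hr0 : r ≠ 0 := by
    rintro rfl
    rw [Fin.sum_univ_zero] at hc
    exact hv0 0 hc.symm
  obtain ⟨s, rfl⟩ := Nat.exists_eq_succ_of_ne_zero hr0
  let c' : ℕ → k := fun i => if h : i < s + 1 then c ⟨i, h⟩ else 0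
  have hc' : ∑ i ∈ Finset.range (s + 1), c' i • v i = v (s + 1) := by
    rw [Finset.sum_range, ← hc]
    exact Finset.sum_congr rfl fun i _ => by simp only [c', dif_pos i.2]
  -- If this polynomial vanished, all c_i would be zero and so would v_(s+1), contrary to
  -- injectivity of ψ.
  have hP : cyclicPoly q c' s ≠ 0 := fun h => by
    have h1 := eq_zero_of_cyclicPoly_eq_zero hq c' h
    rw [Finset.sum_eq_zero fun i hi => by
      rw [h1 i (by rw [Finset.mem_range] at hi; omega), zero_smul]] at hc'
    exact hv0 _ hc'.symm
  obtain ⟨t, ht0, ht⟩ := exists_ne_zero_eval_cyclicPoly hq c' hP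
  refine ⟨∑ i ∈ Finset.range (s + 1), (cyclicPoly q c' i).eval t • v i, ?_, ?_⟩
  · intro h
    rw [Finset.sum_range] at h
    have := Fintype.linearIndependent_iff.mp hli _ h ⟨s, by omega⟩
    exact ht0 (ht.symm.trans this)
  · have h1 : ψ (∑ i ∈ Finset.range (s + 1), (cyclicPoly q c' i).eval t • v i) =
        ∑ i ∈ Finset.range (s + 1), (cyclicPoly q c' i).eval t ^ q • v (i + 1) := by
      rw [map_sum]
      exact Finset.sum_congr rfl fun i _ => by rw [LinearMap.map_smulₛₗ, hσ, hvs]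
    rw [h1, Finset.sum_range_succ, ht, ← hc', Finset.smul_sum, Finset.sum_range_succ',
      Finset.sum_range_succ', ← add_assoc, ← Finset.sum_add_distrib]
    congr 1
    · refine Finset.sum_congr rfl fun i _ => ?_
      rw [smul_smul, ← add_smul, cyclicPoly]
      simp only [eval_add, eval_mul, eval_pow, eval_C, eval_X]
      rw [mul_comm]
    · rw [smul_smul, cyclicPoly, eval_mul, eval_pow, eval_C, eval_X, mul_comm]

/-- The fixed vectors of an injective `q`-semilinear map span. -/
theorem span_fixed_eq_top (hq : 1 < q) (hσ : ∀ t, σ t = t ^ q) (ψ : V →ₛₗ[σ] V)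
    (hψ : Function.Injective ψ) : Submodule.span k {v | ψ v = v} = ⊤ := by
  set U := Submodule.span k {v | ψ v = v} with hU
  by_contra hne
  have hUψ : U ≤ U.comap ψ := by
    rw [hU, Submodule.span_le]
    intro v hv
    have hv' : ψ v = v := hv
    change ψ v ∈ Submodule.span k {v | ψ v = v}
    rw [hv']
    exact Submodule.subset_span hv
  -- Since ψ maps U onto U, it induces an injective map on V / U, to which `exists_ne_zero_fixed`
  -- applies.
  have hsurj : ∀ u ∈ U, ∃ u' ∈ U, ψ u' = u := by
    intro u hu
    induction hu using Submodule.span_induction with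
    | mem v hv => exact ⟨v, Submodule.subset_span hv, hv⟩
    | zero => exact ⟨0, U.zero_mem, map_zero _⟩
    | add x y _ _ hx hy =>
      obtain ⟨x', hx', rfl⟩ := hx
      obtain ⟨y', hy', rfl⟩ := hy
      exact ⟨x' + y', U.add_mem hx' hy', map_add _ _ _⟩
    | smul a x _ hx =>
      obtain ⟨x', hx', rfl⟩ := hx
      obtain ⟨b, rfl⟩ := IsAlgClosed.exists_pow_nat_eq a (n := q) (by omega)
      exact ⟨b • x', U.smul_mem _ hx', by rw [LinearMap.map_smulₛₗ, hσ]⟩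
  -- On a multiple t x of a fixed vector this is the Artin–Schreier equation t^q - t = a. It allows
  -- a fixed class modulo U to be lifted to a fixed vector.
  have hsolve : ∀ u ∈ U, ∃ u' ∈ U, ψ u' - u' = u := by
    intro u hu
    induction hu using Submodule.closure_induction with
    | zero => exact ⟨0, U.zero_mem, by simp⟩
    | add x y _ _ hx hy =>
      obtain ⟨x', hx', rfl⟩ := hx
      obtain ⟨y', hy', rfl⟩ := hy
      exact ⟨x' + y', U.add_mem hx' hy', by rw [map_add]; abel⟩
    | smul_mem a x hx =>
      have hx' : ψ x = x := hx
      obtain ⟨t, ht⟩ := IsAlgClosed.exists_root (X ^ q - X - C a) (by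
        have h1 : (X ^ q - X - C a : k[X]).degree = q := by
          rw [sub_sub]
          refine (degree_sub_eq_left_of_degree_lt ?_).trans (degree_X_pow q)
          rw [degree_X_add_C, degree_X_pow]
          exact_mod_cast hq
        rw [h1]
        exact_mod_cast (by omega : q ≠ 0))
      refine ⟨t • x, U.smul_mem _ (Submodule.subset_span hx), ?_⟩
      rw [LinearMap.map_smulₛₗ, hσ, hx', ← sub_smul]
      simp only [IsRoot, eval_sub, eval_pow, eval_X, eval_C] at ht
      rw [sub_eq_zero.mp ht]
  have : Nontrivial (V ⧸ U) := Submodule.Quotient.nontrivial_iff.mpr hne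
  obtain ⟨v, hv0, hv⟩ := exists_ne_zero_fixed hq hσ (U.mapQ U ψ hUψ) (by
    rw [injective_iff_map_eq_zero]
    intro x hx
    obtain ⟨x, rfl⟩ := Submodule.Quotient.mk_surjective U x
    rw [Submodule.mapQ_apply, Submodule.Quotient.mk_eq_zero] at hx
    obtain ⟨u, hu, hux⟩ := hsurj _ hx
    rw [Submodule.Quotient.mk_eq_zero, ← hψ hux]
    exact hu)
  obtain ⟨v, rfl⟩ := Submodule.Quotient.mk_surjective U v
  rw [Submodule.mapQ_apply, Submodule.Quotient.eq] at hv
  obtain ⟨u, hu, hu'⟩ := hsolve _ hv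
  have hfix : ψ (v - u) = v - u := by
    rw [map_sub, sub_eq_sub_iff_sub_eq_sub, hu']
  refine hv0 ((Submodule.Quotient.mk_eq_zero U).mpr ?_)
  have := U.add_mem (Submodule.subset_span hfix : v - u ∈ U) hu
  rwa [sub_add_cancel] at this

end Lang

end CubicSRC

end

/-! ### Surfaces without nodal triples in characteristic two. -/

noncomputable section

namespace CubicSRC

section Degenerate

variable {k V : Type*} [Field k] [IsAlgClosed k] [AddCommGroup V] [Module k V] {τ : Trilin k V}

theorem exists_quadratic_root {a : k} (ha : a ≠ 0) (b c : k) :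
    ∃ t, a * t ^ 2 + b * t + c = 0 := by
  obtain ⟨t, ht⟩ := IsAlgClosed.exists_root (Polynomial.C a * Polynomial.X ^ 2 +
    Polynomial.C b * Polynomial.X + Polynomial.C c) (by
      rw [Polynomial.degree_quadratic ha]; norm_num)
  exact ⟨t, by simpa using ht⟩

/-- Without nodal triples, the second fundamental form is degenerate everywhere. -/
theorem IsNonsingular.tri_sq_eq (hV : Module.finrank k V = 4) (hτ : IsNonsingular τ)
    (hno : ¬ ∃ a b c, IsNodalTriple τ a b c) {p y z : V} (hp : cub τ p = 0)
    (hy : dcub τ p y = 0) (hz : dcub τ p z = 0) :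
    tri τ p y z ^ 2 = 4 * dcub τ y p * dcub τ z p := by
  by_contra hne
  refine hno ?_
  -- Put q(y) = dcub τ y p, with polar form B = tri τ p. A nonzero discriminant B(y,z)² - 4 q(y)
  -- q(z) gives two isotropic vectors e₁, e₂ in the span of y and z with B(e₁,e₂) ≠ 0, which is a
  -- nondegenerate second fundamental form.
  by_cases hA : dcub τ y p = 0
  · refine hτ.exists_isNodalTriple hV (e₁ := y) (e₂ := (-dcub τ z p) • y + tri τ p y z • z)
      hp hy ?_ hA ?_ ?_
    · rw [dcub_add_right, dcub_smul_right, dcub_smul_right, hy, hz]; ring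
    · have h1 : tri τ y z p = tri τ p y z := by rw [tri_swap_right, tri_swap_left]
      rw [dcub_comb_two, hA, h1]; ring
    · rw [tri_add_right, tri_smul_right, tri_smul_right, tri_self_right, hA]
      intro h
      rw [hA] at hne
      exact hne (by linear_combination h)
  · obtain ⟨r, hr⟩ := exists_quadratic_root hA (tri τ p y z) (dcub τ z p)
    set s := -(tri τ p y z / dcub τ y p) - r with hs
    have hs1 : dcub τ y p * (r + s) = - tri τ p y z := by rw [hs]; field_simp; ring
    have h1 : tri τ y z p = tri τ p y z := by rw [tri_swap_right, tri_swap_left]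
    have h1' : tri τ p z y = tri τ p y z := tri_swap_right _ _ _ _
    refine hτ.exists_isNodalTriple hV (e₁ := r • y + z) (e₂ := s • y + z) hp ?_ ?_ ?_ ?_ ?_
    · rw [dcub_add_right, dcub_smul_right, hy, hz]; ring
    · rw [dcub_add_right, dcub_smul_right, hy, hz]; ring
    · rw [dcub_add_left, dcub_smul_left, tri_smul_left, h1]; linear_combination hr
    · rw [dcub_add_left, dcub_smul_left, tri_smul_left, h1]
      linear_combination hr + (s - r) * hs1
    · rw [tri_add_right, tri_add_mid, tri_add_mid, tri_smul_mid, tri_smul_right, tri_smul_mid,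
        tri_smul_right, tri_self_right, tri_self_right, h1']
      intro h
      apply hne
      have h3 : dcub τ y p * (r * s) = dcub τ z p := by linear_combination r * hs1 - hr
      linear_combination (-dcub τ y p) * h + 2 * dcub τ y p * h3 + tri τ p y z * hs1

end Degenerate

section Coordinates

variable {k : Type*} [Field k] {m : ℕ} (τ : Trilin k (Fin m → k))

theorem tri_eq_sum (x y z : Fin m → k) :
    tri τ y z x = ∑ l, x l * tri τ y z (Pi.single l 1) :=
  map_eq_sum_single (triLin τ y z) x

theorem dcub_eq_sum (x y : Fin m → k) : dcub τ y x = ∑ l, x l * dcub τ y (Pi.single l 1) :=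
  map_eq_sum_single (dcubLin τ y) x

end Coordinates

section CharTwo

variable {k : Type*} [Field k] [IsAlgClosed k] {τ : Trilin k (Fin 4 → k)}

/-- A quadratic derivative of a nonsingular cubic form that vanishes on the hypersurface is
zero. -/
theorem IsNonsingular.dcub_eq_zero_of_forall {m : ℕ} {τ : Trilin k (Fin m → k)} (hm : 2 < m)
    (hτ : IsNonsingular τ) {w : Fin m → k} (h : ∀ x, cub τ x = 0 → dcub τ x w = 0)
    (x : Fin m → k) : dcub τ x w = 0 := by
  have : Infinite k := IsAlgClosed.instInfinite
  obtain ⟨l, hl, hdl⟩ := hτ.exists_eq_mul hm (IsPolyFun.dcub τ w) h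
  obtain ⟨f, hf⟩ := hl.exists_polynomial 0 x
  -- Along t x the factorization compares a term of degree 2 with t³ times a polynomial; cancelling
  -- t² and setting t = 0 leaves dcub τ x w = 0.
  have h1 := eq_zero_of_forall_eval_ne_zero
    (p := Polynomial.C (dcub τ x w) - Polynomial.X * Polynomial.C (cub τ x) * f) fun t ht => by
      have := hdl (t • x)
      rw [dcub_smul_left, cub_smul] at this
      simp only [Polynomial.eval_sub, Polynomial.eval_mul, Polynomial.eval_C, Polynomial.eval_X, hf,
        zero_add]
      refine mul_left_cancel₀ (pow_ne_zero 2 ht) ?_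
      linear_combination this
  have h2 := congrArg (Polynomial.eval 0) h1
  simpa using h2

/-- In characteristic two the polarization of a quaternary cubic form is alternating; if it is
nonzero, its kernel is a line. -/
theorem exists_tri_kernel {k : Type*} [Field k] {τ : Trilin k (Fin 4 → k)} (h2 : (2 : k) = 0)
    {x y z : Fin 4 → k} (hxyz : tri τ x y z ≠ 0) :
    ∃ w, w ≠ 0 ∧ (∀ x y, tri τ x y w = 0) ∧
      ∀ p, (∀ x y, tri τ x y p = 0) → ∃ c : k, p = c • w := by
  let e : Fin 4 → Fin 4 → k := fun i => Pi.single i 1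
  have hm : ∀ x y, tri τ x y x = 0 := fun x y => by rw [tri_self_mid, h2, zero_mul]
  have hr : ∀ x y, tri τ x y y = 0 := fun x y => by rw [tri_self_right, h2, zero_mul]
  have hl : ∀ x y, tri τ x x y = 0 := fun x y => by rw [tri_self_left, h2, zero_mul]
  have hs : ∀ x y p : Fin 4 → k, tri τ x y p = p 0 * tri τ x y (e 0) + p 1 * tri τ x y (e 1) +
      p 2 * tri τ x y (e 2) + p 3 * tri τ x y (e 3) := fun x y p => by
    rw [tri_eq_sum, Fin.sum_univ_four]
  set A := tri τ (e 1) (e 2) (e 3) with hA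
  set B := tri τ (e 0) (e 2) (e 3) with hB
  set C := tri τ (e 0) (e 1) (e 3) with hC
  set D := tri τ (e 0) (e 1) (e 2) with hD
  have s01 : ∀ p, tri τ (e 0) (e 1) p = p 2 * D + p 3 * C := fun p => by
    rw [hs, hm, hr]; ring
  have s02 : ∀ p, tri τ (e 0) (e 2) p = p 1 * D + p 3 * B := fun p => by
    rw [hs, hm, hr, tri_swap_right τ (e 0) (e 2) (e 1)]; ring
  have s03 : ∀ p, tri τ (e 0) (e 3) p = p 1 * C + p 2 * B := fun p => by
    rw [hs, hm, hr, tri_swap_right τ (e 0) (e 3) (e 1), tri_swap_right τ (e 0) (e 3) (e 2)]; ring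
  have s12 : ∀ p, tri τ (e 1) (e 2) p = p 0 * D + p 3 * A := fun p => by
    rw [hs, hm, hr, tri_swap_right τ (e 1) (e 2) (e 0), tri_swap_left τ (e 1) (e 0) (e 2)]; ring
  have s13 : ∀ p, tri τ (e 1) (e 3) p = p 0 * C + p 2 * A := fun p => by
    rw [hs, hm, hr, tri_swap_right τ (e 1) (e 3) (e 0), tri_swap_left τ (e 1) (e 0) (e 3),
      tri_swap_right τ (e 1) (e 3) (e 2)]; ring
  have s23 : ∀ p, tri τ (e 2) (e 3) p = p 0 * B + p 1 * A := fun p => by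
    rw [hs, hm, hr, tri_swap_right τ (e 2) (e 3) (e 0), tri_swap_left τ (e 2) (e 0) (e 3),
      tri_swap_right τ (e 2) (e 3) (e 1), tri_swap_left τ (e 2) (e 1) (e 3)]; ring
  have hker : ∀ p, p 2 * D + p 3 * C = 0 → p 1 * D + p 3 * B = 0 → p 1 * C + p 2 * B = 0 →
      p 0 * D + p 3 * A = 0 → p 0 * C + p 2 * A = 0 → p 0 * B + p 1 * A = 0 →
      ∀ x y, tri τ x y p = 0 := by
    intro p a1 a2 a3 a4 a5 a6 x y
    rw [← s01] at a1
    rw [← s02] at a2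
    rw [← s03] at a3
    rw [← s12] at a4
    rw [← s13] at a5
    rw [← s23] at a6
    have hij : ∀ i j, tri τ p (e i) (e j) = 0 := by
      intro i j
      rw [tri_swap_left, tri_swap_right]
      fin_cases i <;> fin_cases j
      exacts [hl _ _, a1, a2, a3, by rw [tri_swap_left]; exact a1, hl _ _, a4, a5,
        by rw [tri_swap_left]; exact a2, by rw [tri_swap_left]; exact a4, hl _ _, a6,
        by rw [tri_swap_left]; exact a3, by rw [tri_swap_left]; exact a5,
        by rw [tri_swap_left]; exact a6, hl _ _]
    have hj : ∀ j, tri τ p (e j) y = 0 := fun j => by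
      rw [hs, hij, hij, hij, hij]; ring
    rw [tri_swap_right, tri_swap_left, tri_swap_right, hs]
    simp only [tri_swap_right τ p y, hj]; ring
  -- An alternating trilinear form in four variables is the contraction of the volume form with a
  -- vector. Its coordinates are the values on triples of basis vectors, and the signs disappear in
  -- characteristic 2.
  let w : Fin 4 → k := ![A, B, C, D]
  have w0 : w 0 = A := rfl
  have w1 : w 1 = B := rfl
  have w2 : w 2 = C := rfl
  have w3 : w 3 = D := rfl
  have hw : w ≠ 0 := by
    intro h
    have hA0 : A = 0 := congrFun h 0
    have hB0 : B = 0 := congrFun h 1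
    have hC0 : C = 0 := congrFun h 2
    have hD0 : D = 0 := congrFun h 3
    refine hxyz (hker z ?_ ?_ ?_ ?_ ?_ ?_ x y) <;> simp only [hA0, hB0, hC0, hD0, mul_zero, add_zero]
  refine ⟨w, hw, ?_, fun p hp => ?_⟩
  · refine hker w ?_ ?_ ?_ ?_ ?_ ?_ <;> simp only [w0, w1, w2, w3]
    · linear_combination C * D * h2
    · linear_combination B * D * h2
    · linear_combination B * C * h2
    · linear_combination A * D * h2
    · linear_combination A * C * h2
    · linear_combination A * B * h2
  · have r23 : p 2 * w 3 = p 3 * w 2 := by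
      rw [w2, w3]; linear_combination (s01 p).symm.trans (hp _ _) - p 3 * C * h2
    have r13 : p 1 * w 3 = p 3 * w 1 := by
      rw [w1, w3]; linear_combination (s02 p).symm.trans (hp _ _) - p 3 * B * h2
    have r12 : p 1 * w 2 = p 2 * w 1 := by
      rw [w1, w2]; linear_combination (s03 p).symm.trans (hp _ _) - p 2 * B * h2
    have r03 : p 0 * w 3 = p 3 * w 0 := by
      rw [w0, w3]; linear_combination (s12 p).symm.trans (hp _ _) - p 3 * A * h2
    have r02 : p 0 * w 2 = p 2 * w 0 := by
      rw [w0, w2]; linear_combination (s13 p).symm.trans (hp _ _) - p 2 * A * h2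
    have r01 : p 0 * w 1 = p 1 * w 0 := by
      rw [w0, w1]; linear_combination (s23 p).symm.trans (hp _ _) - p 1 * A * h2
    have hr : ∀ i j, p i * w j = p j * w i := by
      intro i j
      fin_cases i <;> fin_cases j
      exacts [rfl, r01, r02, r03, r01.symm, rfl, r12, r13, r02.symm, r12.symm, rfl, r23, r03.symm,
        r13.symm, r23.symm, rfl]
    obtain ⟨j, hj⟩ := Function.ne_iff.mp hw
    refine ⟨p j / w j, funext fun i => ?_⟩
    rw [Pi.zero_apply] at hj
    rw [Pi.smul_apply, smul_eq_mul, div_mul_eq_mul_div, eq_div_iff hj, hr]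

/-- If the alternating form tri were nonzero, with kernel spanned by w, the derivative of the cubic
in direction w would vanish on the whole surface and hence identically. The other three partial
derivatives then have a common zero, which is a singular point. -/
theorem IsNonsingular.tri_eq_zero (h2 : (2 : k) = 0) (hτ : IsNonsingular τ)
    (hno : ¬ ∃ a b c, IsNodalTriple τ a b c) (x y z : Fin 4 → k) : tri τ x y z = 0 := by
  by_contra hxyz
  obtain ⟨w, hw, hwk, hk⟩ := exists_tri_kernel h2 hxyz
  have h3 : ∀ x : Fin 4 → k, dcub τ x x = 0 → cub τ x = 0 := fun x h => by
    rw [dcub_self] at h; linear_combination h - cub τ x * h2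
  -- If w is transversal to the tangent space at p, degeneracy on the tangent space and w ∈ ker give
  -- tri τ p = 0, so p is a multiple of w. But dcub τ p p = 3 cub τ p = 0 then contradicts
  -- transversality.
  have hDw : ∀ p, cub τ p = 0 → dcub τ p w = 0 := by
    intro p hp
    by_contra hpw
    obtain ⟨c, rfl⟩ := hk p fun y z => by
      have hT : ∀ y, dcub τ p (y - (dcub τ p y / dcub τ p w) • w) = 0 := fun y => by
        rw [dcub_sub_right, dcub_smul_right, div_mul_cancel₀ _ hpw, sub_self]
      have h4 := hτ.tri_sq_eq (Module.finrank_fin_fun k) hno hp (hT y) (hT z)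
      have h5 : (4 : k) = 0 := by linear_combination 2 * h2
      rw [h5, zero_mul, zero_mul, sq_eq_zero_iff] at h4
      have hw2 : ∀ x y, tri τ x w y = 0 := fun x y => by rw [tri_swap_right]; exact hwk x y
      rw [sub_eq_add_neg, sub_eq_add_neg, ← neg_smul, ← neg_smul, tri_add_mid, tri_add_right,
        tri_smul_mid, tri_smul_right, hwk, hw2, mul_zero, mul_zero, add_zero, add_zero] at h4
      rw [tri_swap_right, tri_swap_left]
      exact h4
    by_cases hc : c = 0
    · rw [hc, zero_smul, dcub_zero_left] at hpw
      exact hpw rfl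
    · rw [cub_smul] at hp
      have := (mul_eq_zero.mp hp).resolve_left (pow_ne_zero 3 hc)
      rw [dcub_smul_left, dcub_self, this, mul_zero, mul_zero] at hpw
      exact hpw rfl
  have hD := hτ.dcub_eq_zero_of_forall (by norm_num) hDw
  obtain ⟨j, hj⟩ := Function.ne_iff.mp hw
  rw [Pi.zero_apply] at hj
  obtain ⟨p, hp, hp0⟩ := exists_ne_zero_common_zero (k := k) (r := 3) (m := 4) (by norm_num)
    (f := fun i x => dcub τ x (Pi.single (j.succAbove i) 1)) (fun i => IsPolyFun.dcub τ _)
    (fun i => dcub_zero_left τ _)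
  have hpj : dcub τ p (Pi.single j 1) = 0 := by
    have := hD p
    rw [dcub_eq_sum, Fin.sum_univ_succAbove _ j,
      Finset.sum_eq_zero fun i _ => by rw [hp0 i, mul_zero], add_zero] at this
    exact (mul_eq_zero.mp this).resolve_left hj
  have hpy : ∀ y, dcub τ p y = 0 := fun y => by
    rw [dcub_eq_sum, Fin.sum_univ_succAbove _ j, hpj,
      Finset.sum_eq_zero fun i _ => by rw [hp0 i, mul_zero], mul_zero, add_zero]
  obtain ⟨y, hy⟩ := hτ p hp (h3 p (hpy p))
  exact hy (hpy y)

end CharTwo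

end CubicSRC

end

noncomputable section

namespace CubicSRC

/-! ### Cubic forms with vanishing polarization in characteristic two -/

section Hermitian

variable {k : Type*} [Field k] {m : ℕ} {τ : Trilin k (Fin m → k)}

/-- With vanishing polarization, dcub is additive and Frobenius-semilinear in its first argument,
while it is linear in the second. -/
theorem dcub_eq_sum_sq [CharP k 2] (htri : ∀ x y z, tri τ x y z = 0) (y z : Fin m → k) :
    dcub τ y z = ∑ i, y i ^ 2 * dcub τ (Pi.single i 1) z := by
  let B : (Fin m → k) →ₛₗ[frobenius k 2] k :=
    { toFun := fun y => dcub τ y z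
      map_add' := fun x y => by rw [dcub_add_left, htri, add_zero]
      map_smul' := fun c x => by rw [dcub_smul_left, frobenius_def, smul_eq_mul] }
  have h : B y = ∑ i, y i ^ 2 * B (Pi.single i 1) := by
    conv_lhs => rw [pi_eq_sum_univ' y]
    rw [map_sum]
    exact Finset.sum_congr rfl fun i _ => by
      rw [LinearMap.map_smulₛₗ, frobenius_def, smul_eq_mul]
  exact h

theorem eq_zero_of_dcub_eq_zero (h2 : (2 : k) = 0) (hτ : IsNonsingular τ) {x : Fin m → k}
    (h : ∀ y, dcub τ x y = 0) : x = 0 := by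
  by_contra hx
  obtain ⟨y, hy⟩ := hτ x hx (by
    have := h x
    rw [dcub_self] at this
    linear_combination this - cub τ x * h2)
  exact hy (h y)

variable [IsAlgClosed k]

/-- The square of dcub τ x y is Frobenius-semilinear in y, hence of the form dcub τ y (ψ x) by
nondegeneracy. The map ψ is semilinear for t ↦ t⁴, and its fixed vectors carry a Hermitian form over
the field with four elements. -/
theorem exists_semilinear_adjoint [CharP k 2] (htri : ∀ x y z, tri τ x y z = 0)
    (hτ : IsNonsingular τ) :
    ∃ ψ : (Fin m → k) →ₛₗ[(frobenius k 2).comp (frobenius k 2)] (Fin m → k),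
      ∀ x y, dcub τ y (ψ x) = dcub τ x y ^ 2 := by
  have h2 : (2 : k) = 0 := CharTwo.two_eq_zero
  let M : Matrix (Fin m) (Fin m) k := Matrix.of fun i j => dcub τ (Pi.single i 1) (Pi.single j 1)
  have hM : ∀ z, M.mulVec z = fun i => dcub τ (Pi.single i 1) z := fun z => funext fun i => by
    rw [dcub_eq_sum]
    simp only [Matrix.mulVec, dotProduct, M, Matrix.of_apply]
    exact Finset.sum_congr rfl fun j _ => mul_comm _ _
  have hMu : IsUnit M := by
    rw [← Matrix.vecMul_injective_iff_isUnit]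
    have : Function.Injective (M.vecMulLinear) := by
      rw [injective_iff_map_eq_zero]
      intro c hc
      -- For a left kernel vector c, the derivative of the cubic at the vector of square roots of
      -- the c_i vanishes in all directions.
      choose s hs using fun i => IsAlgClosed.exists_pow_nat_eq (c i) (n := 2) (by norm_num)
      have h0 : s = 0 := eq_zero_of_dcub_eq_zero h2 hτ fun y => by
        rw [dcub_eq_sum]
        refine Finset.sum_eq_zero fun j _ => ?_
        rw [dcub_eq_sum_sq htri]
        have := congrFun hc j
        simp only [Matrix.vecMulLinear_apply, Matrix.vecMul, dotProduct, M, Matrix.of_apply,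
          Pi.zero_apply] at this
        simp only [hs, this, mul_zero]
      funext i
      rw [← hs, h0]
      simp
    exact this
  let ψ : (Fin m → k) →ₛₗ[(frobenius k 2).comp (frobenius k 2)] (Fin m → k) :=
    { toFun := fun x => M⁻¹.mulVec fun i => dcub τ x (Pi.single i 1) ^ 2
      map_add' := fun x y => by
        rw [← Matrix.mulVec_add]
        congr 1
        funext i
        rw [dcub_add_left, htri, add_zero, CharTwo.add_sq]
        rfl
      map_smul' := fun c x => by
        rw [← Matrix.mulVec_smul]
        congr 1
        funext i
        rw [dcub_smul_left, Pi.smul_apply, smul_eq_mul, RingHom.comp_apply, frobenius_def,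
          frobenius_def]
        ring }
  refine ⟨ψ, fun x y => ?_⟩
  have h1 : M.mulVec (ψ x) = fun i => dcub τ x (Pi.single i 1) ^ 2 := by
    change M.mulVec (M⁻¹.mulVec _) = _
    rw [Matrix.mulVec_mulVec, Matrix.mul_nonsing_inv _ ((Matrix.isUnit_iff_isUnit_det M).mp hMu),
      Matrix.one_mulVec]
  rw [hM] at h1
  rw [dcub_eq_sum_sq htri, dcub_eq_sum τ y x, CharTwo.sum_sq]
  refine Finset.sum_congr rfl fun i _ => ?_
  rw [congrFun h1 i, mul_pow]

/-- A nonsingular cubic form with vanishing polarization has an orthonormal basis for its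
Frobenius-Hermitian derivative. -/
theorem exists_orthonormal [CharP k 2] (htri : ∀ x y z, tri τ x y z = 0)
    (hτ : IsNonsingular τ) {ω : k} (hω : ω ^ 2 + ω + 1 = 0) :
    ∃ f : Fin m → Fin m → k, ∀ i j, dcub τ (f i) (f j) = if i = j then 1 else 0 := by
  have h2 : (2 : k) = 0 := CharTwo.two_eq_zero
  obtain ⟨ψ, hψ⟩ := exists_semilinear_adjoint htri hτ
  have hadd : ∀ x x' y, dcub τ (x + x') y = dcub τ x y + dcub τ x' y := fun x x' y => by
    rw [dcub_add_left, htri, add_zero]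
  have hσ : ∀ t : k, (frobenius k 2).comp (frobenius k 2) t = t ^ 4 := fun t => by
    rw [RingHom.comp_apply, frobenius_def, frobenius_def]; ring
  have hinj : Function.Injective ψ := by
    rw [injective_iff_map_eq_zero]
    intro x hx
    refine eq_zero_of_dcub_eq_zero h2 hτ fun y => ?_
    have := hψ x y
    rw [hx, dcub_zero_right] at this
    exact sq_eq_zero_iff.mp this.symm
  have hspan := span_fixed_eq_top (by norm_num) hσ ψ hinj
  have hfix : ∀ {f}, ψ f = f → ∀ y, dcub τ y f = dcub τ f y ^ 2 := fun {f} hf y => by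
    rw [← hψ, hf]
  suffices H : ∀ r ≤ m, ∃ f : Fin r → Fin m → k, (∀ i, ψ (f i) = f i) ∧
      ∀ i j, dcub τ (f i) (f j) = if i = j then 1 else 0 by
    obtain ⟨f, -, hf⟩ := H m le_rfl
    exact ⟨f, hf⟩
  intro r
  induction r with
  | zero => exact fun _ => ⟨Fin.elim0, fun i => i.elim0, fun i => i.elim0⟩
  | succ r ih =>
    intro hr
    obtain ⟨f, hfψ, hff⟩ := ih (by omega)
    -- A Gram–Schmidt step: π projects off the vectors already found, and it preserves fixed vectors
    -- of ψ.
    let π : (Fin m → k) →ₗ[k] (Fin m → k) :=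
      LinearMap.id - ∑ i, (dcubLin τ (f i)).smulRight (f i)
    have hπ : ∀ x, π x = x - ∑ i, dcub τ (f i) x • f i := fun x => by
      simp [π, LinearMap.sum_apply]
    have hsum : ∀ x y, dcub τ y x = dcub τ y (π x) + ∑ i, dcub τ (f i) x * dcub τ y (f i) := by
      intro x y
      have : dcub τ y (∑ i, dcub τ (f i) x • f i) = ∑ i, dcub τ (f i) x * dcub τ y (f i) := by
        rw [← dcubLin_apply, map_sum]
        exact Finset.sum_congr rfl fun i _ => by rw [map_smul, dcubLin_apply, smul_eq_mul]
      rw [hπ, dcub_sub_right, this]; ring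
    have hfπ : ∀ j x, dcub τ (f j) (π x) = 0 := fun j x => by
      have := hsum x (f j)
      simp only [hff, mul_ite, mul_one, mul_zero, Finset.sum_ite_eq, Finset.mem_univ,
        if_true] at this
      linear_combination -this
    have hπf : ∀ j x, dcub τ (π x) (f j) = 0 := fun j x => by
      rw [hfix (hfψ j), hfπ]; ring
    have hπψ : ∀ x, ψ x = x → ψ (π x) = π x := by
      intro x hx
      rw [hπ, map_sub, hx, map_sum]
      congr 1
      refine Finset.sum_congr rfl fun i _ => ?_
      rw [LinearMap.map_smulₛₗ, hσ, hfψ]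
      have e1 := hfix hx (f i)
      have e2 := hfix (hfψ i) x
      congr 1
      rw [e2, ← pow_mul] at e1
      exact e1.symm
    -- Otherwise evaluating the cubic at π(x + y) and π(ω x + y) shows that dcub vanishes on
    -- projections of fixed vectors; ω x is again fixed because ω⁴ = ω. All fixed vectors would then
    -- lie in the span of the r < m vectors found so far.
    have hex : ∃ x, ψ x = x ∧ cub τ (π x) ≠ 0 := by
      by_contra! hcon
      have hω0 : ω ^ 4 = ω := by linear_combination (ω ^ 2 - ω) * hω
      have hzero : ∀ x y, ψ x = x → ψ y = y → dcub τ (π x) (π y) = 0 := by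
        intro x y hx hy
        have e1 := hcon (x + y) (by rw [map_add, hx, hy])
        have e2 := hcon (ω • x + y) (by rw [map_add, LinearMap.map_smulₛₗ, hσ, hω0, hx, hy])
        rw [map_add, cub_add, hcon x hx, hcon y hy] at e1
        rw [map_add, map_smul, cub_add, cub_smul, hcon x hx, hcon y hy, dcub_smul_left,
          dcub_smul_right] at e2
        linear_combination -e2 + ω * e1 + dcub τ (π x) (π y) * hω - ω * dcub τ (π x) (π y) * h2
      have hπ0 : ∀ x, ψ x = x → π x = 0 := by
        intro x hx
        refine eq_zero_of_dcub_eq_zero h2 hτ fun y => ?_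
        have hle : Submodule.span k {v | ψ v = v} ≤ LinearMap.ker (dcubLin τ (π x)) := by
          rw [Submodule.span_le]
          intro y hy
          change dcub τ (π x) y = 0
          rw [hsum, hzero x y hx hy, Finset.sum_eq_zero fun i _ => by rw [hπf, mul_zero], add_zero]
        exact hle (hspan ▸ Submodule.mem_top)
      have hle : Submodule.span k {v | ψ v = v} ≤ Submodule.span k (Set.range f) := by
        rw [Submodule.span_le]
        intro x hx
        have := hπ0 x hx
        rw [hπ, sub_eq_zero] at this
        rw [this]
        exact Submodule.sum_mem _ fun i _ =>
          Submodule.smul_mem _ _ (Submodule.subset_span ⟨i, rfl⟩)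
      rw [hspan, top_le_iff] at hle
      have h1 := finrank_range_le_card (R := k) f
      rw [Set.finrank, hle, finrank_top, Module.finrank_fin_fun, Fintype.card_fin] at h1
      omega
    obtain ⟨x, hx, hx0⟩ := hex
    -- The Hermitian identity makes this value equal to its own square, so being nonzero it is 1 and
    -- no rescaling is needed.
    have hxx : dcub τ (π x) (π x) = 1 := by
      have e1 := hfix (hπψ x hx) (π x)
      have e2 : dcub τ (π x) (π x) ≠ 0 := by
        rw [dcub_self]
        intro h
        exact hx0 (by linear_combination h - cub τ (π x) * h2)
      exact mul_left_cancel₀ e2 (by linear_combination -e1)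
    refine ⟨Fin.snoc f (π x), fun i => ?_, fun i j => ?_⟩
    · refine Fin.lastCases ?_ (fun i => ?_) i
      · rw [Fin.snoc_last]; exact hπψ x hx
      · rw [Fin.snoc_castSucc]; exact hfψ i
    · refine Fin.lastCases ?_ (fun i => ?_) i
      · refine Fin.lastCases ?_ (fun j => ?_) j
        · rw [Fin.snoc_last, if_pos rfl, hxx]
        · rw [Fin.snoc_last, Fin.snoc_castSucc, hπf, if_neg (Fin.castSucc_lt_last j).ne']
      · refine Fin.lastCases ?_ (fun j => ?_) j
        · rw [Fin.snoc_last, Fin.snoc_castSucc, hfπ, if_neg (Fin.castSucc_lt_last i).ne]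
        · rw [Fin.snoc_castSucc, Fin.snoc_castSucc, hff]
          simp only [Fin.castSucc_inj]

/-- In characteristic two, a nonsingular quaternary cubic form has a nodal triple or a Hermitian
quadruple. -/
theorem IsNonsingular.exists_isHermitianQuadruple {τ : Trilin k (Fin 4 → k)} (h2 : (2 : k) = 0)
    (hτ : IsNonsingular τ) (hno : ¬ ∃ a b c, IsNodalTriple τ a b c) :
    ∃ a b c d, IsHermitianQuadruple τ a b c d := by
  have : CharP k 2 := CharTwo.of_one_ne_zero_of_two_eq_zero one_ne_zero h2
  have htri := hτ.tri_eq_zero h2 hno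
  obtain ⟨ω, hω⟩ := exists_quadratic_root (one_ne_zero (α := k)) 1 1
  replace hω : ω ^ 2 + ω + 1 = 0 := by linear_combination hω
  obtain ⟨f, hf⟩ := exists_orthonormal htri hτ hω
  have hc : ∀ i, cub τ (f i) = 1 := fun i => by
    have := hf i i
    rw [dcub_self, if_pos rfl] at this
    linear_combination this - cub τ (f i) * h2
  -- In the basis f the surface is the Fermat cubic, and in characteristic 2 one has (x + ωt)³ + (x
  -- + ω²t)³ = x²t + xt².
  refine ⟨f 0 + f 3, f 1, f 2, ω • f 0 + ω ^ 2 • f 3, ?_, ?_, ?_, ?_, ?_, ?_, ?_, ?_, ?_, ?_, ?_, ?_,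
    ?_, ?_, ?_, ?_, htri _ _ _, htri _ _ _, htri _ _ _, htri _ _ _⟩ <;>
  simp only [cub_add, cub_smul, dcub_add_left, dcub_add_right, dcub_smul_left, dcub_smul_right, htri,
    hc, hf] <;> simp
  · linear_combination h2
  · linear_combination (ω - 1) * (ω ^ 3 + 2) * hω + h2
  · linear_combination hω - h2
  · linear_combination (ω ^ 2 - ω + 1) * hω - h2

end Hermitian

end CubicSRC

end

/-! ### Surfaces without nodal triples outside characteristic two. -/

noncomputable section

namespace CubicSRC

/-! ### Degenerate second fundamental forms outside characteristic two -/

section Frames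

variable {k : Type*} [Field k] {τ : Trilin k (Fin 4 → k)}

/-- Every vector is a combination of four linearly independent ones. -/
theorem exists_comb_four {a b c d : Fin 4 → k} (h : LinearIndependent k ![a, b, c, d])
    (y : Fin 4 → k) : ∃ s t q r : k, y = s • a + t • b + q • c + r • d := by
  have htop := h.span_eq_top_of_card_eq_finrank (by simp)
  obtain ⟨g, hg⟩ := (Submodule.mem_span_range_iff_exists_fun k).mp
    (htop ▸ Submodule.mem_top : y ∈ Submodule.span k (Set.range ![a, b, c, d]))
  refine ⟨g 0, g 1, g 2, g 3, ?_⟩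
  rw [← hg, Fin.sum_univ_four]
  rfl

theorem linearIndependent_four_iff {a b c d : Fin 4 → k} :
    LinearIndependent k ![a, b, c, d] ↔ ∀ s t q r : k, s • a + t • b + q • c + r • d = 0 →
      s = 0 ∧ t = 0 ∧ q = 0 ∧ r = 0 := by
  rw [Fintype.linearIndependent_iff]
  constructor
  · intro h s t q r hs
    have := h ![s, t, q, r] (by rw [Fin.sum_univ_four]; exact hs)
    exact ⟨this 0, this 1, this 2, this 3⟩
  · intro h g hg
    rw [Fin.sum_univ_four] at hg
    obtain ⟨h0, h1, h2, h3⟩ := h _ _ _ _ hg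
    intro i
    fin_cases i <;> assumption

theorem eq_zero_of_frame {a b c d : Fin 4 → k} (h : LinearIndependent k ![a, b, c, d])
    (f : (Fin 4 → k) →ₗ[k] k) (ha : f a = 0) (hb : f b = 0) (hc : f c = 0) (hd : f d = 0)
    (y : Fin 4 → k) : f y = 0 := by
  obtain ⟨s, t, q, r, rfl⟩ := exists_comb_four h y
  simp [ha, hb, hc, hd]

theorem exists_mem_linearIndependent_snoc {r : ℕ} {W : Submodule k (Fin 4 → k)}
    {f : Fin r → Fin 4 → k} (hf : LinearIndependent k f) (hr : r < Module.finrank k W) :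
    ∃ y ∈ W, LinearIndependent k (Fin.snoc f y : Fin (r + 1) → Fin 4 → k) := by
  by_contra! hcon
  have hle : W ≤ Submodule.span k (Set.range f) := fun y hy => by
    by_contra hy'
    exact hcon y hy (linearIndependent_finSnoc.mpr ⟨hf, hy'⟩)
  have h1 := Submodule.finrank_mono hle
  have h2 := finrank_range_le_card (R := k) f
  rw [Set.finrank, Fintype.card_fin] at h2
  omega

theorem finrank_ker_dcubLin {p y : Fin 4 → k} (hy : dcub τ p y ≠ 0) :
    Module.finrank k (LinearMap.ker (dcubLin τ p)) = 3 := by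
  have hne : dcubLin τ p ≠ 0 := fun h => hy (by rw [← dcubLin_apply, h, LinearMap.zero_apply])
  have h1 := LinearMap.finrank_range_add_finrank_ker (dcubLin τ p)
  rw [LinearMap.range_eq_top.mpr (LinearMap.surjective hne), finrank_top, Module.finrank_self,
    Module.finrank_fin_fun] at h1
  omega

/-- Completing two tangent vectors to a frame adapted to the tangent space. -/
theorem exists_frame (hτ : IsNonsingular τ) {p v : Fin 4 → k} (hp : cub τ p = 0)
    (hpv : LinearIndependent k ![p, v]) (hv : dcub τ p v = 0) :
    ∃ b u, dcub τ p b = 0 ∧ dcub τ p u = 1 ∧ LinearIndependent k ![p, v, b, u] := by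
  obtain ⟨y, hy⟩ := hτ p (hpv.ne_zero 0) hp
  have hpp : dcub τ p p = 0 := by rw [dcub_self, hp, mul_zero]
  obtain ⟨b, hb, hli⟩ := exists_mem_linearIndependent_snoc hpv
    (by rw [finrank_ker_dcubLin hy]; norm_num : 2 < Module.finrank k (LinearMap.ker (dcubLin τ p)))
  replace hb : dcub τ p b = 0 := hb
  refine ⟨b, (dcub τ p y)⁻¹ • y, hb, by rw [dcub_smul_right, inv_mul_cancel₀ hy], ?_⟩
  rw [linearIndependent_four_iff]
  intro s t q r h
  have hr : r = 0 := by
    have := congrArg (dcub τ p) h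
    simpa [dcub_add_right, dcub_smul_right, hpp, hv, hb, inv_mul_cancel₀ hy, dcub_zero_right]
      using this
  subst hr
  rw [Fintype.linearIndependent_iff] at hli
  have := hli ![s, t, q] (by
    rw [Fin.sum_univ_three]
    rw [zero_smul, add_zero] at h
    exact h)
  exact ⟨this 0, this 1, this 2, rfl⟩

theorem exists_tangent (hτ : IsNonsingular τ) {p : Fin 4 → k} (hp0 : p ≠ 0) (hp : cub τ p = 0) :
    ∃ v, dcub τ p v = 0 ∧ LinearIndependent k ![p, v] := by
  obtain ⟨y, hy⟩ := hτ p hp0 hp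
  have h1 : LinearIndependent k ![p] := by
    rw [linearIndependent_unique_iff]
    exact hp0
  obtain ⟨v, hv, hli⟩ := exists_mem_linearIndependent_snoc h1
    (by rw [finrank_ker_dcubLin hy]; norm_num : 1 < Module.finrank k (LinearMap.ker (dcubLin τ p)))
  refine ⟨v, hv, ?_⟩
  convert hli using 1
  ext i
  fin_cases i <;> rfl

end Frames

section OddCharacteristic

variable {k : Type*} [Field k] [IsAlgClosed k] {τ : Trilin k (Fin 4 → k)}

/-- A degenerate second fundamental form has a kernel. -/
theorem IsNonsingular.exists_tri_eq_zero (h2 : (2 : k) ≠ 0) (hτ : IsNonsingular τ)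
    (hno : ¬ ∃ a b c, IsNodalTriple τ a b c) {p : Fin 4 → k} (hp0 : p ≠ 0) (hp : cub τ p = 0) :
    ∃ v, LinearIndependent k ![p, v] ∧ ∀ y, tri τ p v y = 0 := by
  obtain ⟨y, hy, hpy⟩ := exists_tangent hτ hp0 hp
  obtain ⟨z, u, hz, hu, hli⟩ := exists_frame hτ hp hpy hy
  have hq := hτ.tri_sq_eq (Module.finrank_fin_fun k) hno hp hy hz
  have hpp : dcub τ p p = 0 := by rw [dcub_self, hp, mul_zero]
  have hzy : tri τ p z y = tri τ p y z := tri_swap_right _ _ _ _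
  -- The pair (α, β) is a kernel vector of the Gram matrix of the second fundamental form on y, z,
  -- whose determinant is zero by `hq`.
  obtain ⟨α, β, hαβ, e1, e2⟩ : ∃ α β : k, (α ≠ 0 ∨ β ≠ 0) ∧
      α * (2 * dcub τ y p) + β * tri τ p y z = 0 ∧
      α * tri τ p y z + β * (2 * dcub τ z p) = 0 := by
    by_cases hA : dcub τ y p = 0
    · rw [hA, mul_zero, zero_mul, sq_eq_zero_iff] at hq
      exact ⟨1, 0, Or.inl one_ne_zero, by rw [hA]; ring, by rw [hq]; ring⟩
    · exact ⟨- tri τ p y z, 2 * dcub τ y p, Or.inr (mul_ne_zero h2 hA), by ring, by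
        linear_combination -hq⟩
  set v₀ := α • y + β • z with hv₀
  have f1 : tri τ p v₀ y = 0 := by
    rw [hv₀, tri_add_mid, tri_smul_mid, tri_smul_mid, tri_self_right, hzy]; exact e1
  have f2 : tri τ p v₀ z = 0 := by
    rw [hv₀, tri_add_mid, tri_smul_mid, tri_smul_mid, tri_self_right]; exact e2
  have f3 : tri τ p v₀ p = 0 := by
    rw [tri_self_mid, hv₀, dcub_add_right, dcub_smul_right, dcub_smul_right, hy, hz]; ring
  -- Since tri τ p p u = 2, a multiple of p cancels the pairing with the transversal vector u
  -- without disturbing the tangential ones.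
  set γ := - (tri τ p v₀ u / 2) with hγ
  refine ⟨v₀ + γ • p, ?_, fun w => ?_⟩
  · rw [LinearIndependent.pair_iff]
    intro s t hst
    rw [linearIndependent_four_iff] at hli
    have := hli (s + t * γ) (t * α) (t * β) 0 (by rw [← hst, hv₀]; module)
    obtain ⟨g0, g1, g2, -⟩ := this
    have ht : t = 0 := by
      rcases hαβ with h | h
      · exact (mul_eq_zero.mp g1).resolve_right h
      · exact (mul_eq_zero.mp g2).resolve_right h
    rw [ht, zero_mul, add_zero] at g0
    exact ⟨g0, ht⟩
  · refine eq_zero_of_frame hli (triLin τ p (v₀ + γ • p)) ?_ ?_ ?_ ?_ w <;>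
    rw [triLin_apply, tri_add_mid, tri_smul_mid, tri_self_left]
    · rw [f3, hpp]; ring
    · rw [f1, hy]; ring
    · rw [f2, hz]; ring
    · rw [hu, hγ]; field_simp; ring

/-- The kernel vector of the polar quadric annihilates its Gram matrix in any frame. So the Hessian
determinant vanishes on the surface. -/
theorem IsNonsingular.det_tri_eq_zero (h2 : (2 : k) ≠ 0) (hτ : IsNonsingular τ)
    (hno : ¬ ∃ a b c, IsNodalTriple τ a b c) {p a b c d : Fin 4 → k} (hp0 : p ≠ 0)
    (hp : cub τ p = 0) (h : LinearIndependent k ![a, b, c, d]) :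
    (Matrix.of fun i j => tri τ p (![a, b, c, d] i) (![a, b, c, d] j)).det = 0 := by
  obtain ⟨v, hv, hv'⟩ := hτ.exists_tri_eq_zero h2 hno hp0 hp
  obtain ⟨s, t, q, r, hs⟩ := exists_comb_four h v
  rw [← Matrix.exists_mulVec_eq_zero_iff]
  refine ⟨![s, t, q, r], fun h0 => ?_, funext fun i => ?_⟩
  · have g0 : s = 0 := congrFun h0 0
    have g1 : t = 0 := congrFun h0 1
    have g2 : q = 0 := congrFun h0 2
    have g3 : r = 0 := congrFun h0 3
    rw [g0, g1, g2, g3] at hs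
    exact hv.ne_zero 1 (by simpa using hs)
  · have := hv' (![a, b, c, d] i)
    rw [tri_swap_right, hs] at this
    simp only [tri_add_right, tri_smul_right] at this
    simp only [Matrix.mulVec, dotProduct, Matrix.of_apply, Fin.sum_univ_four, Matrix.cons_val_zero,
      Matrix.cons_val_one, Matrix.cons_val, Pi.zero_apply]
    linear_combination this

end OddCharacteristic

end CubicSRC

end

noncomputable section

namespace CubicSRC

/-! ### The Hessian outside characteristic two -/

section Gram

variable {k : Type*} [Field k] {m : ℕ} (τ : Trilin k (Fin m → k))

/-- The matrix of the polar quadric of `x` in a family of vectors. -/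
def gram (x : Fin m → k) (e : Fin m → Fin m → k) : Matrix (Fin m) (Fin m) k :=
  Matrix.of fun i j => tri τ x (e i) (e j)

theorem gram_apply (x : Fin m → k) (e : Fin m → Fin m → k) (i j : Fin m) :
    gram τ x e i j = tri τ x (e i) (e j) := rfl

theorem gram_eq_mul (x : Fin m → k) (e : Fin m → Fin m → k) :
    gram τ x e = Matrix.of e * gram τ x (fun i => Pi.single i 1) * (Matrix.of e).transpose := by
  ext i j
  rw [Matrix.mul_apply, gram_apply, tri_eq_sum]
  refine Finset.sum_congr rfl fun l _ => ?_
  rw [Matrix.mul_apply, tri_swap_right, tri_eq_sum, Matrix.transpose_apply, Matrix.of_apply,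
    mul_comm]
  congr 1
  refine Finset.sum_congr rfl fun l' _ => ?_
  rw [gram_apply, tri_swap_right, Matrix.of_apply]

theorem det_gram (x : Fin m → k) (e : Fin m → Fin m → k) :
    (gram τ x e).det = (Matrix.of e).det ^ 2 * (gram τ x fun i => Pi.single i 1).det := by
  rw [gram_eq_mul, Matrix.det_mul, Matrix.det_mul, Matrix.det_transpose]
  ring

theorem gram_smul (t : k) (x : Fin m → k) (e : Fin m → Fin m → k) :
    gram τ (t • x) e = t • gram τ x e := by
  ext i j
  simp only [gram_apply, Matrix.smul_apply, tri_smul_left, smul_eq_mul]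

theorem isPolyFun_det_gram (e : Fin m → Fin m → k) : IsPolyFun fun x => (gram τ x e).det := by
  have h : ∀ i j, IsPolyFun fun x => tri τ x (e i) (e j) := fun i j => by
    have e1 : (fun x => tri τ x (e i) (e j)) = triLin τ (e i) (e j) := by
      ext x
      rw [triLin_apply, tri_swap_left, tri_swap_right]
    rw [e1]
    exact IsPolyFun.linear _
  choose P hP using h
  refine ⟨(Matrix.of fun i j => P i j).det, fun x => ?_⟩
  rw [RingHom.map_det]
  congr 1
  ext i j
  exact hP i j x

end Gram

section OddCharacteristic

variable {k : Type*} [Field k] [IsAlgClosed k] {τ : Trilin k (Fin 4 → k)}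

theorem exists_cubic_root {a : k} (ha : a ≠ 0) (b c d : k) :
    ∃ t, a * t ^ 3 + b * t ^ 2 + c * t + d = 0 := by
  obtain ⟨t, ht⟩ := IsAlgClosed.exists_root (Polynomial.C a * Polynomial.X ^ 3 +
    Polynomial.C b * Polynomial.X ^ 2 + Polynomial.C c * Polynomial.X + Polynomial.C d) (by
      rw [Polynomial.degree_cubic ha]; norm_num)
  exact ⟨t, by simpa using ht⟩

/-- If the Hessian form is divisible by the cubic form, the quotient vanishes at some point of the
surface. -/
theorem IsNonsingular.exists_det_gram_eq (h2 : (2 : k) ≠ 0) (hτ : IsNonsingular τ)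
    (hno : ¬ ∃ a b c, IsNodalTriple τ a b c) :
    ∃ (p : Fin 4 → k) (l : (Fin 4 → k) → k), p ≠ 0 ∧ cub τ p = 0 ∧ l p = 0 ∧ IsPolyFun l ∧
      ∀ x, (gram τ x fun i => Pi.single i 1).det = cub τ x * l x := by
  have : Infinite k := IsAlgClosed.instInfinite
  have hg := isPolyFun_det_gram τ fun i => Pi.single i 1
  have hli : LinearIndependent k (![Pi.single 0 1, Pi.single 1 1, Pi.single 2 1, Pi.single 3 1] :
      Fin 4 → Fin 4 → k) := by
    rw [linearIndependent_four_iff]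
    intro s t q r h
    exact ⟨by simpa using congrFun h 0, by simpa using congrFun h 1, by simpa using congrFun h 2,
      by simpa using congrFun h 3⟩
  have he : (![Pi.single 0 1, Pi.single 1 1, Pi.single 2 1, Pi.single 3 1] :
      Fin 4 → Fin 4 → k) = fun i => Pi.single i 1 := by
    ext i
    fin_cases i <;> rfl
  obtain ⟨l, hl, hgl⟩ := hτ.exists_eq_mul (by norm_num) hg fun x hx => by
    by_cases hx0 : x = 0
    · rw [hx0, ← zero_smul k (0 : Fin 4 → k), gram_smul, zero_smul, Matrix.det_zero]
    · have := hτ.det_tri_eq_zero h2 hno hx0 hx hli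
      rwa [he] at this
  -- The Hessian has degree 4 and the cubic degree 3, so l is homogeneous of degree 1; restricting
  -- to a line through the origin is enough to see l 0 = 0.
  have hl0 : l 0 = 0 := by
    obtain ⟨x, hx⟩ := hτ.exists_cub_ne_zero
    obtain ⟨f, hf⟩ := hl.exists_polynomial 0 x
    have h1 := eq_zero_of_forall_eval_ne_zero
      (p := Polynomial.X * Polynomial.C (gram τ x fun i => Pi.single i 1).det -
        Polynomial.C (cub τ x) * f) fun t ht => by
      have := hgl (t • x)
      rw [gram_smul, Matrix.det_smul, cub_smul, Fintype.card_fin] at this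
      simp only [Polynomial.eval_sub, Polynomial.eval_mul, Polynomial.eval_C, Polynomial.eval_X, hf,
        zero_add]
      refine mul_left_cancel₀ (pow_ne_zero 3 ht) ?_
      linear_combination this
    have h3 := congrArg (Polynomial.eval 0) h1
    simpa [hf, hx] using h3
  obtain ⟨p, hp0, hp⟩ := exists_ne_zero_common_zero (k := k) (r := 2) (m := 4) (by norm_num)
    (f := ![cub τ, l]) (fun i => by
      fin_cases i
      · exact IsPolyFun.cub τ
      · exact hl) (fun i => by
      fin_cases i
      · exact cub_zero τ
      · exact hl0)
  exact ⟨p, l, hp0, hp 0, hp 1, hl, hgl⟩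

/-- A point of the surface at which the Hessian vanishes to second order. -/
theorem IsNonsingular.exists_frame_of_hessian (h2 : (2 : k) ≠ 0) (hτ : IsNonsingular τ)
    (hno : ¬ ∃ a b c, IsNodalTriple τ a b c) :
    ∃ p v b u, cub τ p = 0 ∧ dcub τ p b = 0 ∧ dcub τ p u = 1 ∧
      LinearIndependent k ![p, v, b, u] ∧ (∀ y, tri τ p v y = 0) ∧
      ((∀ z, dcub τ v z = 0) ∨ dcub τ b p = 0) := by
  have : Infinite k := IsAlgClosed.instInfinite
  obtain ⟨p, l, hp0, hp, hlp, hl, hgl⟩ := hτ.exists_det_gram_eq h2 hno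
  obtain ⟨v, hpv, hv⟩ := hτ.exists_tri_eq_zero h2 hno hp0 hp
  have hpv' : dcub τ p v = 0 := by
    have := hv p
    rw [tri_self_mid] at this
    exact (mul_eq_zero.mp this).resolve_left h2
  obtain ⟨b, u, hb, hu, hli⟩ := exists_frame hτ hp hpv hpv'
  refine ⟨p, v, b, u, hp, hb, hu, hli, hv, ?_⟩
  by_contra! hcon
  obtain ⟨⟨z, hz⟩, hbp⟩ := hcon
  have hpp : dcub τ p p = 0 := by rw [dcub_self, hp, mul_zero]
  obtain ⟨f, hf⟩ := hl.exists_polynomial p z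
  set e : Fin 4 → Fin 4 → k := ![p, v, b, u] with he
  let G : Matrix (Fin 4) (Fin 4) (Polynomial k) := Matrix.of fun i j =>
    Polynomial.C (tri τ p (e i) (e j)) + Polynomial.X * Polynomial.C (tri τ z (e i) (e j))
  let r : Fin 4 → Polynomial k := fun j => Polynomial.C (tri τ z v (e j))
  -- The row of v in the Gram matrix vanishes at p, so along p + t z it is t times the corresponding
  -- row for z.
  have hG : G = G.updateRow 1 ((Polynomial.X : Polynomial k) • r) := by
    refine (Matrix.updateRow_eq_self G 1).symm.trans ?_
    congr 1
    ext1 j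
    change Polynomial.C (tri τ p v (e j)) + Polynomial.X * Polynomial.C (tri τ z v (e j)) = _
    rw [hv, Polynomial.C_0, zero_add]
    rfl
  have hGd : G.det = Polynomial.X * (G.updateRow 1 r).det := by
    conv_lhs => rw [hG, Matrix.det_updateRow_smul]
  have hGe : ∀ t, G.det.eval t = (gram τ (p + t • z) e).det := fun t => by
    rw [← Polynomial.coe_evalRingHom, RingHom.map_det]
    congr 1
    ext i j
    simp [G, gram_apply, tri_add_left, tri_smul_left, mul_comm t]
  -- Along p + t z the Hessian is a square times cub · l. Both sides are divisible by t since p lies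
  -- on the surface; after cancelling t, the condition l p = 0 still makes the value at t = 0
  -- vanish.
  have h1 := eq_zero_of_forall_eval_ne_zero
    (p := (G.updateRow 1 r).det - Polynomial.C ((Matrix.of e).det ^ 2) *
      (Polynomial.C (dcub τ p z) + Polynomial.X * Polynomial.C (dcub τ z p) +
        Polynomial.X ^ 2 * Polynomial.C (cub τ z)) * f) fun t ht => by
    have h3 := hGe t
    rw [hGd, det_gram, hgl, cub_add, hp, dcub_smul_right, dcub_smul_left, cub_smul,
      Polynomial.eval_mul, Polynomial.eval_X] at h3
    simp only [Polynomial.eval_sub, Polynomial.eval_mul, Polynomial.eval_add, Polynomial.eval_pow,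
      Polynomial.eval_C, Polynomial.eval_X, hf]
    refine mul_left_cancel₀ ht ?_
    linear_combination h3
  have h3 := congrArg (Polynomial.eval 0) h1
  rw [Polynomial.eval_sub, Polynomial.eval_mul (q := f), hf, zero_smul, add_zero, hlp, mul_zero,
    sub_zero, ← Polynomial.coe_evalRingHom, RingHom.map_det, map_zero] at h3
  -- The determinant of this matrix is, up to sign and powers of 2, the product of dcub τ b p and
  -- dcub τ v z, both nonzero by assumption.
  have h4 : (Polynomial.evalRingHom (0 : k)).mapMatrix (G.updateRow 1 r) =
      !![0, 0, 0, 2; tri τ z v p, tri τ z v v, tri τ z v b, tri τ z v u;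
        0, 0, 2 * dcub τ b p, tri τ p b u; 2, 0, tri τ p b u, 2 * dcub τ u p] := by
    have e1 : tri τ p b p = 0 := by rw [tri_self_mid, hb, mul_zero]
    have e2 : tri τ p u p = 2 := by rw [tri_self_mid, hu, mul_one]
    have e3 : ∀ y, tri τ p y v = 0 := fun y => by rw [tri_swap_right, hv]
    ext i j
    fin_cases i <;> fin_cases j <;>
      simp [G, r, Matrix.updateRow_apply, he, e1, e2, e3, tri_self_left, hpp, hb, hu,
        tri_self_right, tri_swap_right τ p u b]
  rw [h4, Matrix.det_succ_row_zero] at h3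
  simp [Fin.sum_univ_succ, Matrix.det_fin_three, Fin.succAbove, h2, hbp, tri_self_right, hz] at h3

end OddCharacteristic

end CubicSRC

end

noncomputable section

namespace CubicSRC

section OddCharacteristic

variable {k : Type*} [Field k] [IsAlgClosed k] {τ : Trilin k (Fin 4 → k)}

/-- A nonsingular cubic surface without nodal triples contains no line along which the second
fundamental form at one point is zero. -/
theorem IsNonsingular.not_line_of_flat (h2 : (2 : k) ≠ 0) (hτ : IsNonsingular τ)
    (hno : ¬ ∃ a b c, IsNodalTriple τ a b c) {p e₁ e₂ u : Fin 4 → k} (hp : cub τ p = 0)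
    (hli : LinearIndependent k ![p, e₁, e₂, u]) (h₁ : dcub τ p e₁ = 0) (h₂ : dcub τ p e₂ = 0)
    (hu : dcub τ p u = 1) (h₁p : dcub τ e₁ p = 0) (h₁₂ : tri τ p e₁ e₂ = 0) : cub τ e₁ ≠ 0 := by
  intro hc
  have hpp : dcub τ p p = 0 := by rw [dcub_self, hp, mul_zero]
  have hx : ∀ s : k, cub τ (s • p + e₁) = 0 := fun s => by
    rw [cub_add, cub_smul, dcub_smul_left, dcub_smul_right, hp, h₁, h₁p, hc]; ring
  have hd : ∀ (s : k) y, dcub τ (s • p + e₁) y =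
      s ^ 2 * dcub τ p y + s * tri τ p e₁ y + dcub τ e₁ y := fun s y => by
    rw [dcub_add_left, dcub_smul_left, tri_smul_left]
  -- The line through p and e₁ lies on the surface. If dcub τ e₁ e₂ = 0, the derivative at s p + e₁
  -- vanishes on p, e₁ and e₂ for all s, and a root of a quadratic equation in s makes it vanish on
  -- u as well: a singular point.
  by_cases hA : dcub τ e₁ e₂ = 0
  · obtain ⟨s, hs⟩ := exists_quadratic_root (one_ne_zero (α := k)) (tri τ p e₁ u) (dcub τ e₁ u)
    obtain ⟨y, hy⟩ := hτ (s • p + e₁) (fun h0 => by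
      have := (linearIndependent_four_iff.mp hli) s 1 0 0 (by rw [← h0]; module)
      exact one_ne_zero this.2.1) (hx s)
    refine hy (eq_zero_of_frame hli (dcubLin τ (s • p + e₁)) ?_ ?_ ?_ ?_ y) <;>
      rw [dcubLin_apply, hd]
    · rw [hpp, tri_self_mid, h₁, h₁p]; ring
    · rw [h₁, tri_self_right, h₁p, dcub_self, hc]; ring
    · rw [h₂, h₁₂, hA]; ring
    · rw [hu]; linear_combination hs
  -- At x = s p + e₁ the vectors p and y are tangent and p is isotropic for the second fundamental
  -- form. The choice of s gives tri τ x p y = 1, so the form is nondegenerate there.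
  · set s := (1 - tri τ p e₁ u) / 2 with hs
    set x := s • p + e₁ with hxdef
    have hxe : dcub τ x e₂ = dcub τ e₁ e₂ := by rw [hd, h₂, h₁₂]; ring
    set y := u - (dcub τ x u / dcub τ e₁ e₂) • e₂ with hy
    have hxy : dcub τ x y = 0 := by
      rw [hy, dcub_sub_right, dcub_smul_right, hxe]; field_simp; ring
    have hxp : dcub τ x p = 0 := by rw [hd, hpp, tri_self_mid, h₁, h₁p]; ring
    have hq := hτ.tri_sq_eq (Module.finrank_fin_fun k) hno (hx s) hxp hxy
    have hpx : dcub τ p x = 0 := by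
      rw [hxdef, dcub_add_right, dcub_smul_right, hpp, h₁]; ring
    have ht : tri τ x p y = 1 := by
      have e1 : tri τ x p y = 2 * s * dcub τ p y + tri τ p e₁ y := by
        rw [hxdef, tri_add_left, tri_smul_left, tri_self_left, tri_swap_left τ e₁]; ring
      have e2 : dcub τ p y = 1 := by
        rw [hy, dcub_sub_right, dcub_smul_right, h₂, hu]; ring
      have e3 : tri τ p e₁ y = tri τ p e₁ u := by
        have := map_sub (triLin τ p e₁) u ((dcub τ x u / dcub τ e₁ e₂) • e₂)
        rw [map_smul, triLin_apply, triLin_apply, triLin_apply, h₁₂, smul_zero, sub_zero] at this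
        exact this
      rw [e1, e2, e3, hs]; field_simp; ring
    rw [ht, hpx] at hq
    simp at hq

/-- If dcub τ b p were also zero, the second fundamental form at p would vanish and the tangent
plane section would be a cone over the zeros of a binary cubic in v and b. A zero of that cubic
gives a line excluded by `IsNonsingular.not_line_of_flat`. -/
theorem IsNonsingular.dcub_ne_zero_of_kernel (h2 : (2 : k) ≠ 0) (hτ : IsNonsingular τ)
    (hno : ¬ ∃ a b c, IsNodalTriple τ a b c) {p v b u : Fin 4 → k} (hp : cub τ p = 0)
    (hb : dcub τ p b = 0) (hu : dcub τ p u = 1) (hli : LinearIndependent k ![p, v, b, u])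
    (hv : ∀ y, tri τ p v y = 0) : dcub τ b p ≠ 0 := by
  intro hbp
  have hpv : dcub τ p v = 0 := by
    have := hv p
    rw [tri_self_mid] at this
    exact (mul_eq_zero.mp this).resolve_left h2
  have hvp : dcub τ v p = 0 := by
    have := hv v
    rw [tri_self_right] at this
    exact (mul_eq_zero.mp this).resolve_left h2
  by_cases hc : cub τ v = 0
  · exact hτ.not_line_of_flat h2 hno hp hli hpv hb hu hvp (hv b) hc
  · obtain ⟨s, hs⟩ := exists_cubic_root hc (dcub τ v b) (dcub τ b v) (cub τ b)
    refine hτ.not_line_of_flat h2 hno (e₁ := s • v + b) (e₂ := v) (u := u) hp ?_ ?_ hpv hu ?_ ?_ ?_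
    · rw [linearIndependent_four_iff] at hli ⊢
      intro x y z w h
      obtain ⟨g0, g1, g2, g3⟩ := hli x (y * s + z) y w (by rw [← h]; module)
      refine ⟨g0, g2, ?_, g3⟩
      rwa [g2, zero_mul, zero_add] at g1
    · rw [dcub_add_right, dcub_smul_right, hpv, hb]; ring
    · rw [dcub_add_left, dcub_smul_left, tri_smul_left, hvp, hbp, tri_swap_right, tri_swap_left, hv]
      ring
    · rw [tri_swap_right, hv]
    · rw [cub_add, cub_smul, dcub_smul_left, dcub_smul_right]; linear_combination hs

end OddCharacteristic

end CubicSRC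

end

/-! ### The remaining case of characteristic three. -/

noncomputable section

namespace CubicSRC

section CharThree

variable {k : Type*} [Field k]

theorem det_symm_four (x₀₀ x₀₁ x₀₂ x₁₁ x₁₂ x₂₂ q₁ q₂ : k) :
    (!![x₀₀, x₀₁, x₀₂, 0; x₀₁, x₁₁, x₁₂, q₁; x₀₂, x₁₂, x₂₂, q₂; 0, q₁, q₂, 0] :
      Matrix (Fin 4) (Fin 4) k).det =
      -(q₁ ^ 2 * (x₀₀ * x₂₂ - x₀₂ ^ 2) - 2 * q₁ * q₂ * (x₀₀ * x₁₂ - x₀₁ * x₀₂) +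
        q₂ ^ 2 * (x₀₀ * x₁₁ - x₀₁ ^ 2)) := by
  rw [Matrix.det_succ_row_zero]
  simp [Fin.sum_univ_succ, Matrix.det_fin_three, Fin.succAbove]
  ring

/-- A frame in which a cubic form over a field of characteristic three is
`x₀ ^ 2 * x₂ + α * x₀ * x₁ ^ 2 + c (x₁, x₂) + x₃ * q (x₁, x₂) + f * x₃ ^ 3`. -/
structure IsInseparableFrame (τ : Trilin k (Fin 4 → k)) (p b u v : Fin 4 → k) : Prop where
  li : LinearIndependent k ![p, b, u, v]
  cub_p : cub τ p = 0
  pb : dcub τ p b = 0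
  pu : dcub τ p u = 1
  pbu : tri τ p b u = 0
  up : dcub τ u p = 0
  bp : dcub τ b p ≠ 0
  pv : dcub τ p v = 0
  pvy : ∀ y, tri τ p v y = 0
  vy : ∀ y, dcub τ v y = 0
  cub_v : cub τ v ≠ 0

variable {τ : Trilin k (Fin 4 → k)} {p b u v : Fin 4 → k}

/-- The coordinate x₃ occurs only in the entries indexed by b and u. By `det_symm_four` the Hessian
is therefore affine in x₃. -/
theorem IsInseparableFrame.gram_eq (h3 : (3 : k) = 0) (h : IsInseparableFrame τ p b u v)
    (x₀ x₁ x₂ x₃ : k) :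
    (Matrix.of fun i j => tri τ (x₀ • p + x₁ • b + x₂ • u + x₃ • v) (![p, b, u, v] i)
      (![p, b, u, v] j)) =
    !![2 * x₂, 2 * dcub τ b p * x₁, 2 * x₀, 0;
      2 * dcub τ b p * x₁, 2 * (dcub τ b p * x₀ + x₂ * dcub τ b u + x₃ * dcub τ b v),
        2 * x₁ * dcub τ b u + 2 * x₂ * dcub τ u b + x₃ * tri τ b u v,
        2 * x₁ * dcub τ b v + x₂ * tri τ b u v;
      2 * x₀, 2 * x₁ * dcub τ b u + 2 * x₂ * dcub τ u b + x₃ * tri τ b u v,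
        2 * (x₁ * dcub τ u b + x₃ * dcub τ u v), x₁ * tri τ b u v + 2 * x₂ * dcub τ u v;
      0, 2 * x₁ * dcub τ b v + x₂ * tri τ b u v, x₁ * tri τ b u v + 2 * x₂ * dcub τ u v, 0] := by
  have hs : ∀ y, dcub τ y y = 0 := fun y => by rw [dcub_self, h3, zero_mul]
  have t1 : ∀ x y z, tri τ x y z = tri τ y x z := fun x y z => tri_swap_left _ _ _ _
  have t2 : ∀ x y z, tri τ x y z = tri τ x z y := fun x y z => tri_swap_right _ _ _ _
  have hpyv : ∀ y, tri τ p y v = 0 := fun y => by rw [t2, h.pvy]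
  have e1 : tri τ b p u = 0 := by rw [t1, h.pbu]
  have e2 : tri τ u p b = 0 := by rw [t1, t2, h.pbu]
  have e3 : ∀ y, tri τ v p y = 0 := fun y => by rw [t1, h.pvy]
  have e4 : ∀ y, tri τ v y p = 0 := fun y => by rw [t2, t1, h.pvy]
  have e5 : tri τ v b u = tri τ b u v := by rw [t1, t2]
  have e6 : tri τ u b v = tri τ b u v := by rw [t1]
  have e7 : ∀ y, tri τ y p v = 0 := fun y => by rw [t1, hpyv]
  have key : ∀ y z, tri τ (x₀ • p + x₁ • b + x₂ • u + x₃ • v) y z =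
      x₀ * tri τ p y z + x₁ * tri τ b y z + x₂ * tri τ u y z + x₃ * tri τ v y z := fun y z => by
    simp only [tri_add_left, tri_smul_left]
  have hsymm : ∀ i j, tri τ (x₀ • p + x₁ • b + x₂ • u + x₃ • v) (![p, b, u, v] i)
      (![p, b, u, v] j) = tri τ (x₀ • p + x₁ • b + x₂ • u + x₃ • v) (![p, b, u, v] j)
      (![p, b, u, v] i) := fun i j => t2 _ _ _
  have a00 : tri τ (x₀ • p + x₁ • b + x₂ • u + x₃ • v) p p = 2 * x₂ := by
    rw [key]; simp only [tri_self_right, hs, h.pb, h.pu, h.pv]; ring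
  have a01 : tri τ (x₀ • p + x₁ • b + x₂ • u + x₃ • v) p b = 2 * dcub τ b p * x₁ := by
    rw [key, tri_self_left, tri_self_mid, e2, e3, h.pb]; ring
  have a02 : tri τ (x₀ • p + x₁ • b + x₂ • u + x₃ • v) p u = 2 * x₀ := by
    rw [key, tri_self_left, e1, tri_self_mid, e3, h.pu, h.up]; ring
  have a03 : tri τ (x₀ • p + x₁ • b + x₂ • u + x₃ • v) p v = 0 := by
    rw [key]; simp only [e7]; ring
  have a11 : tri τ (x₀ • p + x₁ • b + x₂ • u + x₃ • v) b b =
      2 * (dcub τ b p * x₀ + x₂ * dcub τ b u + x₃ * dcub τ b v) := by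
    rw [key]; simp only [tri_self_right, hs]; ring
  have a12 : tri τ (x₀ • p + x₁ • b + x₂ • u + x₃ • v) b u =
      2 * x₁ * dcub τ b u + 2 * x₂ * dcub τ u b + x₃ * tri τ b u v := by
    rw [key, h.pbu, tri_self_left, tri_self_mid, e5]; ring
  have a13 : tri τ (x₀ • p + x₁ • b + x₂ • u + x₃ • v) b v =
      2 * x₁ * dcub τ b v + x₂ * tri τ b u v := by
    rw [key, hpyv, tri_self_left, e6, tri_self_mid, h.vy]; ring
  have a22 : tri τ (x₀ • p + x₁ • b + x₂ • u + x₃ • v) u u =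
      2 * (x₁ * dcub τ u b + x₃ * dcub τ u v) := by
    rw [key]; simp only [tri_self_right, hs, h.up]; ring
  have a23 : tri τ (x₀ • p + x₁ • b + x₂ • u + x₃ • v) u v =
      x₁ * tri τ b u v + 2 * x₂ * dcub τ u v := by
    rw [key, hpyv, tri_self_left, tri_self_mid, h.vy]; ring
  have a33 : tri τ (x₀ • p + x₁ • b + x₂ • u + x₃ • v) v v = 0 := by
    rw [key]; simp only [tri_self_right, h.vy]; ring
  ext i j
  fin_cases i <;> fin_cases j
  · exact a00
  · exact a01
  · exact a02
  · exact a03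
  · exact (t2 _ _ _).trans a01
  · exact a11
  · exact a12
  · exact a13
  · exact (t2 _ _ _).trans a02
  · exact (t2 _ _ _).trans a12
  · exact a22
  · exact a23
  · exact (t2 _ _ _).trans a03
  · exact (t2 _ _ _).trans a13
  · exact (t2 _ _ _).trans a23
  · exact a33

variable [IsAlgClosed k]

/-- If the quadratic form takes a nonzero value Q at (x₁, x₂), the equation of the surface in x₃ has
two distinct roots for every x₀. The Hessian, affine in x₃, vanishes at both and hence also at x₃ =
0. Comparing powers of x₀ then contradicts the Euler relation x₁Q₁ + x₂Q₂ = 2Q. -/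
theorem IsInseparableFrame.quadratic_eq_zero (h2 : (2 : k) ≠ 0) (h3 : (3 : k) = 0)
    (hτ : IsNonsingular τ) (hno : ¬ ∃ a b c, IsNodalTriple τ a b c)
    (h : IsInseparableFrame τ p b u v) (x₁ x₂ : k) :
    x₁ ^ 2 * dcub τ b v + x₁ * x₂ * tri τ b u v + x₂ ^ 2 * dcub τ u v = 0 := by
  by_contra hQ
  set Q := x₁ ^ 2 * dcub τ b v + x₁ * x₂ * tri τ b u v + x₂ ^ 2 * dcub τ u v with hQdef
  set Q₁ := 2 * x₁ * dcub τ b v + x₂ * tri τ b u v with hQ₁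
  set Q₂ := x₁ * tri τ b u v + 2 * x₂ * dcub τ u v with hQ₂
  have hE : ∀ x₀ : k, Q₁ ^ 2 * (2 * x₂ * (2 * (x₁ * dcub τ u b)) - (2 * x₀) ^ 2) -
      2 * Q₁ * Q₂ * (2 * x₂ * (2 * x₁ * dcub τ b u + 2 * x₂ * dcub τ u b) -
        2 * dcub τ b p * x₁ * (2 * x₀)) +
      Q₂ ^ 2 * (2 * x₂ * (2 * (dcub τ b p * x₀ + x₂ * dcub τ b u)) -
        (2 * dcub τ b p * x₁) ^ 2) = 0 := by
    intro x₀
    set w := x₀ • p + x₁ • b + x₂ • u with hw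
    have hwv : dcub τ w v = Q := by
      rw [hw, dcub_comb_three, h.pv, tri_swap_right τ p b, tri_swap_right τ p u, h.pvy, h.pvy]
      ring
    have hcub : ∀ t, cub τ (w + t • v) = cub τ v * t ^ 3 + 0 * t ^ 2 + Q * t + cub τ w := by
      intro t
      rw [cub_add, cub_smul, dcub_smul_right, dcub_smul_left, hwv, h.vy]; ring
    -- In characteristic 3 the polynomial f t³ + Q t, with f = cub τ v, is additive. A nonzero d
    -- with f d² + Q = 0 thus carries the root r to another root r + d.
    obtain ⟨r, hr⟩ := exists_cubic_root h.cub_v 0 Q (cub τ w)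
    obtain ⟨d, hd⟩ := exists_quadratic_root h.cub_v 0 Q
    have hd0 : d ≠ 0 := by
      rintro rfl
      exact hQ (by linear_combination hd)
    have hdet : ∀ t, cub τ (w + t • v) = 0 → _ := fun t ht =>
      hτ.det_tri_eq_zero h2 hno (p := w + t • v) (fun h0 => by
        obtain ⟨-, g1, g2, -⟩ := (linearIndependent_four_iff.mp h.li) x₀ x₁ x₂ t h0
        rw [g1, g2] at hQdef
        exact hQ (by rw [hQdef]; ring)) ht h.li
    have d1 := hdet r ((hcub r).trans hr)
    have d2 := hdet (r + d) ((hcub _).trans (by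
      linear_combination hr + d * hd + (cub τ v * (r ^ 2 * d + r * d ^ 2)) * h3))
    rw [hw, h.gram_eq h3, det_symm_four, neg_eq_zero, ← hQ₁, ← hQ₂] at d1 d2
    have d3 : d * (Q₁ ^ 2 * (2 * x₂ * (2 * dcub τ u v)) -
        2 * Q₁ * Q₂ * (2 * x₂ * tri τ b u v) + Q₂ ^ 2 * (2 * x₂ * (2 * dcub τ b v))) = 0 := by
      linear_combination d2 - d1
    have d4 := (mul_eq_zero.mp d3).resolve_left hd0
    linear_combination d1 - r * d4
  have h8 : (8 : k) ≠ 0 := by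
    have : (8 : k) = 2 ^ 3 := by norm_num
    rw [this]
    exact pow_ne_zero 3 h2
  -- The second difference in x₀ isolates the coefficient of x₀²; the first difference below
  -- isolates that of x₀.
  have f1 : Q₁ = 0 := by
    have : 8 * Q₁ ^ 2 = 0 := by linear_combination 2 * hE 0 - hE 1 - hE (-1)
    exact pow_eq_zero_iff (two_ne_zero) |>.mp ((mul_eq_zero.mp this).resolve_left h8)
  have f2 : Q₂ ^ 2 * x₂ = 0 := by
    have e0 := hE 1
    have e1 := hE (-1)
    rw [f1] at e0 e1
    have : 8 * dcub τ b p * (Q₂ ^ 2 * x₂) = 0 := by linear_combination e0 - e1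
    exact (mul_eq_zero.mp this).resolve_left (mul_ne_zero h8 h.bp)
  have f3 : x₁ * Q₁ + x₂ * Q₂ = 2 * Q := by rw [hQ₁, hQ₂, hQdef]; ring
  rw [f1, mul_zero, zero_add] at f3
  have f4 : x₂ * Q₂ ≠ 0 := by rw [f3]; exact mul_ne_zero h2 hQ
  rcases mul_eq_zero.mp f2 with f | f
  · exact f4 (by rw [pow_eq_zero_iff two_ne_zero |>.mp f, mul_zero])
  · exact f4 (by rw [f, zero_mul])

/-- The cubic is now a ternary form in the coordinates of p, b, u plus f x₃³, whose last term has
zero derivative. A critical point of the ternary form becomes a singular point of the surface once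
x₃ is chosen as a cube root that places it there. -/
theorem IsInseparableFrame.false (h2 : (2 : k) ≠ 0) (h3 : (3 : k) = 0)
    (hτ : IsNonsingular τ) (hno : ¬ ∃ a b c, IsNodalTriple τ a b c)
    (h : IsInseparableFrame τ p b u v) : False := by
  have hq := h.quadratic_eq_zero h2 h3 hτ hno
  have q1 : dcub τ b v = 0 := by linear_combination hq 1 0
  have q2 : dcub τ u v = 0 := by linear_combination hq 0 1
  have q12 : tri τ b u v = 0 := by linear_combination hq 1 1 - q1 - q2
  have hs : ∀ y, dcub τ y y = 0 := fun y => by rw [dcub_self, h3, zero_mul]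
  have h2α : 2 * dcub τ b p ^ 2 ≠ 0 := mul_ne_zero h2 (pow_ne_zero 2 h.bp)
  obtain ⟨ξ, hξ⟩ := exists_cubic_root h2α 0 (2 * dcub τ b u) (dcub τ u b)
  -- With α = dcub τ b p, the coefficient α ξ² makes the derivative along p equal to 3αξ² = 0, and ξ
  -- was chosen to kill the derivative along b. The derivative along u follows from the Euler
  -- relation, since 3 = 0.
  set x := (dcub τ b p * ξ ^ 2) • p + ξ • b + (1 : k) • u with hx
  have t1 : ∀ x y z, tri τ x y z = tri τ y x z := fun x y z => tri_swap_left _ _ _ _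
  have t2 : ∀ x y z, tri τ x y z = tri τ x z y := fun x y z => tri_swap_right _ _ _ _
  have hpyv : ∀ y, tri τ p y v = 0 := fun y => by rw [t2, h.pvy]
  have hxp : dcub τ x p = 0 := by
    have e : tri τ b u p = 0 := by rw [t2, t1, h.pbu]
    rw [hx, dcub_comb_three, hs, h.up, tri_self_mid, tri_self_mid, e, h.pb, h.pu]
    linear_combination dcub τ b p * ξ ^ 2 * h3
  have hxb : dcub τ x b = 0 := by
    rw [hx, dcub_comb_three, h.pb, hs, tri_self_right, tri_self_mid, t2 p u b, h.pbu]
    linear_combination hξ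
  have hxu : dcub τ x u = 0 := by
    have := hs x
    nth_rw 2 [hx] at this
    rw [dcub_add_right, dcub_add_right, dcub_smul_right, dcub_smul_right, dcub_smul_right, hxp,
      hxb] at this
    linear_combination this
  have hxv : dcub τ x v = 0 := by
    rw [hx, dcub_comb_three, h.pv, q1, q2, hpyv, hpyv, q12]; ring
  have hxvy : ∀ y, tri τ x v y = 0 := by
    have e : ∀ y, tri τ x v y = (dcub τ b p * ξ ^ 2) * tri τ p v y + ξ * tri τ b v y +
        tri τ u v y := fun y => by
      rw [hx]; simp only [tri_add_left, tri_smul_left]; ring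
    refine eq_zero_of_frame h.li (triLin τ x v) ?_ ?_ ?_ ?_ <;> rw [triLin_apply, e, h.pvy]
    · rw [t2, t1, hpyv, t2 u, t1 u, hpyv]; ring
    · rw [tri_self_mid, q1, t2, t1, q12]; ring
    · rw [t2, q12, tri_self_mid, q2]; ring
    · rw [tri_self_right, tri_self_right, h.vy, h.vy]; ring
  obtain ⟨ζ, hζ⟩ := exists_cubic_root h.cub_v 0 0 (cub τ x)
  obtain ⟨y, hy⟩ := hτ (x + ζ • v) (fun h0 => by
      have := (linearIndependent_four_iff.mp h.li) _ _ _ _ h0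
      exact one_ne_zero this.2.2.1) (by
    rw [cub_add, cub_smul, dcub_smul_right, dcub_smul_left, hxv, h.vy]; linear_combination hζ)
  have hX : ∀ y, dcub τ (x + ζ • v) y = dcub τ x y := fun y => by
    rw [dcub_add_left, dcub_smul_left, tri_smul_mid, hxvy, h.vy]; ring
  rw [hX] at hy
  exact hy (eq_zero_of_frame h.li (dcubLin τ x) hxp hxb hxu hxv y)

/-- Outside characteristic two every nonsingular cubic surface has a nodal triple. -/
theorem IsNonsingular.exists_isNodalTriple_of_two_ne_zero (h2 : (2 : k) ≠ 0)
    (hτ : IsNonsingular τ) : ∃ a b c, IsNodalTriple τ a b c := by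
  by_contra hno
  obtain ⟨p, v, b, u, hp, hb, hu, hli, hv, hor⟩ := hτ.exists_frame_of_hessian h2 hno
  have hbp := hτ.dcub_ne_zero_of_kernel h2 hno hp hb hu hli hv
  have hvy := hor.resolve_right hbp
  have hcv : cub τ v ≠ 0 := fun hc => by
    obtain ⟨y, hy⟩ := hτ v (hli.ne_zero 1) hc
    exact hy (hvy y)
  -- The derivative at v vanishes although v is not on the surface, so 3 cub τ v = 0 forces
  -- characteristic 3.
  have h3 : (3 : k) = 0 := by
    have := hvy v
    rw [dcub_self] at this
    exact (mul_eq_zero.mp this).resolve_right hcv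
  have hpp : dcub τ p p = 0 := by rw [dcub_self, hp, mul_zero]
  have hpv : dcub τ p v = 0 := by
    have := hv p
    rw [tri_self_mid] at this
    exact (mul_eq_zero.mp this).resolve_left h2
  -- Completing the square: t removes the mixed term x₀x₁x₂, and s below removes x₀x₂².
  set t := -(tri τ p b u / (2 * dcub τ b p)) with ht
  set w := u + t • b with hw
  set s := -(dcub τ w p / 2) with hs
  have hpw : dcub τ p w = 1 := by rw [hw, dcub_add_right, dcub_smul_right, hb, hu]; ring
  refine IsInseparableFrame.false (p := p) (b := b) (u := w + s • p) (v := v) h2 h3 hτ hno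
    ⟨?_, hp, hb, ?_, ?_, ?_, hbp, hpv, hv, hvy, hcv⟩
  · rw [linearIndependent_four_iff] at hli ⊢
    intro x y z r h
    obtain ⟨g0, g1, g2, g3⟩ := hli (x + z * s) r (y + z * t) z (by rw [← h, hw]; module)
    rw [g3, zero_mul, add_zero] at g0 g2
    exact ⟨g0, g2, g3, g1⟩
  · rw [dcub_add_right, dcub_smul_right, hpw, hpp]; ring
  · rw [tri_add_right, tri_smul_right, tri_self_mid, hb, hw, tri_add_right, tri_smul_right,
      tri_self_right, ht]
    field_simp
    ring
  · rw [dcub_add_left, dcub_smul_left, hpp, tri_smul_mid, tri_self_right, hpw, hs]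
    field_simp
    ring

end CharThree

end CubicSRC

end

/-! ### Assembly of the curves, the linear subspaces and the final statement. -/

noncomputable section

namespace CubicSRC

/-! ### Very free curves on smooth cubic hypersurfaces -/

section Main

open MvPolynomial

theorem X_notMem_span_of_isHomogeneous {k σ : Type*} [Field k] {d : ℕ} {F : MvPolynomial σ k}
    (hF : F.IsHomogeneous d) (hF0 : F ≠ 0) (hd : 1 < d) (j : σ) :
    (X j : MvPolynomial σ k) ∉ Ideal.span {F} := by
  rw [Ideal.mem_span_singleton]
  rintro ⟨G, hG⟩
  have hG0 : G ≠ 0 := by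
    rintro rfl
    exact X_ne_zero (R := k) j (by rw [hG, mul_zero])
  have h := congrArg totalDegree hG
  rw [totalDegree_X, totalDegree_mul_of_isDomain hF0 hG0, hF.totalDegree hF0] at h
  omega

theorem IsNodalTriple.linearIndependent {k V : Type*} [Field k] [AddCommGroup V] [Module k V]
    {τ : Trilin k V} {a b c : V} (h : IsNodalTriple τ a b c) : LinearIndependent k ![a, b, c] := by
  rw [Fintype.linearIndependent_iff]
  intro g hg
  rw [Fin.sum_univ_three] at hg
  replace hg : g 0 • a + g 1 • b + g 2 • c = 0 := hg
  have e : ∀ y z, g 0 * tri τ y z a + g 1 * tri τ y z b + g 2 * tri τ y z c = 0 := fun y z => by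
    have := congrArg (triLin τ y z) hg
    simpa only [map_add, map_smul, map_zero, triLin_apply, smul_eq_mul] using this
  have h0 : g 0 = 0 := by
    have := e b c
    rw [tri_self_mid, tri_self_right, h.bc, h.cb, tri_swap_right, tri_swap_left, h.abc] at this
    linear_combination this
  have h1 : g 1 = 0 := by
    have := e a c
    rw [tri_self_mid, tri_self_right, h.ac, h.ca, tri_swap_right, h.abc] at this
    linear_combination this
  have h2 : g 2 = 0 := by
    have := e a b
    rw [tri_self_mid, tri_self_right, h.ab, h.ba, h.abc] at this
    linear_combination this
  intro i
  fin_cases i <;> assumption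

/-- Linear forms vanishing on `L` vanish on a curve parametrized by combinations of elements of
`L`. -/
theorem sum_C_mul_eq_zero_of_mem {k σ : Type*} [Field k] {m r : ℕ} {L : Submodule k (Fin m → k)}
    {e : Fin r → Fin m → k} (he : ∀ i, e i ∈ L) (q : Fin r → MvPolynomial σ k) (c : Fin m → k)
    (hc : ∀ v ∈ L, ∑ j, c j * v j = 0) : ∑ j, C (c j) * ∑ i, C (e i j) * q i = 0 := by
  simp_rw [Finset.mul_sum]
  rw [Finset.sum_comm]
  refine Finset.sum_eq_zero fun i _ => ?_
  simp_rw [← mul_assoc, ← C_mul]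
  rw [← Finset.sum_mul, ← map_sum, hc _ (he i), C_0, zero_mul]

variable {k : Type*} [Field k] [IsAlgClosed k] {j : ℕ} {F : MvPolynomial (Fin (j + 3 + 1)) k}
  {τ : Trilin k (Fin (j + 3 + 1) → k)}

theorem exists_isVeryFreeTuple_plane (h2 : (2 : k) ≠ 0) (hτ : IsNonsingular τ)
    (hF : ∀ x, eval x F = cub τ x) (hD : ∀ x y, ∑ a, y a * eval x (pderiv a F) = dcub τ x y) :
    ∃ h, IsVeryFreeTuple F h ∧ ∃ L : Submodule k (Fin (j + 3 + 1) → k), Module.finrank k L = 3 ∧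
      ∀ c : Fin (j + 3 + 1) → k, (∀ v ∈ L, ∑ i, c i * v i = 0) → ∑ i, C (c i) * h i = 0 := by
  have : Infinite k := IsAlgClosed.instInfinite
  obtain ⟨f, -, hf⟩ := hτ.exists_four
  obtain ⟨a, b, c, habc⟩ := hf.exists_isNodalTriple_of_two_ne_zero h2
  have hn : IsNodalTriple τ (f a) (f b) (f c) := ⟨habc.1, habc.2, habc.3, habc.4, habc.5, habc.6,
    habc.7, habc.8, habc.9, habc.10⟩
  exact ⟨_, hn.isVeryFreeTuple hF hD, Submodule.span k (Set.range ![f a, f b, f c]),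
    finrank_span_eq_card hn.linearIndependent,
    sum_C_mul_eq_zero_of_mem (fun i => Submodule.subset_span (Set.mem_range_self i)) _⟩

theorem exists_isVeryFreeTuple_solid (h2 : (2 : k) = 0) (hτ : IsNonsingular τ)
    (hF : ∀ x, eval x F = cub τ x) (hD : ∀ x y, ∑ a, y a * eval x (pderiv a F) = dcub τ x y) :
    ∃ h, IsVeryFreeTuple F h ∧ ∃ L : Submodule k (Fin (j + 3 + 1) → k), Module.finrank k L = 4 ∧
      ∀ c : Fin (j + 3 + 1) → k, (∀ v ∈ L, ∑ i, c i * v i = 0) → ∑ i, C (c i) * h i = 0 := by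
  have : Infinite k := IsAlgClosed.instInfinite
  obtain ⟨f, hinj, hf⟩ := hτ.exists_four
  have hL : Module.finrank k (LinearMap.range f) = 4 := by
    rw [LinearMap.finrank_range_of_inj hinj, Module.finrank_fin_fun]
  -- In characteristic 2 either curve may occur. In both cases L is the four-dimensional image of f,
  -- even when the curve is plane.
  by_cases hno : ∃ a b c, IsNodalTriple (τ.pull f) a b c
  · obtain ⟨a, b, c, habc⟩ := hno
    have hn : IsNodalTriple τ (f a) (f b) (f c) := ⟨habc.1, habc.2, habc.3, habc.4, habc.5, habc.6,
      habc.7, habc.8, habc.9, habc.10⟩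
    exact ⟨_, hn.isVeryFreeTuple hF hD, _, hL, sum_C_mul_eq_zero_of_mem (fun i => by
      fin_cases i <;> exact LinearMap.mem_range_self f _) _⟩
  · obtain ⟨a, b, c, d, ⟨g1, g2, g3, g4, g5, g6, g7, g8, g9, g10, g11, g12, g13, g14, g15, g16, g17,
      g18, g19, g20⟩⟩ := hf.exists_isHermitianQuadruple h2 hno
    have hn : IsHermitianQuadruple τ (f a) (f b) (f c) (f d) := ⟨g1, g2, g3, g4, g5, g6, g7, g8, g9,
      g10, g11, g12, g13, g14, g15, g16, g17, g18, g19, g20⟩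
    exact ⟨_, hn.isVeryFreeTuple h2 hF hD, _, hL, sum_C_mul_eq_zero_of_mem (fun i => by
      fin_cases i <;> exact LinearMap.mem_range_self f _) _⟩

theorem ringChar_eq_two_iff {k : Type*} [Field k] : ringChar k = 2 ↔ (2 : k) = 0 := by
  constructor
  · intro h
    have := ringChar.spec k 2
    rw [h] at this
    exact_mod_cast this.mpr dvd_rfl
  · intro h
    have h1 : ringChar k ∣ 2 := (ringChar.spec k 2).mp (by exact_mod_cast h)
    rcases (Nat.dvd_prime Nat.prime_two).mp h1 with h | h
    · exact absurd h CharP.ringChar_ne_one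
    · exact h

end Main

end CubicSRC

end

theorem mainTheorem1 {k : Type u} [Field k] [IsAlgClosed k] (n : ℕ) (hn : 3 ≤ n)
    {X : Scheme.{u}} (i : X ⟶ CubicSRC.PP k n) (hX : CubicSRC.IsHypersurface 3 i)
    (hsm : Smooth (i ≫ CubicSRC.PP.toSpec k n)) :
    (∃ h : CubicSRC.PP k 1 ⟶ X,
      CubicSRC.IsVeryFree (i ≫ CubicSRC.PP.toSpec k n) h ∧
      (ringChar k ≠ 2 → ∃ L : Submodule k (Fin (n + 1) → k), Module.finrank k L = 3 ∧
        Set.range (h ≫ i) ⊆ CubicSRC.linearSubspace L) ∧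
      (ringChar k = 2 → ∃ L : Submodule k (Fin (n + 1) → k), Module.finrank k L = 4 ∧
        Set.range (h ≫ i) ⊆ CubicSRC.linearSubspace L)) ∧
    CubicSRC.IsSeparablyRationallyConnected (i ≫ CubicSRC.PP.toSpec k n) := by
  obtain ⟨j, rfl⟩ := Nat.exists_eq_add_of_le' hn
  obtain ⟨hi, F, hF, hF0, hker⟩ := hX
  obtain ⟨τ, hFτ, hD⟩ := CubicSRC.exists_trilin_of_isHomogeneous hF
  have hτ : CubicSRC.IsNonsingular τ := fun p hp hp0 => by
    obtain ⟨l, hl⟩ := CubicSRC.exists_pderiv_ne_zero hF hF0 hker hsm p hp ((hFτ p).trans hp0)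
    refine ⟨Pi.single l 1, fun h0 => hl ?_⟩
    rw [← hD] at h0
    simpa [Pi.single_apply] using h0
  have hprime : (Ideal.span {F}).IsPrime := (Ideal.span_singleton_prime hF0).mpr
    (CubicSRC.prime_of_isNonsingular (by omega) hτ hFτ)
  have hint : AlgebraicGeometry.IsIntegral X := CubicSRC.isIntegral_of_isPrime three_pos hF hker
    hprime ⟨0, CubicSRC.X_notMem_span_of_isHomogeneous hF hF0 (by norm_num) 0⟩
  have key : ∃ h : CubicSRC.PP k 1 ⟶ X,
      CubicSRC.IsVeryFree (i ≫ CubicSRC.PP.toSpec k (j + 3)) h ∧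
      (ringChar k ≠ 2 → ∃ L : Submodule k (Fin (j + 3 + 1) → k), Module.finrank k L = 3 ∧
        Set.range (h ≫ i) ⊆ CubicSRC.linearSubspace L) ∧
      (ringChar k = 2 → ∃ L : Submodule k (Fin (j + 3 + 1) → k), Module.finrank k L = 4 ∧
        Set.range (h ≫ i) ⊆ CubicSRC.linearSubspace L) := by
    by_cases h2 : (2 : k) = 0
    · obtain ⟨h, hv, L, hL, hL'⟩ := CubicSRC.exists_isVeryFreeTuple_solid h2 hτ hFτ hD
      obtain ⟨g, hg, hgL⟩ := hv.exists_isVeryFree hF hker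
      exact ⟨g, hg, fun h => absurd (CubicSRC.ringChar_eq_two_iff.mpr h2) h,
        fun _ => ⟨L, hL, hgL L hL'⟩⟩
    · obtain ⟨h, hv, L, hL, hL'⟩ := CubicSRC.exists_isVeryFreeTuple_plane h2 hτ hFτ hD
      obtain ⟨g, hg, hgL⟩ := hv.exists_isVeryFree hF hker
      exact ⟨g, hg, fun _ => ⟨L, hL, hgL L hL'⟩,
        fun h => absurd (CubicSRC.ringChar_eq_two_iff.mp h) h2⟩
  refine ⟨key, hint, hsm, ⟨_, i, hi, rfl⟩, ?_⟩
  obtain ⟨h, hh, -⟩ := key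
  exact ⟨h, hh⟩
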